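/- Let $d\ge 1$, $\nu>0$, and $p>1$ with $p\ge 1+\frac d2$, and let $\mathbb T^d=(\mathbb R/\mathbb Z)^d$ carry Lebesgue measure. Let $\mathcal V$ be the set of $\mathbb R^d$-valued, divergence-free, mean-zero trigonometric polynomials on $\mathbb T^d$, and for $q\in[1,\infty)$, $\alpha\in\mathbb R$ let $V_{q,\alpha}$ be the completion of $\mathcal V$ for the norm $\|v\|_{q,\alpha}=\|(1-\Delta)^{\alpha/2}v\|_{L_q(\mathbb T^d)}$. Write $\|\cdot\|_2=\|\cdot\|_{2,0}$, $p'=\frac{p}{p-1}$, and let $\langle\cdot,\cdot\rangle$ be the $L_2$ inner product and its extension to a pairing. For $v\in V_{p,1}\cap V_{2,0}$ put $$e(v)=\Bigl(\tfrac{\partial_iv_j+\partial_jv_i}{2}\Bigr)_{i,j},\qquad \tau(v)=2\nu\,(1+|e(v)|^2)^{(p-2)/2}e(v),$$ and define $b(v)$ as a linear functional on $\mathcal V$ by $$\langle\varphi,b(v)\rangle=\langle v,(v\cdot\nabla)\varphi\rangle-\langle e(\varphi),\tau(v)\rangle .$$ Let $\Gamma:V_{2,0}\to V_{2,0}$ be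 a bounded, self-adjoint, nonnegative definite operator of trace class and $\mu_0$ a Borel probability measure on $V_{2,0}$. A $V_{2,0}$-valued Brownian motion with covariance $\Gamma$ is a process $(Y_t)_{t\ge0}$ with paths in $C([0,\infty)\to V_{2,0})$ such that, for all $\varphi\in V_{2,0}$ and $0\le s<t$, almost surely $E[e^{\mathbf i\langle\varphi,Y_t-Y_s\rangle}\mid (Y_u)_{u\le s}]=e^{-\frac{t-s}{2}\langle\varphi,\Gamma\varphi\rangle}$. A process $(X_t,Y_t)_{t\ge0}$ on a probability space $(\Omega,\mathcal F,P)$ is called a weak solution with initial law $\mu_0$ of $$X_t=X_0+\int_0^tb(X_s)\,ds+Y_t$$ if the paths of $X$ belong to $L_{p,\mathrm{loc}}([0,\infty)\to V_{p,1})\cap L_{\infty,\mathrm{loc}}([0,\infty)\to V_{2,0})\cap C([0,\infty)\to V_{2\wedge p',-\beta})$ for some $\beta>0$; $Y$ is a $V_{2,0}$-valued Brownian motion with covariance $\Gamma$; $X_0$ has law $\mu_0$; for every $t\ge0$, $(Y_{t+u}-Y_t)_{u\ge0}$ is independent of $\{\langle\varphi,X_s\rangle : s\le t,\ \varphi\in\mathcal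 V\}$; and, almost surely, for all $\varphi\in\mathcal V$ and $t\ge0$, $$\langle\varphi,X_t\rangle=\langle\varphi,X_0\rangle+\int_0^t\langle\varphi,b(X_s)\rangle\,ds+\langle\varphi,Y_t\rangle .$$ Let $(X,Y)$ and $(\widetilde X,Y)$ be two weak solutions with initial law $\mu_0$, on a common probability space $(\Omega,\mathcal F,P)$ and with the same Brownian motion $Y$, such that each of $Z=X$ and $Z=\widetilde X$ satisfies, for some constant $C<\infty$, $$E\Bigl[\sup_{t\le T}\|Z_t\|_2^2+\int_0^T\|Z_t\|_{p,1}^p\,dt\Bigr]\le(1+T)\,C\qquad\text{for all }T>0 .$$ If $X_0=\widetilde X_0$ almost surely, then $P(X_t=\widetilde X_t\text{ for all }t\ge0)=1$. -/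

import Mathlib

open MeasureTheory ProbabilityTheory
open scoped ENNReal InnerProductSpace

noncomputable section

namespace PowerLawFluid

/-! ## Fields on the torus and their Fourier series -/

/-- Values of vector fields: `ℝ^d` with its Euclidean norm. -/
abbrev Vec (d : ℕ) : Type := EuclideanSpace ℝ (Fin d)

/-- Normalised Lebesgue (Haar) measure on the torus `(ℝ/ℤ)^d`. -/
abbrev torusMeasure (d : ℕ) : Measure (UnitAddTorus (Fin d)) :=
  Measure.pi fun _ => AddCircle.haarAddCircle

/-- Formal vector-valued Fourier series `∑_z c_z exp(2πi z·x)`, `z ∈ ℤ^d`, `c_z ∈ ℂ^d`. All the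
spaces `V_{q,α}` embed into this space, which gives a meaning to their intersections and to
inclusions between them. -/
abbrev FormalField (d : ℕ) : Type := (Fin d → ℤ) → Fin d → ℂ

/-- The Fourier coefficients of a vector field. -/
def fieldCoeff {d : ℕ} (f : UnitAddTorus (Fin d) → Vec d) : FormalField d :=
  fun z i => UnitAddTorus.mFourierCoeff (fun x => (f x i : ℂ)) z

/-- The set `𝒱` of real, divergence-free, mean-zero trigonometric polynomials, given by
their Fourier coefficients. -/
structure TestField (d : ℕ) where
  coeff : (Fin d → ℤ) →₀ (Fin d → ℂ)
  mean_zero : coeff 0 = 0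
  real : ∀ z i, (starRingEnd ℂ) (coeff z i) = coeff (-z) i
  div_free : ∀ z, ∑ i, (z i : ℂ) * coeff z i = 0

/-- The vector field `φ(x) = ∑_z φ̂_z exp(2πi z·x)`. (The sum is real, so taking the real
part is only a change of type.) -/
def TestField.field {d : ℕ} (φ : TestField d) : C(UnitAddTorus (Fin d), Vec d) where
  toFun x := WithLp.toLp 2 fun i =>
    (∑ z ∈ φ.coeff.support, φ.coeff z i * UnitAddTorus.mFourier z x).re
  continuous_toFun := by fun_prop

/-- The partial derivative `∂_j φ_i`. -/
def TestField.partialDeriv {d : ℕ} (φ : TestField d) (j i : Fin d)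
    (x : UnitAddTorus (Fin d)) : ℝ :=
  (∑ z ∈ φ.coeff.support,
    2 * Real.pi * Complex.I * (z j : ℂ) * φ.coeff z i * UnitAddTorus.mFourier z x).re

/-- The pairing `⟨φ, u⟩` of `φ ∈ 𝒱` with a formal Fourier series, extending the inner product
of `L_2`. -/
def pairing {d : ℕ} (φ : TestField d) (u : FormalField d) : ℝ :=
  (∑ z ∈ φ.coeff.support, ∑ i, φ.coeff z i * (starRingEnd ℂ) (u z i)).re

/-! ## The spaces `V_{q,α}` -/

/-- The closure of `𝒱` in `L_q(𝕋^d → ℝ^d)`. -/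
abbrev solenoidal (d : ℕ) (q : ℝ≥0∞) [Fact (1 ≤ q)] :
    Submodule ℝ (Lp (Vec d) q (torusMeasure d)) :=
  (Submodule.span ℝ (Set.range fun φ : TestField d =>
    ContinuousMap.toLp q (torusMeasure d) ℝ φ.field)).topologicalClosure

/-- The Banach space `V_{q,α}`, the completion of `𝒱` for the norm
`‖(1-Δ)^{α/2} v‖_{L_q}`. Since `(1-Δ)^{α/2}` is a bijection of `𝒱`, this completion is isometric
to the closure of `𝒱` in `L_q`: an element `u` is represented by `(1-Δ)^{α/2} u`,
and the norm of `u` is the `L_q` norm of its representative. The index `α` enters through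
the embedding `V.coeff` into formal Fourier series. -/
abbrev V (d : ℕ) (q : ℝ≥0∞) [Fact (1 ≤ q)] (_α : ℝ) : Type := solenoidal d q

/-- The Fourier coefficients `û_z = (1 + 4π²|z|²)^{-α/2} f̂_z` of the element `u` of `V_{q,α}`
represented by `f = (1-Δ)^{α/2} u`. -/
def V.coeff {d : ℕ} {q : ℝ≥0∞} [Fact (1 ≤ q)] (α : ℝ) (u : V d q α) : FormalField d :=
  fun z i => (((1 + 4 * Real.pi ^ 2 * ∑ k, (z k : ℝ) ^ 2) ^ (-α / 2) : ℝ) : ℂ) *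
    fieldCoeff (u : Lp (Vec d) q (torusMeasure d)) z i

/-- The norm `‖u‖_{q,α}` of a formal Fourier series, equal to `∞` outside `V_{q,α}`. -/
def normV {d : ℕ} (q : ℝ≥0∞) [Fact (1 ≤ q)] (α : ℝ) (u : FormalField d) : ℝ≥0∞ :=
  ⨅ (v : V d q α) (_ : V.coeff α v = u), ‖v‖ₑ

/-- The Hilbert space `V_{2,0}` carries its Borel σ-algebra. -/
instance (d : ℕ) : MeasurableSpace (V d 2 0) := borel _

instance (d : ℕ) : BorelSpace (V d 2 0) := ⟨rfl⟩

instance (p : ℝ) [h : Fact (1 < p)] : Fact (1 ≤ ENNReal.ofReal p) :=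
  ⟨by rw [ENNReal.one_le_ofReal]; exact h.out.le⟩

/-- The exponent `2 ∧ p'`, with `p' = p/(p-1)`, is at least `1`. -/
instance (p : ℝ) [h : Fact (1 < p)] : Fact (1 ≤ ENNReal.ofReal (min 2 (p / (p - 1)))) :=
  ⟨by
    have h1 : 0 < p - 1 := sub_pos.mpr h.out
    rw [ENNReal.one_le_ofReal, le_min_iff, one_le_div h1]
    exact ⟨one_le_two, by linarith⟩⟩

/-! ## The drift -/

open Classical in
/-- The (almost everywhere unique) real integrable function on the torus with the given
Fourier coefficients; `0` if there is none. -/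
def ofCoeff {d : ℕ} (c : (Fin d → ℤ) → ℂ) : UnitAddTorus (Fin d) → ℝ :=
  if h : ∃ f : UnitAddTorus (Fin d) → ℝ, Integrable f (torusMeasure d) ∧
      ∀ z, UnitAddTorus.mFourierCoeff (fun x => (f x : ℂ)) z = c z
  then h.choose else 0

/-- The component `v_i` as a function on the torus. -/
def component {d : ℕ} (v : FormalField d) (i : Fin d) : UnitAddTorus (Fin d) → ℝ :=
  ofCoeff fun z => v z i

/-- The rate of strain tensor `e(v)_{ij} = (∂_i v_j + ∂_j v_i)/2`, with derivatives in the sense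
of distributions, as a function on the torus. -/
def strain {d : ℕ} (v : FormalField d) (i j : Fin d) : UnitAddTorus (Fin d) → ℝ :=
  ofCoeff fun z =>
    (2 * Real.pi * Complex.I * (z i : ℂ) * v z j +
      2 * Real.pi * Complex.I * (z j : ℂ) * v z i) / 2

/-- The extra stress tensor `τ(v) = 2ν (1 + |e(v)|²)^{(p-2)/2} e(v)`. -/
def stress {d : ℕ} (ν p : ℝ) (v : FormalField d) (i j : Fin d)
    (x : UnitAddTorus (Fin d)) : ℝ :=
  2 * ν * (1 + ∑ k, ∑ l, strain v k l x ^ 2) ^ ((p - 2) / 2) * strain v i j x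

/-- `⟨φ, b(v)⟩` for `b(v) = -(v·∇)v + div τ(v)`, that is
`⟨v, (v·∇)φ⟩ - ⟨e(φ), τ(v)⟩`. -/
def drift {d : ℕ} (ν p : ℝ) (v : FormalField d) (φ : TestField d) : ℝ :=
  (∫ x, ∑ i, ∑ j, component v i x * (component v j x * φ.partialDeriv j i x)
    ∂torusMeasure d) -
  ∫ x, ∑ i, ∑ j, (φ.partialDeriv i j x + φ.partialDeriv j i x) / 2 * stress ν p v i j x
    ∂torusMeasure d

/-! ## Brownian motion with values in a Hilbert space -/

/-- A bounded self-adjoint nonnegative definite operator of trace class. -/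
def IsCovariance {H : Type*} [NormedAddCommGroup H] [InnerProductSpace ℝ H] [CompleteSpace H]
    (Γ : H →L[ℝ] H) : Prop :=
  Γ.IsPositive ∧
    ∃ (s : Set H) (b : HilbertBasis s ℝ H), Summable fun i => ⟪b i, Γ (b i)⟫_ℝ

/-- `W` is an `H`-valued Brownian motion with covariance operator `Γ`. -/
structure IsBrownianMotion {Ω : Type*} [MeasurableSpace Ω] (P : Measure Ω)
    {H : Type*} [NormedAddCommGroup H] [InnerProductSpace ℝ H] [CompleteSpace H]
    [MeasurableSpace H] [BorelSpace H] (Γ : H →L[ℝ] H) (W : ℝ → Ω → H) : Prop where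
  measurable : ∀ t, 0 ≤ t → Measurable (W t)
  continuous : ∀ᵐ ω ∂P, ContinuousOn (fun t => W t ω) (Set.Ici 0)
  condExp : ∀ (φ : H) (s t : ℝ), 0 ≤ s → s < t →
    P[fun ω => Complex.exp (Complex.I * (⟪φ, W t ω - W s ω⟫_ℝ : ℂ)) |
        ⨆ u ∈ Set.Icc 0 s, MeasurableSpace.comap (W u) inferInstance]
      =ᵐ[P] fun _ => Complex.exp (-((t - s : ℝ) : ℂ) / 2 * (⟪φ, Γ φ⟫_ℝ : ℂ))

/-! ## Weak solutions -/

/-- The path `x` belongs to `L_{r,loc}([0,∞) → V_{q,α})`. -/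
def MemLpLoc {d : ℕ} (r q : ℝ≥0∞) [Fact (1 ≤ q)] (α : ℝ) (x : ℝ → FormalField d) : Prop :=
  ∃ u : ℝ → V d q α, (∀ T, 0 < T → MemLp u r (volume.restrict (Set.Icc 0 T))) ∧
    ∀ᵐ t ∂volume.restrict (Set.Ici (0 : ℝ)), V.coeff α (u t) = x t

/-- The path `x` belongs to `C([0,∞) → V_{q,α})`. -/
def MemC {d : ℕ} (q : ℝ≥0∞) [Fact (1 ≤ q)] (α : ℝ) (x : ℝ → FormalField d) : Prop :=
  ∃ u : ℝ → V d q α, ContinuousOn u (Set.Ici 0) ∧ ∀ t, 0 ≤ t → V.coeff α (u t) = x t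

/-- `(X, Y)` is a weak solution of `X_t = X_0 + ∫_0^t b(X_s) ds + Y_t` with initial law `μ₀`,
where `Y` is a Brownian motion in `V_{2,0}` with covariance operator `Γ`. Only times
`t ≥ 0` matter. -/
structure IsWeakSolution {d : ℕ} (ν p : ℝ) [Fact (1 < p)] (Γ : V d 2 0 →L[ℝ] V d 2 0)
    (μ₀ : Measure (V d 2 0)) {Ω : Type*} [MeasurableSpace Ω] (P : Measure Ω)
    (X : ℝ → Ω → FormalField d) (Y : ℝ → Ω → V d 2 0) : Prop where
  measurable : ∀ t, 0 ≤ t → ∀ φ : TestField d, Measurable fun ω => pairing φ (X t ω)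
  memLp : ∀ᵐ ω ∂P, MemLpLoc (ENNReal.ofReal p) (ENNReal.ofReal p) 1 fun t => X t ω
  memLinfty : ∀ᵐ ω ∂P, MemLpLoc ∞ 2 0 fun t => X t ω
  memC : ∃ β : ℝ, 0 < β ∧
    ∀ᵐ ω ∂P, MemC (ENNReal.ofReal (min 2 (p / (p - 1)))) (-β) fun t => X t ω
  brownian : IsBrownianMotion P Γ Y
  initial_law : ∃ ξ : Ω → V d 2 0, AEMeasurable ξ P ∧
    (∀ᵐ ω ∂P, V.coeff 0 (ξ ω) = X 0 ω) ∧ P.map ξ = μ₀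
  indep : ∀ t : ℝ, 0 ≤ t →
    Indep
      (⨆ u ∈ Set.Ici (0 : ℝ),
        MeasurableSpace.comap (fun ω => Y (t + u) ω - Y t ω) inferInstance)
      (⨆ s ∈ Set.Icc (0 : ℝ) t, ⨆ φ : TestField d,
        MeasurableSpace.comap (fun ω => pairing φ (X s ω)) inferInstance) P
  equation : ∀ᵐ ω ∂P, ∀ (φ : TestField d) (t : ℝ), 0 ≤ t →
    pairing φ (X t ω) = pairing φ (X 0 ω) +
      (∫ s in (0 : ℝ)..t, drift ν p (X s ω) φ) + pairing φ (V.coeff 0 (Y t ω))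

/-- The a priori bound: for some finite constant `C` and all `T > 0`,
`E[sup_{t ≤ T} ‖X_t‖_2² + ∫_0^T ‖X_t‖_{p,1}^p dt] ≤ (1 + T) C`. -/
def AprioriBound {d : ℕ} (p : ℝ) [Fact (1 < p)] {Ω : Type*} [MeasurableSpace Ω]
    (P : Measure Ω) (X : ℝ → Ω → FormalField d) : Prop :=
  ∃ C : ℝ, 0 ≤ C ∧ ∀ T : ℝ, 0 < T →
    ∫⁻ ω, ((⨆ t ∈ Set.Icc 0 T, normV 2 0 (X t ω) ^ 2) +
        ∫⁻ t in Set.Icc 0 T, normV (ENNReal.ofReal p) 1 (X t ω) ^ p) ∂P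
      ≤ ENNReal.ofReal ((1 + T) * C)

end PowerLawFluid

end

noncomputable section

namespace PowerLawFluid

/-! ## The conjugate function inequality of M. Riesz on the circle -/

/-- Differentiation under an integral over a compact interval. -/
theorem hasDerivAt_integral_of_continuous {F F' : ℝ → ℝ → ℝ}
    (hF : Continuous (Function.uncurry F)) (hF' : Continuous (Function.uncurry F'))
    (h : ∀ r θ, HasDerivAt (fun r => F r θ) (F' r θ) r) (a b r : ℝ) :
    HasDerivAt (fun r => ∫ θ in a..b, F r θ) (∫ θ in a..b, F' r θ) r := by
  obtain ⟨C, hC⟩ := ((isCompact_Icc (a := r - 1) (b := r + 1)).prod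
    (isCompact_uIcc (a := a) (b := b))).exists_bound_of_continuousOn hF'.continuousOn
  have hc : ∀ {G : ℝ → ℝ → ℝ}, Continuous (Function.uncurry G) → ∀ r, Continuous (G r) :=
    fun hG r => hG.comp (Continuous.prodMk_right r)
  refine (intervalIntegral.hasDerivAt_integral_of_dominated_loc_of_deriv_le
    (s := Set.Icc (r - 1) (r + 1)) (bound := fun _ => C) (Icc_mem_nhds (by linarith) (by linarith))
    (.of_forall fun r => (hc hF r).aestronglyMeasurable) ((hc hF r).intervalIntegrable _ _)
    (hc hF' r).aestronglyMeasurable ?_ (by simp) ?_).2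
  · exact .of_forall fun θ hθ s hs => hC (s, θ) ⟨hs, Set.uIoc_subset_uIcc hθ⟩
  · exact .of_forall fun θ _ s _ => h s θ

/-- The exponential polynomial `∑ k^j a_k e^{k(ρ+iθ)}`, the `j`-th derivative of
`∑ a_k e^{kζ}` at `ζ = ρ + iθ`. -/
def expPoly {ι : Type*} (S : Finset ι) (a : ι → ℂ) (k : ι → ℕ) (j : ℕ) (ρ θ : ℝ) : ℂ :=
  ∑ i ∈ S, (k i : ℂ) ^ j * a i * Complex.exp (k i * (ρ + Complex.I * θ))

section Subharmonic

variable {ι : Type*} (S : Finset ι) (a : ι → ℂ) (k : ι → ℕ)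

theorem continuous_expPoly (j : ℕ) : Continuous (fun x : ℝ × ℝ => expPoly S a k j x.1 x.2) := by
  unfold expPoly; fun_prop

theorem continuous_expPoly_right (j : ℕ) (ρ : ℝ) : Continuous (expPoly S a k j ρ) := by
  unfold expPoly; fun_prop

theorem hasDerivAt_expPoly_left (j : ℕ) (ρ θ : ℝ) :
    HasDerivAt (fun ρ => expPoly S a k j ρ θ) (expPoly S a k (j + 1) ρ θ) ρ := by
  unfold expPoly
  refine HasDerivAt.fun_sum fun i _ => ?_
  have h1 : HasDerivAt (fun ρ : ℝ => (k i : ℂ) * (ρ + Complex.I * θ)) (k i) ρ := by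
    simpa using ((Complex.ofRealCLM.hasDerivAt (x := ρ)).add_const (Complex.I * θ)).const_mul
      (k i : ℂ)
  exact (h1.cexp.const_mul ((k i : ℂ) ^ j * a i)).congr_deriv (by ring)

theorem hasDerivAt_expPoly_right (j : ℕ) (ρ θ : ℝ) :
    HasDerivAt (fun θ => expPoly S a k j ρ θ) (Complex.I * expPoly S a k (j + 1) ρ θ) θ := by
  unfold expPoly
  rw [Finset.mul_sum]
  refine HasDerivAt.fun_sum fun i _ => ?_
  have h1 : HasDerivAt (fun θ : ℝ => (k i : ℂ) * (ρ + Complex.I * θ)) (k i * Complex.I) θ := by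
    simpa using (((Complex.ofRealCLM.hasDerivAt (x := θ)).const_mul Complex.I).const_add
      (ρ : ℂ)).const_mul (k i : ℂ)
  exact (h1.cexp.const_mul ((k i : ℂ) ^ j * a i)).congr_deriv (by ring)

theorem expPoly_period (j : ℕ) (ρ : ℝ) :
    expPoly S a k j ρ (2 * Real.pi) = expPoly S a k j ρ 0 := by
  unfold expPoly
  refine Finset.sum_congr rfl fun i _ => ?_
  congr 1
  have : (k i : ℂ) * (ρ + Complex.I * ((2 * Real.pi : ℝ) : ℂ)) =
      k i * (ρ + Complex.I * ((0 : ℝ) : ℂ)) + k i * (2 * Real.pi * Complex.I) := by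
    push_cast; ring
  rw [this, Complex.exp_add, Complex.exp_nat_mul_two_pi_mul_I, mul_one]

end Subharmonic

/-- The function `U² N^m - N^{m+1}`-combination whose composition with holomorphic functions is
subharmonic, where `N = ε + U² + V²`. -/
def rieszFun (ε m U V : ℝ) : ℝ :=
  2 * (m + 1) ^ 2 * U ^ 2 * (ε + U ^ 2 + V ^ 2) ^ m - (ε + U ^ 2 + V ^ 2) ^ (m + 1)

/-- The derivative of `rieszFun` in direction `(a, b)`. -/
def rieszFunDeriv (ε m U V a b : ℝ) : ℝ :=
  4 * (m + 1) ^ 2 * U * a * (ε + U ^ 2 + V ^ 2) ^ m +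
    2 * (2 * (m + 1) ^ 2 * U ^ 2 * (m * (ε + U ^ 2 + V ^ 2) ^ (m - 1)) -
      (m + 1) * (ε + U ^ 2 + V ^ 2) ^ m) * (U * a + V * b)

/-- The derivative of `rieszFunDeriv` along a curve with velocity `(U', V')`, where `(a, b)`
changes with velocity `(a', b')`. -/
def rieszFunDeriv₂ (ε m U V a b U' V' a' b' : ℝ) : ℝ :=
  4 * (m + 1) ^ 2 * ((U' * a + U * a') * (ε + U ^ 2 + V ^ 2) ^ m +
      U * a * (m * (ε + U ^ 2 + V ^ 2) ^ (m - 1) * (2 * (U * U' + V * V')))) +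
    2 * (2 * (m + 1) ^ 2 * (2 * U * U' * (m * (ε + U ^ 2 + V ^ 2) ^ (m - 1)) +
        U ^ 2 * (m * ((m - 1) * (ε + U ^ 2 + V ^ 2) ^ (m - 2) * (2 * (U * U' + V * V'))))) -
      (m + 1) * (m * (ε + U ^ 2 + V ^ 2) ^ (m - 1) * (2 * (U * U' + V * V')))) * (U * a + V * b) +
    2 * (2 * (m + 1) ^ 2 * U ^ 2 * (m * (ε + U ^ 2 + V ^ 2) ^ (m - 1)) -
      (m + 1) * (ε + U ^ 2 + V ^ 2) ^ m) * (U' * a + U * a' + (V' * b + V * b'))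

section RieszFun

variable {ε : ℝ} (hε : 0 < ε) (m : ℝ)

include hε

theorem hasDerivAt_normSq_rpow (m : ℝ) {U V : ℝ → ℝ} {U' V' t : ℝ} (hU : HasDerivAt U U' t)
    (hV : HasDerivAt V V' t) :
    HasDerivAt (fun t => (ε + U t ^ 2 + V t ^ 2) ^ m)
      (m * (ε + U t ^ 2 + V t ^ 2) ^ (m - 1) * (2 * (U t * U' + V t * V'))) t := by
  have h := (((hU.pow 2).const_add ε).add (hV.pow 2))
  have h2 := h.rpow_const (p := m) (Or.inl (by
    have : 0 < ε + U t ^ 2 + V t ^ 2 := by positivity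
    exact this.ne'))
  refine h2.congr_deriv ?_
  simp only [Pi.add_apply, Pi.pow_apply]
  push_cast
  ring

theorem hasDerivAt_rieszFun {U V : ℝ → ℝ} {U' V' t : ℝ} (hU : HasDerivAt U U' t)
    (hV : HasDerivAt V V' t) :
    HasDerivAt (fun t => rieszFun ε m (U t) (V t)) (rieszFunDeriv ε m (U t) (V t) U' V') t := by
  have h := (((hU.pow 2).const_mul (2 * (m + 1) ^ 2)).mul (hasDerivAt_normSq_rpow hε m hU hV)).sub
    (hasDerivAt_normSq_rpow hε (m + 1) hU hV)
  refine h.congr_deriv ?_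
  simp only [rieszFunDeriv, Pi.pow_apply, add_sub_cancel_right]
  push_cast
  ring

theorem hasDerivAt_rieszFunDeriv {U V a b : ℝ → ℝ} {U' V' a' b' t : ℝ} (hU : HasDerivAt U U' t)
    (hV : HasDerivAt V V' t) (ha : HasDerivAt a a' t) (hb : HasDerivAt b b' t) :
    HasDerivAt (fun t => rieszFunDeriv ε m (U t) (V t) (a t) (b t))
      (rieszFunDeriv₂ ε m (U t) (V t) (a t) (b t) U' V' a' b') t := by
  have hm := hasDerivAt_normSq_rpow hε m hU hV
  have hm1 := hasDerivAt_normSq_rpow hε (m - 1) hU hV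
  have h := (((hU.const_mul (4 * (m + 1) ^ 2)).mul ha).mul hm).add
    ((((((hU.pow 2).const_mul (2 * (m + 1) ^ 2)).mul (hm1.const_mul m)).sub
      (hm.const_mul (m + 1))).const_mul 2).mul ((hU.mul ha).add (hV.mul hb)))
  refine h.congr_deriv ?_
  simp only [rieszFunDeriv₂, Pi.pow_apply, Pi.mul_apply, Pi.add_apply, Pi.sub_apply]
  rw [show m - 1 - 1 = m - 2 by ring]
  push_cast
  ring

theorem continuous_normSq_rpow (s : ℝ) :
    Continuous (fun x : ℝ × ℝ => (ε + x.1 ^ 2 + x.2 ^ 2) ^ s) :=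
  Continuous.rpow_const (by fun_prop) fun x => Or.inl (by positivity)

theorem continuous_rieszFun {X : Type*} [TopologicalSpace X] {U V : X → ℝ} (hU : Continuous U)
    (hV : Continuous V) : Continuous (fun x => rieszFun ε m (U x) (V x)) := by
  have h (s : ℝ) := (continuous_normSq_rpow hε s).comp (hU.prodMk hV)
  have h1 := h m
  have h2 := h (m + 1)
  unfold rieszFun
  exact ((continuous_const.mul (hU.pow 2)).mul h1).sub h2

theorem continuous_rieszFunDeriv {X : Type*} [TopologicalSpace X] {U V a b : X → ℝ}
    (hU : Continuous U) (hV : Continuous V) (ha : Continuous a) (hb : Continuous b) :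
    Continuous (fun x => rieszFunDeriv ε m (U x) (V x) (a x) (b x)) := by
  have h (s : ℝ) := (continuous_normSq_rpow hε s).comp (hU.prodMk hV)
  have h1 := h m
  have h2 := h (m - 1)
  simp only [Function.comp_def] at h1 h2
  unfold rieszFunDeriv
  exact (((continuous_const.mul hU).mul ha).mul h1).add ((continuous_const.mul
    (((continuous_const.mul (hU.pow 2)).mul (continuous_const.mul h2)).sub
      (continuous_const.mul h1))).mul ((hU.mul ha).add (hV.mul hb)))

theorem continuous_rieszFunDeriv₂ {X : Type*} [TopologicalSpace X]
    {U V a b U' V' a' b' : X → ℝ}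
    (hU : Continuous U) (hV : Continuous V) (ha : Continuous a) (hb : Continuous b)
    (hU' : Continuous U') (hV' : Continuous V') (ha' : Continuous a') (hb' : Continuous b') :
    Continuous (fun x => rieszFunDeriv₂ ε m (U x) (V x) (a x) (b x) (U' x) (V' x) (a' x)
      (b' x)) := by
  have h (s : ℝ) := (continuous_normSq_rpow hε s).comp (hU.prodMk hV)
  obtain ⟨f0, e0⟩ : ∃ f, f = (fun x => (ε + U x ^ 2 + V x ^ 2) ^ m) := ⟨_, rfl⟩
  obtain ⟨f1, e1⟩ : ∃ f, f = (fun x => (ε + U x ^ 2 + V x ^ 2) ^ (m - 1)) := ⟨_, rfl⟩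
  obtain ⟨f2, e2⟩ : ∃ f, f = (fun x => (ε + U x ^ 2 + V x ^ 2) ^ (m - 2)) := ⟨_, rfl⟩
  have h0 : Continuous f0 := e0 ▸ h m
  have h1 : Continuous f1 := e1 ▸ h (m - 1)
  have h2 : Continuous f2 := e2 ▸ h (m - 2)
  have g0 (x : X) : (ε + U x ^ 2 + V x ^ 2) ^ m = f0 x := by rw [e0]
  have g1 (x : X) : (ε + U x ^ 2 + V x ^ 2) ^ (m - 1) = f1 x := by rw [e1]
  have g2 (x : X) : (ε + U x ^ 2 + V x ^ 2) ^ (m - 2) = f2 x := by rw [e2]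
  simp only [rieszFunDeriv₂, g0, g1, g2]
  fun_prop

theorem rieszFun_subharmonic (hm : 0 ≤ m) (U V a b c d : ℝ) :
    0 ≤ rieszFunDeriv₂ ε m U V a b a b c d + rieszFunDeriv₂ ε m U V (-b) a (-b) a (-c) (-d) := by
  have hN : 0 < ε + U ^ 2 + V ^ 2 := by positivity
  set N := ε + U ^ 2 + V ^ 2 with hNdef
  have h1 : N ^ m = N ^ (m - 2) * N ^ 2 := by
    rw [← Real.rpow_natCast N 2, ← Real.rpow_add hN]; congr 1; push_cast; ring
  have h2 : N ^ (m - 1) = N ^ (m - 2) * N := by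
    nth_rewrite 3 [← Real.rpow_one N]
    rw [← Real.rpow_add hN]; congr 1; ring
  have hP : 0 < N ^ (m - 2) := Real.rpow_pos_of_pos hN _
  have key : rieszFunDeriv₂ ε m U V a b a b c d + rieszFunDeriv₂ ε m U V (-b) a (-b) a (-c) (-d) =
      N ^ (m - 2) * (a ^ 2 + b ^ 2) * (4 * (m + 1) * m * N * ε +
        2 * (m + 1) ^ 2 * U ^ 2 * (4 * m * (2 * N + ε) + 4 * m ^ 2 * (N - ε))) := by
    unfold rieszFunDeriv₂
    rw [← hNdef, h1, h2]
    have : V ^ 2 = N - ε - U ^ 2 := by rw [hNdef]; ring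
    generalize N ^ (m - 2) = P
    linear_combination (N ^ (0 : ℕ) * P * (a ^ 2 + b ^ 2)) * (-8 * m * (m + 1) * N + 16 * m * (m - 1) * (m + 1) ^ 2 * U ^ 2 * (1 / 2 : ℝ)) * this
  rw [key]
  have hNε : 0 ≤ N - ε := by rw [hNdef]; nlinarith [sq_nonneg U, sq_nonneg V]
  positivity

end RieszFun

section CircleInequality

variable {ι : Type*} {S : Finset ι} {a : ι → ℂ} {k : ι → ℕ}

theorem rieszFun_mean_nonneg {ε : ℝ} (hε : 0 < ε) {m : ℝ} (hm : 0 ≤ m) (hk : ∀ i ∈ S, k i ≠ 0) :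
    (∫ _ in (0 : ℝ)..2 * Real.pi, rieszFun ε m 0 0) ≤ ∫ θ in (0 : ℝ)..2 * Real.pi,
      rieszFun ε m (expPoly S a k 0 0 θ).re (expPoly S a k 0 0 θ).im := by
  have hc (j : ℕ) := continuous_expPoly S a k j
  have hre (j : ℕ) : Continuous fun x : ℝ × ℝ => (expPoly S a k j x.1 x.2).re :=
    Complex.continuous_re.comp (hc j)
  have him (j : ℕ) : Continuous fun x : ℝ × ℝ => (expPoly S a k j x.1 x.2).im :=
    Complex.continuous_im.comp (hc j)
  have hdre (j : ℕ) (ρ θ : ℝ) : HasDerivAt (fun ρ => (expPoly S a k j ρ θ).re)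
      (expPoly S a k (j + 1) ρ θ).re ρ :=
    (Complex.reCLM.hasFDerivAt.comp_hasDerivAt ρ (hasDerivAt_expPoly_left S a k j ρ θ))
  have hdim (j : ℕ) (ρ θ : ℝ) : HasDerivAt (fun ρ => (expPoly S a k j ρ θ).im)
      (expPoly S a k (j + 1) ρ θ).im ρ :=
    (Complex.imCLM.hasFDerivAt.comp_hasDerivAt ρ (hasDerivAt_expPoly_left S a k j ρ θ))
  have hdre' (j : ℕ) (ρ θ : ℝ) : HasDerivAt (fun θ => (expPoly S a k j ρ θ).re)
      (-(expPoly S a k (j + 1) ρ θ).im) θ := by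
    exact (Complex.reCLM.hasFDerivAt.comp_hasDerivAt θ
      (hasDerivAt_expPoly_right S a k j ρ θ)).congr_deriv (by simp)
  have hdim' (j : ℕ) (ρ θ : ℝ) : HasDerivAt (fun θ => (expPoly S a k j ρ θ).im)
      (expPoly S a k (j + 1) ρ θ).re θ := by
    exact (Complex.imCLM.hasFDerivAt.comp_hasDerivAt θ
      (hasDerivAt_expPoly_right S a k j ρ θ)).congr_deriv (by simp)
  set F : ℝ → ℝ → ℝ := fun ρ θ =>
    rieszFun ε m (expPoly S a k 0 ρ θ).re (expPoly S a k 0 ρ θ).im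
  set B : ℝ → ℝ → ℝ := fun ρ θ =>
    rieszFunDeriv ε m (expPoly S a k 0 ρ θ).re (expPoly S a k 0 ρ θ).im
      (expPoly S a k 1 ρ θ).re (expPoly S a k 1 ρ θ).im
  set C : ℝ → ℝ → ℝ := fun ρ θ =>
    rieszFunDeriv ε m (expPoly S a k 0 ρ θ).re (expPoly S a k 0 ρ θ).im
      (-(expPoly S a k 1 ρ θ).im) (expPoly S a k 1 ρ θ).re
  set B' : ℝ → ℝ → ℝ := fun ρ θ =>
    rieszFunDeriv₂ ε m (expPoly S a k 0 ρ θ).re (expPoly S a k 0 ρ θ).im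
      (expPoly S a k 1 ρ θ).re (expPoly S a k 1 ρ θ).im
      (expPoly S a k 1 ρ θ).re (expPoly S a k 1 ρ θ).im
      (expPoly S a k 2 ρ θ).re (expPoly S a k 2 ρ θ).im
  set C' : ℝ → ℝ → ℝ := fun ρ θ =>
    rieszFunDeriv₂ ε m (expPoly S a k 0 ρ θ).re (expPoly S a k 0 ρ θ).im
      (-(expPoly S a k 1 ρ θ).im) (expPoly S a k 1 ρ θ).re
      (-(expPoly S a k 1 ρ θ).im) (expPoly S a k 1 ρ θ).re
      (-(expPoly S a k 2 ρ θ).re) (-(expPoly S a k 2 ρ θ).im)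
  have cF : Continuous (Function.uncurry F) := continuous_rieszFun hε m (hre 0) (him 0)
  have cB : Continuous (Function.uncurry B) :=
    continuous_rieszFunDeriv hε m (hre 0) (him 0) (hre 1) (him 1)
  have cB' : Continuous (Function.uncurry B') :=
    continuous_rieszFunDeriv₂ hε m (hre 0) (him 0) (hre 1) (him 1) (hre 1) (him 1) (hre 2) (him 2)
  have cC' : Continuous (Function.uncurry C') :=
    continuous_rieszFunDeriv₂ hε m (hre 0) (him 0) (him 1).neg (hre 1) (him 1).neg (hre 1)
      (hre 2).neg (him 2).neg
  have dF (ρ θ : ℝ) : HasDerivAt (fun ρ => F ρ θ) (B ρ θ) ρ :=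
    hasDerivAt_rieszFun hε m (hdre 0 ρ θ) (hdim 0 ρ θ)
  have dB (ρ θ : ℝ) : HasDerivAt (fun ρ => B ρ θ) (B' ρ θ) ρ :=
    hasDerivAt_rieszFunDeriv hε m (hdre 0 ρ θ) (hdim 0 ρ θ) (hdre 1 ρ θ) (hdim 1 ρ θ)
  have dC (ρ θ : ℝ) : HasDerivAt (fun θ => C ρ θ) (C' ρ θ) θ :=
    hasDerivAt_rieszFunDeriv hε m (hdre' 0 ρ θ) (hdim' 0 ρ θ) (hdim' 1 ρ θ).neg (hdre' 1 ρ θ)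
      |>.congr_deriv rfl
  have hpi : (0 : ℝ) ≤ 2 * Real.pi := by positivity
  have hBpos (ρ : ℝ) : 0 ≤ ∫ θ in (0 : ℝ)..2 * Real.pi, B' ρ θ := by
    have hC0 : ∫ θ in (0 : ℝ)..2 * Real.pi, C' ρ θ = 0 := by
      rw [intervalIntegral.integral_eq_sub_of_hasDerivAt (fun θ _ => dC ρ θ)
        ((cC'.comp (Continuous.prodMk_right ρ)).intervalIntegrable _ _)]
      simp only [C, expPoly_period, sub_self]
    have := intervalIntegral.integral_add (μ := volume)
      ((cB'.comp (Continuous.prodMk_right ρ)).intervalIntegrable 0 (2 * Real.pi))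
      ((cC'.comp (Continuous.prodMk_right ρ)).intervalIntegrable 0 (2 * Real.pi))
    simp only [Function.comp_apply, Function.uncurry_apply_pair, hC0, add_zero] at this
    rw [← this]
    exact intervalIntegral.integral_nonneg hpi fun θ _ => rieszFun_subharmonic hε m hm _ _ _ _ _ _
  set E : ℕ → ℝ → ℝ → ℂ := fun j r θ =>
    ∑ i ∈ S, (k i : ℂ) ^ j * a i * (r * Complex.exp (Complex.I * θ)) ^ k i with hE
  have hEexp (j : ℕ) (ρ θ : ℝ) : expPoly S a k j ρ θ = E j (Real.exp ρ) θ := by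
    refine Finset.sum_congr rfl fun i _ => ?_
    rw [Complex.ofReal_exp, ← Complex.exp_add, ← Complex.exp_nat_mul]
  have hE0 (j : ℕ) (θ : ℝ) : E j 0 θ = 0 :=
    Finset.sum_eq_zero fun i hi => by simp [hk i hi]
  have cE (j : ℕ) : Continuous fun x : ℝ × ℝ => E j x.1 x.2 := by simp only [hE]; fun_prop
  have cEre (j : ℕ) : Continuous fun x : ℝ × ℝ => (E j x.1 x.2).re :=
    Complex.continuous_re.comp (cE j)
  have cEim (j : ℕ) : Continuous fun x : ℝ × ℝ => (E j x.1 x.2).im :=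
    Complex.continuous_im.comp (cE j)
  have tF : Filter.Tendsto (fun ρ => ∫ θ in (0 : ℝ)..2 * Real.pi, F ρ θ) Filter.atBot
      (nhds (∫ _ in (0 : ℝ)..2 * Real.pi, rieszFun ε m 0 0)) := by
    have h := intervalIntegral.continuous_parametric_intervalIntegral_of_continuous' (μ := volume)
      (f := fun r θ => rieszFun ε m (E 0 r θ).re (E 0 r θ).im)
      (continuous_rieszFun hε m (cEre 0) (cEim 0)) 0 (2 * Real.pi)
    have h2 := (h.tendsto 0).comp Real.tendsto_exp_atBot
    simpa only [Function.comp_def, hE0, Complex.zero_re, Complex.zero_im, ← hEexp] using h2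
  have tB : Filter.Tendsto (fun ρ => ∫ θ in (0 : ℝ)..2 * Real.pi, B ρ θ) Filter.atBot
      (nhds 0) := by
    have h := intervalIntegral.continuous_parametric_intervalIntegral_of_continuous' (μ := volume)
      (f := fun r θ => rieszFunDeriv ε m (E 0 r θ).re (E 0 r θ).im (E 1 r θ).re (E 1 r θ).im)
      (continuous_rieszFunDeriv hε m (cEre 0) (cEim 0) (cEre 1) (cEim 1)) 0 (2 * Real.pi)
    have h2 := (h.tendsto 0).comp Real.tendsto_exp_atBot
    simpa [Function.comp_def, hE0, ← hEexp, rieszFunDeriv, B] using h2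
  have mB : Monotone fun ρ => ∫ θ in (0 : ℝ)..2 * Real.pi, B ρ θ :=
    monotone_of_hasDerivAt_nonneg
      (fun ρ => hasDerivAt_integral_of_continuous cB cB' dB 0 (2 * Real.pi) ρ) hBpos
  have mF : Monotone fun ρ => ∫ θ in (0 : ℝ)..2 * Real.pi, F ρ θ :=
    monotone_of_hasDerivAt_nonneg
      (fun ρ => hasDerivAt_integral_of_continuous cF cB dF 0 (2 * Real.pi) ρ)
      (fun ρ => mB.le_of_tendsto tB ρ)
  exact mF.le_of_tendsto tF 0

theorem riesz_pointwise {m A U N : ℝ} (hm : 0 ≤ m) (hA : 0 ≤ A) (hN : 0 ≤ N) :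
    A * U ^ 2 * N ^ m ≤ N ^ (m + 1) / 2 + A * (2 * A) ^ m * |U| ^ (2 * m + 2) := by
  have hU : (U ^ 2) ^ (m + 1) = |U| ^ (2 * m + 2) := by
    rw [← sq_abs, ← Real.rpow_natCast, ← Real.rpow_mul (abs_nonneg U)]
    congr 1; push_cast; ring
  have hN1 : N ^ (m + 1) = N ^ m * N := Real.rpow_add_one' hN (by linarith)
  have hU1 : (U ^ 2) ^ (m + 1) = (U ^ 2) ^ m * U ^ 2 :=
    Real.rpow_add_one' (sq_nonneg U) (by linarith)
  have hNm : 0 ≤ N ^ m := Real.rpow_nonneg hN m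
  rw [← hU]
  rcases le_or_gt (A * U ^ 2) (N / 2) with h | h
  · have h2 : 0 ≤ A * (2 * A) ^ m * (U ^ 2) ^ (m + 1) := by positivity
    nlinarith
  · have h1 : N ^ m ≤ (2 * A) ^ m * (U ^ 2) ^ m := by
      rw [← Real.mul_rpow (by positivity) (sq_nonneg U)]
      exact Real.rpow_le_rpow hN (by linarith) hm
    have h2 : 0 ≤ N ^ (m + 1) / 2 := by positivity
    calc A * U ^ 2 * N ^ m ≤ A * U ^ 2 * ((2 * A) ^ m * (U ^ 2) ^ m) := by gcongr
      _ = A * (2 * A) ^ m * (U ^ 2) ^ (m + 1) := by rw [hU1]; ring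
      _ ≤ _ := by linarith

/-- The constant in the conjugate function inequality. -/
def rieszConst (p : ℝ) : ℝ := 2 * (p ^ 2 / 2 * (2 * (p ^ 2 / 2)) ^ ((p - 2) / 2))

theorem rieszConst_nonneg (p : ℝ) : 0 ≤ rieszConst p := by unfold rieszConst; positivity

/-- **M. Riesz's inequality** for analytic trigonometric polynomials of mean zero. -/
theorem circle_riesz {p : ℝ} (hp : 2 ≤ p) (hk : ∀ i ∈ S, k i ≠ 0) :
    (∫ θ in (0 : ℝ)..2 * Real.pi, ‖expPoly S a k 0 0 θ‖ ^ p) ≤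
      rieszConst p * ∫ θ in (0 : ℝ)..2 * Real.pi, |(expPoly S a k 0 0 θ).re| ^ p := by
  obtain ⟨m, rfl⟩ : ∃ m, p = 2 * m + 2 := ⟨(p - 2) / 2, by ring⟩
  have hm : 0 ≤ m := by linarith
  have hc := continuous_expPoly_right S a k 0 0
  set q := expPoly S a k 0 0
  have hcre : Continuous fun θ => (q θ).re := Complex.continuous_re.comp hc
  have hcim : Continuous fun θ => (q θ).im := Complex.continuous_im.comp hc
  have hpi : (0 : ℝ) ≤ 2 * Real.pi := by positivity
  set A := 2 * (m + 1) ^ 2 with hA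
  have hA0 : 0 ≤ A := by positivity
  have hconst : rieszConst (2 * m + 2) = 2 * (A * (2 * A) ^ m) := by
    have h1 : (2 * m + 2) ^ 2 / 2 = A := by rw [hA]; ring
    have h2 : (2 * m + 2 - 2) / 2 = m := by ring
    rw [rieszConst, h1, h2]
  have cU : Continuous fun θ => |(q θ).re| ^ (2 * m + 2) :=
    (hcre.abs).rpow_const fun _ => Or.inr (by linarith)
  have cq : Continuous fun θ => ‖q θ‖ ^ (2 * m + 2) :=
    hc.norm.rpow_const fun _ => Or.inr (by linarith)
  have key (ε : ℝ) (hε : 0 < ε) : (∫ θ in (0 : ℝ)..2 * Real.pi, ‖q θ‖ ^ (2 * m + 2)) ≤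
      rieszConst (2 * m + 2) * (∫ θ in (0 : ℝ)..2 * Real.pi, |(q θ).re| ^ (2 * m + 2)) +
        2 * (2 * Real.pi) * ε ^ (m + 1) := by
    have h1 := rieszFun_mean_nonneg (S := S) (a := a) (k := k) hε hm hk
    have h2 (θ : ℝ) : rieszFun ε m (q θ).re (q θ).im ≤
        A * (2 * A) ^ m * |(q θ).re| ^ (2 * m + 2) - ‖q θ‖ ^ (2 * m + 2) / 2 := by
      have hN : 0 ≤ ε + (q θ).re ^ 2 + (q θ).im ^ 2 := by positivity
      have h3 := riesz_pointwise (U := (q θ).re) hm hA0 hN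
      have h4 : ‖q θ‖ ^ (2 * m + 2) ≤ (ε + (q θ).re ^ 2 + (q θ).im ^ 2) ^ (m + 1) := by
        rw [show 2 * m + 2 = ((2 : ℕ) : ℝ) * (m + 1) by push_cast; ring,
          Real.rpow_mul (norm_nonneg _), Real.rpow_natCast, Complex.sq_norm, Complex.normSq_apply]
        exact Real.rpow_le_rpow (add_nonneg (mul_self_nonneg _) (mul_self_nonneg _)) (by nlinarith)
          (by linarith)
      unfold rieszFun
      linarith
    have cR : Continuous fun θ => A * (2 * A) ^ m * |(q θ).re| ^ (2 * m + 2) :=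
      continuous_const.mul cU
    have cRq : Continuous fun θ => A * (2 * A) ^ m * |(q θ).re| ^ (2 * m + 2) -
      ‖q θ‖ ^ (2 * m + 2) / 2 := cR.sub (cq.div_const 2)
    have cΦ : Continuous fun θ => rieszFun ε m (q θ).re (q θ).im :=
      continuous_rieszFun hε m hcre hcim
    have h5 := h1.trans (intervalIntegral.integral_mono_on hpi
      (cΦ.intervalIntegrable _ _)
      (cRq.intervalIntegrable _ _) fun θ _ => h2 θ)
    rw [intervalIntegral.integral_sub (cR.intervalIntegrable _ _)
      ((cq.div_const 2).intervalIntegrable _ _), intervalIntegral.integral_const_mul,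
      intervalIntegral.integral_div, intervalIntegral.integral_const] at h5
    have h6 : rieszFun ε m 0 0 = -ε ^ (m + 1) := by simp [rieszFun]
    rw [h6, smul_eq_mul] at h5
    rw [hconst]
    linarith
  have ht : Filter.Tendsto (fun ε : ℝ =>
      rieszConst (2 * m + 2) * (∫ θ in (0 : ℝ)..2 * Real.pi, |(q θ).re| ^ (2 * m + 2)) +
        2 * (2 * Real.pi) * ε ^ (m + 1)) (nhdsWithin 0 (Set.Ioi 0))
      (nhds (rieszConst (2 * m + 2) *
        (∫ θ in (0 : ℝ)..2 * Real.pi, |(q θ).re| ^ (2 * m + 2)))) := by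
    have h : Continuous fun ε : ℝ =>
      rieszConst (2 * m + 2) * (∫ θ in (0 : ℝ)..2 * Real.pi, |(q θ).re| ^ (2 * m + 2)) +
        2 * (2 * Real.pi) * ε ^ (m + 1) :=
      continuous_const.add (continuous_const.mul
        (continuous_id.rpow_const fun _ => Or.inr (by linarith)))
    have h' := (h.tendsto 0).mono_left (nhdsWithin_le_nhds (s := Set.Ioi 0))
    simpa [Real.zero_rpow (show m + 1 ≠ 0 by linarith)] using h'
  exact ge_of_tendsto ht (Filter.eventually_of_mem self_mem_nhdsWithin fun ε hε => key ε hε)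

end CircleInequality

/-! ## Half-space multipliers on the torus -/

/-- The trigonometric polynomial `∑_{z ∈ S} c_z exp(2πi z·x)`. -/
def trigPoly {d : ℕ} (S : Finset (Fin d → ℤ)) (c : (Fin d → ℤ) → ℂ) :
    C(UnitAddTorus (Fin d), ℂ) :=
  ∑ z ∈ S, c z • UnitAddTorus.mFourier z

theorem trigPoly_apply {d : ℕ} (S : Finset (Fin d → ℤ)) (c : (Fin d → ℤ) → ℂ)
    (x : UnitAddTorus (Fin d)) : trigPoly S c x = ∑ z ∈ S, c z * UnitAddTorus.mFourier z x := by
  simp [trigPoly]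

/-- The straight line through the origin of the torus with velocity `n / 2π`. -/
def torusLine {d : ℕ} (n : Fin d → ℤ) (t : ℝ) : UnitAddTorus (Fin d) :=
  fun i => ((t * n i / (2 * Real.pi) : ℝ) : UnitAddCircle)

theorem continuous_torusLine {d : ℕ} (n : Fin d → ℤ) : Continuous (torusLine n) :=
  continuous_pi fun i => (AddCircle.continuous_mk' 1).comp (by fun_prop)

theorem mFourier_add_apply {d : ℕ} (z : Fin d → ℤ) (x y : UnitAddTorus (Fin d)) :
    UnitAddTorus.mFourier z (x + y) = UnitAddTorus.mFourier z x * UnitAddTorus.mFourier z y := by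
  simp only [UnitAddTorus.mFourier, ContinuousMap.coe_mk, ← Finset.prod_mul_distrib]
  refine Finset.prod_congr rfl fun i _ => ?_
  simp [fourier_apply, smul_add, AddCircle.toCircle_add]

theorem mFourier_torusLine {d : ℕ} (z n : Fin d → ℤ) (t : ℝ) :
    UnitAddTorus.mFourier z (torusLine n t) =
      Complex.exp (Complex.I * ((∑ i, n i * z i : ℤ) * t)) := by
  simp only [UnitAddTorus.mFourier, ContinuousMap.coe_mk, torusLine, fourier_coe_apply]
  rw [← Complex.exp_sum]
  congr 1
  push_cast
  rw [Finset.sum_mul, Finset.mul_sum]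
  refine Finset.sum_congr rfl fun i _ => ?_
  have : (Real.pi : ℂ) ≠ 0 := Complex.ofReal_ne_zero.mpr Real.pi_ne_zero
  field_simp

theorem integral_comp_add_right {d : ℕ} (f : UnitAddTorus (Fin d) → ℝ) (y : UnitAddTorus (Fin d)) :
    ∫ x, f (x + y) ∂torusMeasure d = ∫ x, f x ∂torusMeasure d :=
  integral_add_right_eq_self f y

/-- Averaging along lines does not change the integral. -/
theorem integral_line_average {d : ℕ} (n : Fin d → ℤ) {f : UnitAddTorus (Fin d) × ℝ → ℝ}
    (hf : Continuous f) (T : ℝ) (hT : 0 ≤ T) :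
    ∫ x, (∫ t in (0 : ℝ)..T, f (x + torusLine n t, t)) ∂torusMeasure d =
      ∫ t in (0 : ℝ)..T, ∫ x, f (x, t) ∂torusMeasure d := by
  simp only [intervalIntegral.integral_of_le hT]
  have hg : Continuous fun q : UnitAddTorus (Fin d) × ℝ => f (q.1 + torusLine n q.2, q.2) := by
    have := continuous_torusLine n
    fun_prop
  obtain ⟨C, hC⟩ := ((isCompact_univ (X := UnitAddTorus (Fin d))).prod
    (isCompact_Icc (a := 0) (b := T))).exists_bound_of_continuousOn hg.continuousOn
  rw [integral_integral_swap]
  · exact integral_congr_ae (.of_forall fun t =>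
      integral_comp_add_right (fun x => f (x, t)) (torusLine n t))
  · refine Integrable.of_bound hg.aestronglyMeasurable C ?_
    rw [← Measure.restrict_univ (μ := torusMeasure d), Measure.prod_restrict]
    refine ae_restrict_of_forall_mem (MeasurableSet.univ.prod measurableSet_Ioc) fun q hq => ?_
    exact hC q ⟨trivial, Set.Ioc_subset_Icc_self hq.2⟩

/-- The coefficients of the analytic function whose real part is the restriction of
`∑_{z ∈ S} c_z exp(2πi z·x)` to a line. -/
def lineCoeff {d : ℕ} (l : (Fin d → ℤ) → ℤ) (c : (Fin d → ℤ) → ℂ) (x : UnitAddTorus (Fin d))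
    (z : Fin d → ℤ) : ℂ :=
  if 0 < l z then c z * UnitAddTorus.mFourier z x
  else (starRingEnd ℂ) (c z * UnitAddTorus.mFourier z x)

theorem lineCoeff_mul_exp {d : ℕ} (l : (Fin d → ℤ) → ℤ) (c : (Fin d → ℤ) → ℂ)
    (x : UnitAddTorus (Fin d)) (z : Fin d → ℤ) (t : ℝ) :
    ((l z).natAbs : ℂ) ^ 0 * lineCoeff l c x z *
      Complex.exp ((l z).natAbs * ((0 : ℝ) + Complex.I * t)) =
    if 0 < l z then c z * UnitAddTorus.mFourier z x * Complex.exp (Complex.I * (l z * t))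
    else (starRingEnd ℂ) (c z * UnitAddTorus.mFourier z x *
      Complex.exp (Complex.I * (l z * t))) := by
  unfold lineCoeff
  split_ifs with h0
  · have : ((l z).natAbs : ℂ) = l z := by
      rw [← Int.cast_natCast, Int.natAbs_of_nonneg h0.le]
    rw [this, pow_zero, one_mul, Complex.ofReal_zero, zero_add]
    congr 2; ring
  · have : ((l z).natAbs : ℂ) = -l z := by
      rw [← Int.cast_natCast, Int.ofNat_natAbs_of_nonpos (not_lt.mp h0), Int.cast_neg]
    rw [this, pow_zero, one_mul, Complex.ofReal_zero, zero_add, map_mul (starRingEnd ℂ) _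
      (Complex.exp _), ← Complex.exp_conj]
    congr 2
    simp only [map_mul, Complex.conj_I, Complex.conj_ofReal, map_intCast]
    ring

theorem exp_mul_trigPoly_line {d : ℕ} (n : Fin d → ℤ) (n₀ : ℤ) (S : Finset (Fin d → ℤ))
    (c : (Fin d → ℤ) → ℂ) (x : UnitAddTorus (Fin d)) (t : ℝ) :
    Complex.exp (Complex.I * (n₀ * t)) * trigPoly S c (x + torusLine n t) =
      ∑ z ∈ S, c z * UnitAddTorus.mFourier z x *
        Complex.exp (Complex.I * ((∑ i, n i * z i + n₀ : ℤ) * t)) := by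
  rw [trigPoly_apply, Finset.mul_sum]
  refine Finset.sum_congr rfl fun z _ => ?_
  rw [mFourier_add_apply, mFourier_torusLine]
  push_cast
  rw [show Complex.I * ((∑ i, (n i : ℂ) * z i + n₀) * t) =
    Complex.I * (n₀ * t) + Complex.I * ((∑ i, (n i : ℂ) * z i) * t) by ring, Complex.exp_add]
  ring

theorem expPoly_line_re {d : ℕ} (n : Fin d → ℤ) (n₀ : ℤ) (S : Finset (Fin d → ℤ))
    (c : (Fin d → ℤ) → ℂ) (x : UnitAddTorus (Fin d)) (t : ℝ) :
    (expPoly S (lineCoeff (fun z => ∑ i, n i * z i + n₀) c x)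
      (fun z => (∑ i, n i * z i + n₀).natAbs) 0 0 t).re =
    (Complex.exp (Complex.I * (n₀ * t)) * trigPoly S c (x + torusLine n t)).re := by
  rw [exp_mul_trigPoly_line, expPoly, Complex.re_sum, Complex.re_sum]
  refine Finset.sum_congr rfl fun z _ => ?_
  rw [lineCoeff_mul_exp (fun z => ∑ i, n i * z i + n₀)]
  split_ifs
  · rfl
  · exact Complex.conj_re _

theorem expPoly_line_im {d : ℕ} (n : Fin d → ℤ) (n₀ : ℤ) (S : Finset (Fin d → ℤ))
    (c : (Fin d → ℤ) → ℂ) (h : ∀ z ∈ S, ∑ i, n i * z i + n₀ ≠ 0) (x : UnitAddTorus (Fin d))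
    (t : ℝ) :
    (expPoly S (lineCoeff (fun z => ∑ i, n i * z i + n₀) c x)
      (fun z => (∑ i, n i * z i + n₀).natAbs) 0 0 t).im =
    (Complex.exp (Complex.I * (n₀ * t)) *
      trigPoly S (fun z => ((∑ i, n i * z i + n₀).sign : ℂ) * c z) (x + torusLine n t)).im := by
  rw [exp_mul_trigPoly_line, expPoly, Complex.im_sum, Complex.im_sum]
  refine Finset.sum_congr rfl fun z hz => ?_
  rw [lineCoeff_mul_exp (fun z => ∑ i, n i * z i + n₀)]
  split_ifs with h0
  · rw [Int.sign_eq_one_of_pos h0, Int.cast_one, one_mul]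
  · rw [Int.sign_eq_neg_one_of_neg (lt_of_le_of_ne (not_lt.mp h0) (h z hz)), Complex.conj_im]
    simp only [Int.cast_neg, Int.cast_one, neg_mul, one_mul, Complex.neg_im]

/-- Imaginary parts of half-space multipliers. -/
theorem integral_im_halfSpace_le {d : ℕ} {p : ℝ} (hp : 2 ≤ p) (n : Fin d → ℤ) (n₀ : ℤ)
    (S : Finset (Fin d → ℤ)) (c : (Fin d → ℤ) → ℂ) (h : ∀ z ∈ S, ∑ i, n i * z i + n₀ ≠ 0) :
    (∫ t in (0 : ℝ)..2 * Real.pi, ∫ x, |(Complex.exp (Complex.I * (n₀ * t)) *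
      trigPoly S (fun z => ((∑ i, n i * z i + n₀).sign : ℂ) * c z) x).im| ^ p ∂torusMeasure d) ≤
    rieszConst p * (2 * Real.pi * ∫ x, ‖trigPoly S c x‖ ^ p ∂torusMeasure d) := by
  have hpi : (0 : ℝ) ≤ 2 * Real.pi := by positivity
  have hp0 : 0 ≤ p := by linarith
  have hre := expPoly_line_re n n₀ S c
  have him := expPoly_line_im n n₀ S c h
  generalize trigPoly S (fun z => ((∑ i, n i * z i + n₀).sign : ℂ) * c z) = g at *
  generalize trigPoly S c = f at *
  have hexp (t : ℝ) : ‖Complex.exp (Complex.I * (n₀ * t))‖ = 1 := by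
    rw [show Complex.I * ((n₀ : ℂ) * t) = ((n₀ * t : ℝ) : ℂ) * Complex.I by push_cast; ring,
      Complex.norm_exp_ofReal_mul_I]
  have cG : Continuous fun q : UnitAddTorus (Fin d) × ℝ =>
      |(Complex.exp (Complex.I * (n₀ * q.2)) * g q.1).im| ^ p :=
    (Complex.continuous_im.comp (by fun_prop)).abs.rpow_const fun _ => Or.inr hp0
  have cF : Continuous fun q : UnitAddTorus (Fin d) × ℝ => ‖f q.1‖ ^ p :=
    (by fun_prop : Continuous fun q : UnitAddTorus (Fin d) × ℝ => ‖f q.1‖).rpow_const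
      fun _ => Or.inr hp0
  have hl1 := integral_line_average n cG (2 * Real.pi) hpi
  have hl2 := integral_line_average n cF (2 * Real.pi) hpi
  dsimp only at hl1 hl2
  rw [← hl1]
  rw [intervalIntegral.integral_const, smul_eq_mul, sub_zero] at hl2
  rw [← hl2, ← integral_const_mul]
  have hshift : Continuous fun q : UnitAddTorus (Fin d) × ℝ => q.1 + torusLine n q.2 := by
    have := continuous_torusLine n
    fun_prop
  have cint {F : UnitAddTorus (Fin d) × ℝ → ℝ} (hF : Continuous F) : Integrable
      (fun x => ∫ t in (0 : ℝ)..2 * Real.pi, F (x + torusLine n t, t)) (torusMeasure d) :=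
    (intervalIntegral.continuous_parametric_intervalIntegral_of_continuous' (μ := volume)
      (f := fun x t => F (x + torusLine n t, t))
      (hF.comp (hshift.prodMk continuous_snd)) 0 (2 * Real.pi)).integrable_of_hasCompactSupport
      (HasCompactSupport.of_compactSpace _)
  have i1 := cint cG
  have i2 := (cint cF).const_mul (rieszConst p)
  refine integral_mono i1 i2 fun x => ?_
  have hr := circle_riesz (S := S) (a := lineCoeff (fun z => ∑ i, n i * z i + n₀) c x) hp
    fun z hz => Int.natAbs_ne_zero.mpr (h z hz)
  have cE := continuous_expPoly_right S (lineCoeff (fun z => ∑ i, n i * z i + n₀) c x)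
    (fun z => (∑ i, n i * z i + n₀).natAbs) 0 0
  replace hre := hre x
  replace him := him x
  generalize expPoly S (lineCoeff (fun z => ∑ i, n i * z i + n₀) c x)
      (fun z => (∑ i, n i * z i + n₀).natAbs) 0 0 = E at *
  have cline : Continuous fun t => x + torusLine n t :=
    continuous_const.add (continuous_torusLine n)
  have c1 : Continuous fun t => ‖E t‖ ^ p := cE.norm.rpow_const fun _ => Or.inr hp0
  have c2 : Continuous fun t => |(E t).re| ^ p :=
    (Complex.continuous_re.comp cE).abs.rpow_const fun _ => Or.inr hp0
  have c3 : Continuous fun t => ‖f (x + torusLine n t)‖ ^ p :=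
    (f.continuous.comp cline).norm.rpow_const fun _ => Or.inr hp0
  have c4 : Continuous fun t : ℝ =>
      |(Complex.exp (Complex.I * (n₀ * (t : ℝ))) * g (x + torusLine n t)).im| ^ p := by
    have h := cG.comp (cline.prodMk continuous_id)
    exact h
  have h1 : (∫ t in (0 : ℝ)..2 * Real.pi,
      |(Complex.exp (Complex.I * (n₀ * t)) * g (x + torusLine n t)).im| ^ p) ≤
      ∫ t in (0 : ℝ)..2 * Real.pi, ‖E t‖ ^ p := by
    refine intervalIntegral.integral_mono_on hpi (c4.intervalIntegrable _ _)
      (c1.intervalIntegrable _ _) fun t _ => ?_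
    rw [← him t]
    exact Real.rpow_le_rpow (abs_nonneg _) (Complex.abs_im_le_norm _) hp0
  have h2 : (∫ t in (0 : ℝ)..2 * Real.pi, |(E t).re| ^ p) ≤
      ∫ t in (0 : ℝ)..2 * Real.pi, ‖f (x + torusLine n t)‖ ^ p := by
    refine intervalIntegral.integral_mono_on hpi (c2.intervalIntegrable _ _)
      (c3.intervalIntegrable _ _) fun t _ => ?_
    refine Real.rpow_le_rpow (abs_nonneg _) ?_ hp0
    rw [hre t]
    refine (Complex.abs_re_le_norm _).trans_eq ?_
    rw [norm_mul, hexp, one_mul]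
  exact h1.trans (hr.trans (mul_le_mul_of_nonneg_left h2 (rieszConst_nonneg p)))

/-- The constant in `integral_halfSpace_le`. -/
def halfSpaceConst (p : ℝ) : ℝ := 2 ^ p * (2 * rieszConst p)

theorem halfSpaceConst_nonneg (p : ℝ) : 0 ≤ halfSpaceConst p := by
  have := rieszConst_nonneg p
  unfold halfSpaceConst; positivity

theorem norm_rpow_le_re_im {p : ℝ} (hp : 0 ≤ p) (w : ℂ) :
    ‖w‖ ^ p ≤ 2 ^ p * (|w.re| ^ p + |w.im| ^ p) := by
  have h := Complex.norm_le_abs_re_add_abs_im w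
  rcases le_total |w.re| |w.im| with h1 | h1
  · calc ‖w‖ ^ p ≤ (2 * |w.im|) ^ p := Real.rpow_le_rpow (norm_nonneg _) (by linarith) hp
      _ = 2 ^ p * |w.im| ^ p := Real.mul_rpow (by norm_num) (abs_nonneg _)
      _ ≤ _ := by gcongr; exact le_add_of_nonneg_left (by positivity)
  · calc ‖w‖ ^ p ≤ (2 * |w.re|) ^ p := Real.rpow_le_rpow (norm_nonneg _) (by linarith) hp
      _ = 2 ^ p * |w.re| ^ p := Real.mul_rpow (by norm_num) (abs_nonneg _)
      _ ≤ _ := by gcongr; exact le_add_of_nonneg_right (by positivity)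

/-- Affine half-space multipliers with integer coefficients are bounded on `L_p`, uniformly. -/
theorem integral_halfSpace_le {d : ℕ} {p : ℝ} (hp : 2 ≤ p) (n : Fin d → ℤ) (n₀ : ℤ)
    (S : Finset (Fin d → ℤ)) (c : (Fin d → ℤ) → ℂ) (h : ∀ z ∈ S, ∑ i, n i * z i + n₀ ≠ 0) :
    (∫ x, ‖trigPoly S (fun z => ((∑ i, n i * z i + n₀).sign : ℂ) * c z) x‖ ^ p ∂torusMeasure d) ≤
    halfSpaceConst p * ∫ x, ‖trigPoly S c x‖ ^ p ∂torusMeasure d := by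
  have hp0 : 0 ≤ p := by linarith
  have hpi : (0 : ℝ) < 2 * Real.pi := by positivity
  have h1 := integral_im_halfSpace_le hp n n₀ S c h
  have h2 := integral_im_halfSpace_le hp n n₀ S (fun z => Complex.I * c z) h
  set g := trigPoly S (fun z => ((∑ i, n i * z i + n₀).sign : ℂ) * c z) with hg
  have e1 : ∀ x, trigPoly S (fun z => Complex.I * c z) x = Complex.I * trigPoly S c x := fun x => by
    simp only [trigPoly_apply, Finset.mul_sum, mul_assoc]
  have e2 : ∀ x, trigPoly S (fun z => ((∑ i, n i * z i + n₀).sign : ℂ) * (Complex.I * c z)) x =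
      Complex.I * g x := fun x => by
    simp only [hg, trigPoly_apply, Finset.mul_sum]
    exact Finset.sum_congr rfl fun z _ => by ring
  simp only [e1, e2, norm_mul, Complex.norm_I, one_mul] at h2
  have hexp (t : ℝ) : ‖Complex.exp (Complex.I * (n₀ * t))‖ = 1 := by
    rw [show Complex.I * ((n₀ : ℂ) * t) = ((n₀ * t : ℝ) : ℂ) * Complex.I by push_cast; ring,
      Complex.norm_exp_ofReal_mul_I]
  have e3 (t : ℝ) (x : UnitAddTorus (Fin d)) :
      (Complex.exp (Complex.I * (n₀ * t)) * (Complex.I * g x)).im =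
        (Complex.exp (Complex.I * (n₀ * t)) * g x).re := by
    rw [mul_left_comm, Complex.I_mul_im]
  simp only [e3] at h2
  have ci {F : UnitAddTorus (Fin d) × ℝ → ℝ} (hF : Continuous F) (t : ℝ) :
      Integrable (fun x => |F (x, t)| ^ p) (torusMeasure d) :=
    ((hF.comp (Continuous.prodMk_left t)).abs.rpow_const
      fun _ => Or.inr hp0).integrable_of_hasCompactSupport (HasCompactSupport.of_compactSpace _)
  have ct {F : UnitAddTorus (Fin d) × ℝ → ℝ} (hF : Continuous F) : Continuous
      fun t => ∫ x, |F (x, t)| ^ p ∂torusMeasure d := by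
    have hc : Continuous (Function.uncurry fun (t : ℝ) (x : UnitAddTorus (Fin d)) =>
        |F (x, t)| ^ p) :=
      (hF.comp continuous_swap).abs.rpow_const fun _ => Or.inr hp0
    simpa using continuous_parametric_integral_of_continuous (μ := torusMeasure d) hc
      isCompact_univ
  have cE : Continuous fun q : UnitAddTorus (Fin d) × ℝ =>
    Complex.exp (Complex.I * (n₀ * q.2)) * g q.1 := by fun_prop
  have cre := Complex.continuous_re.comp cE
  have cim := Complex.continuous_im.comp cE
  have h3 : (∫ _ in (0 : ℝ)..2 * Real.pi, ∫ x, ‖g x‖ ^ p ∂torusMeasure d) ≤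
      2 ^ p * ((∫ t in (0 : ℝ)..2 * Real.pi, ∫ x, |(Complex.exp (Complex.I * (n₀ * t)) *
        g x).re| ^ p ∂torusMeasure d) + ∫ t in (0 : ℝ)..2 * Real.pi, ∫ x,
          |(Complex.exp (Complex.I * (n₀ * t)) * g x).im| ^ p ∂torusMeasure d) := by
    have hadd := intervalIntegral.integral_add (μ := volume)
      ((ct cre).intervalIntegrable 0 (2 * Real.pi)) ((ct cim).intervalIntegrable 0 (2 * Real.pi))
    simp only [Function.comp_apply] at hadd
    rw [← hadd, ← intervalIntegral.integral_const_mul]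
    refine intervalIntegral.integral_mono_on hpi.le (by simp)
      ((((ct cre).add (ct cim)).const_mul _).intervalIntegrable _ _) fun t _ => ?_
    have := integral_add (ci cre t) (ci cim t)
    simp only [Function.comp_apply] at this ⊢
    rw [← this, ← integral_const_mul]
    have i1 := ((ci cre t).add (ci cim t)).const_mul ((2 : ℝ) ^ p)
    refine integral_mono ?_ i1 fun x => ?_
    · exact (g.continuous.norm.rpow_const
        fun _ => Or.inr hp0).integrable_of_hasCompactSupport (HasCompactSupport.of_compactSpace _)
    · have h4 := norm_rpow_le_re_im hp0 (Complex.exp (Complex.I * (n₀ * t)) * g x)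
      rwa [norm_mul, hexp, one_mul] at h4
  rw [intervalIntegral.integral_const, smul_eq_mul, sub_zero] at h3
  refine le_of_mul_le_mul_left ?_ hpi
  have h2p : (0 : ℝ) < 2 ^ p := by positivity
  unfold halfSpaceConst
  calc _ ≤ _ := h3
    _ ≤ 2 ^ p * (rieszConst p * (2 * Real.pi * ∫ x, ‖trigPoly S c x‖ ^ p ∂torusMeasure d) +
        rieszConst p * (2 * Real.pi * ∫ x, ‖trigPoly S c x‖ ^ p ∂torusMeasure d)) := by
      gcongr
    _ = _ := by ring

/-! ## Fourier multipliers on `L_q` of the torus -/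

/-- The exponential monomial `exp(2πi z·x)` as an element of `L_q`. -/
def monoLp {d : ℕ} (q : ℝ≥0∞) [Fact (1 ≤ q)] (z : Fin d → ℤ) : Lp ℂ q (torusMeasure d) :=
  ContinuousMap.toLp q (torusMeasure d) ℂ (UnitAddTorus.mFourier z)

theorem toLp_trigPoly {d : ℕ} (q : ℝ≥0∞) [Fact (1 ≤ q)] (S : Finset (Fin d → ℤ))
    (c : (Fin d → ℤ) → ℂ) :
    ContinuousMap.toLp q (torusMeasure d) ℂ (trigPoly S c) = ∑ z ∈ S, c z • monoLp q z := by
  simp [trigPoly, monoLp, map_sum]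

/-- The sequence `m` is the symbol of a Fourier multiplier bounded by `C` on `L_q`. -/
def IsMultiplier {d : ℕ} (q : ℝ≥0∞) [Fact (1 ≤ q)] (C : ℝ) (m : (Fin d → ℤ) → ℂ) : Prop :=
  ∀ (S : Finset (Fin d → ℤ)) (c : (Fin d → ℤ) → ℂ),
    ‖∑ z ∈ S, (m z * c z) • monoLp q z‖ ≤ C * ‖∑ z ∈ S, c z • monoLp q z‖

theorem IsMultiplier.mul {d : ℕ} {q : ℝ≥0∞} [Fact (1 ≤ q)] {C C' : ℝ} {m m' : (Fin d → ℤ) → ℂ}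
    (hC : 0 ≤ C) (h : IsMultiplier q C m) (h' : IsMultiplier q C' m') :
    IsMultiplier q (C * C') fun z => m z * m' z := fun S c => by
  have h1 := h S (fun z => m' z * c z)
  simp only [← mul_assoc] at h1
  refine h1.trans ?_
  rw [mul_assoc]
  exact mul_le_mul_of_nonneg_left (h' S c) hC

theorem IsMultiplier.add {d : ℕ} {q : ℝ≥0∞} [Fact (1 ≤ q)] {C C' : ℝ} {m m' : (Fin d → ℤ) → ℂ}
    (h : IsMultiplier q C m) (h' : IsMultiplier q C' m') :
    IsMultiplier q (C + C') fun z => m z + m' z := fun S c => by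
  simp only [add_mul, add_smul, Finset.sum_add_distrib]
  exact (norm_add_le _ _).trans (add_le_add (h S c) (h' S c))

theorem IsMultiplier.const {d : ℕ} {q : ℝ≥0∞} [Fact (1 ≤ q)] (a : ℂ) :
    IsMultiplier (d := d) q ‖a‖ fun _ => a := fun S c => by
  simp only [mul_smul, ← Finset.smul_sum, norm_smul, le_refl]

theorem IsMultiplier.mono {d : ℕ} {q : ℝ≥0∞} [Fact (1 ≤ q)] {C C' : ℝ} {m : (Fin d → ℤ) → ℂ}
    (h : IsMultiplier q C m) (hC : C ≤ C') : IsMultiplier q C' m := fun S c =>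
  (h S c).trans (mul_le_mul_of_nonneg_right hC (norm_nonneg _))

theorem norm_toLp_rpow {d : ℕ} {p : ℝ} [hp : Fact (1 < p)] (f : C(UnitAddTorus (Fin d), ℂ)) :
    ‖ContinuousMap.toLp (ENNReal.ofReal p) (torusMeasure d) ℂ f‖ =
      (∫ x, ‖f x‖ ^ p ∂torusMeasure d) ^ (1 / p) := by
  have hp0 : 0 < p := one_pos.trans hp.out
  rw [Lp.norm_def, toReal_eLpNorm (Lp.aestronglyMeasurable _),
    lpNorm_eq_integral_norm_rpow_toReal (by simpa using hp0) ENNReal.ofReal_ne_top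
    (Lp.aestronglyMeasurable _), ENNReal.toReal_ofReal hp0.le, one_div]
  congr 1
  refine integral_congr_ae ?_
  filter_upwards [ContinuousMap.coeFn_toLp (p := ENNReal.ofReal p) (𝕜 := ℂ) (torusMeasure d) f]
    with x hx
  rw [hx]

theorem exists_int_sign {d : ℕ} (θ : Fin d → ℝ) (θ₀ : ℝ) (S : Finset (Fin d → ℤ))
    (h : ∀ z ∈ S, ∑ i, θ i * z i + θ₀ ≠ 0) :
    ∃ (n : Fin d → ℤ) (n₀ : ℤ), ∀ z ∈ S, ∑ i, n i * z i + n₀ ≠ 0 ∧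
      ((∑ i, n i * z i + n₀).sign : ℝ) = Real.sign (∑ i, θ i * z i + θ₀) := by
  have hfloor (a : ℝ) : Filter.Tendsto (fun k : ℕ => (⌊(k : ℝ) * a⌋ : ℝ) / k) Filter.atTop
      (nhds a) := by
    rw [tendsto_iff_dist_tendsto_zero]
    refine squeeze_zero' (.of_forall fun _ => dist_nonneg) ?_ (tendsto_one_div_atTop_nhds_zero_nat)
    filter_upwards [Filter.eventually_gt_atTop 0] with k hk
    have hk' : (0 : ℝ) < k := Nat.cast_pos.mpr hk
    have h1 := Int.floor_le ((k : ℝ) * a)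
    have h2 := Int.lt_floor_add_one ((k : ℝ) * a)
    rw [Real.dist_eq, show (⌊(k : ℝ) * a⌋ : ℝ) / k - a = (⌊(k : ℝ) * a⌋ - k * a) / k by
      field_simp, abs_div, abs_of_pos hk']
    gcongr
    rw [abs_le]
    constructor <;> linarith
  have hlim (z : Fin d → ℤ) : Filter.Tendsto (fun k : ℕ =>
      ((∑ i, ⌊(k : ℝ) * θ i⌋ * z i + ⌊(k : ℝ) * θ₀⌋ : ℤ) : ℝ) / k) Filter.atTop
      (nhds (∑ i, θ i * z i + θ₀)) := by
    have := (tendsto_finsetSum Finset.univ fun i _ =>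
      (hfloor (θ i)).mul_const (z i : ℝ)).add (hfloor θ₀)
    refine this.congr fun k => ?_
    push_cast
    rw [add_div, Finset.sum_div]
    congr 1
    exact Finset.sum_congr rfl fun i _ => by ring
  have hev : ∀ᶠ k : ℕ in Filter.atTop, ∀ z ∈ S,
      0 < (((∑ i, ⌊(k : ℝ) * θ i⌋ * z i + ⌊(k : ℝ) * θ₀⌋ : ℤ) : ℝ) / k) *
        (∑ i, θ i * z i + θ₀) := by
    rw [Filter.eventually_all_finset]
    intro z hz
    refine ((hlim z).mul_const _).eventually (lt_mem_nhds ?_)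
    exact mul_self_pos.mpr (h z hz)
  obtain ⟨k, hk, hk0⟩ := (hev.and (Filter.eventually_gt_atTop 0)).exists
  refine ⟨fun i => ⌊(k : ℝ) * θ i⌋, ⌊(k : ℝ) * θ₀⌋, fun z hz => ?_⟩
  have h1 := hk z hz
  have hk' : (0 : ℝ) < k := Nat.cast_pos.mpr hk0
  generalize (∑ i, ⌊(k : ℝ) * θ i⌋ * z i + ⌊(k : ℝ) * θ₀⌋ : ℤ) = a at *
  generalize ∑ i, θ i * z i + θ₀ = b at *
  rw [← Real.sign_intCast]
  rw [div_mul_eq_mul_div, div_pos_iff_of_pos_right hk'] at h1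
  refine ⟨by rintro rfl; simp at h1, ?_⟩
  rcases pos_and_pos_or_neg_and_neg_of_mul_pos h1 with ⟨h2, h3⟩ | ⟨h2, h3⟩
  · rw [Real.sign_of_pos h2, Real.sign_of_pos h3]
  · rw [Real.sign_of_neg h2, Real.sign_of_neg h3]

/-- The norm of half-space multipliers on `L_p`. -/
def halfSpaceNorm (p : ℝ) : ℝ := halfSpaceConst p ^ (1 / p)

theorem halfSpaceNorm_nonneg (p : ℝ) : 0 ≤ halfSpaceNorm p :=
  Real.rpow_nonneg (halfSpaceConst_nonneg p) _

theorem norm_halfSpace_le {d : ℕ} {p : ℝ} [Fact (1 < p)] (hp : 2 ≤ p) (θ : Fin d → ℝ) (θ₀ : ℝ)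
    (S : Finset (Fin d → ℤ)) (c : (Fin d → ℤ) → ℂ) (h : ∀ z ∈ S, ∑ i, θ i * z i + θ₀ ≠ 0) :
    ‖∑ z ∈ S, ((Real.sign (∑ i, θ i * z i + θ₀) : ℂ) * c z) • monoLp (ENNReal.ofReal p) z‖ ≤
      halfSpaceNorm p * ‖∑ z ∈ S, c z • monoLp (ENNReal.ofReal p) z‖ := by
  obtain ⟨n, n₀, hn⟩ := exists_int_sign θ θ₀ S h
  have h1 := integral_halfSpace_le hp n n₀ S c fun z hz => (hn z hz).1
  have h2 : ∑ z ∈ S, ((Real.sign (∑ i, θ i * z i + θ₀) : ℂ) * c z) •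
      monoLp (ENNReal.ofReal p) z =
      ∑ z ∈ S, (((∑ i, n i * z i + n₀).sign : ℂ) * c z) • monoLp (ENNReal.ofReal p) z :=
    Finset.sum_congr rfl fun z hz => by rw [← (hn z hz).2]; norm_cast
  rw [h2, ← toLp_trigPoly _ S (fun z => ((∑ i, n i * z i + n₀).sign : ℂ) * c z),
    ← toLp_trigPoly, norm_toLp_rpow, norm_toLp_rpow, halfSpaceNorm,
    ← Real.mul_rpow (halfSpaceConst_nonneg p) (integral_nonneg fun x => by positivity)]
  exact Real.rpow_le_rpow (integral_nonneg fun x => by positivity) h1 (by positivity)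

/-- Half-space multipliers whose boundary contains no lattice point. -/
theorem isMultiplier_sign {d : ℕ} {p : ℝ} [Fact (1 < p)] (hp : 2 ≤ p) (θ : Fin d → ℝ) (θ₀ : ℝ)
    (h : ∀ z : Fin d → ℤ, ∑ i, θ i * z i + θ₀ ≠ 0) :
    IsMultiplier (ENNReal.ofReal p) (halfSpaceNorm p)
      fun z : Fin d → ℤ => (Real.sign (∑ i, θ i * z i + θ₀) : ℂ) :=
  fun S c => norm_halfSpace_le hp θ θ₀ S c fun z _ => h z

/-! ### Averages of half-spaces -/

section Ball

variable {H : Type*} [NormedAddCommGroup H] [InnerProductSpace ℝ H] [FiniteDimensional ℝ H]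
  [MeasurableSpace H] [BorelSpace H]

theorem measurable_realSign : Measurable Real.sign :=
  Measurable.ite measurableSet_Iio measurable_const
    (Measurable.ite measurableSet_Ioi measurable_const measurable_const)

theorem abs_realSign_le (r : ℝ) : |Real.sign r| ≤ 1 := by
  rcases Real.sign_apply_eq r with h | h | h <;> rw [h] <;> norm_num

theorem realSign_mul_self (r : ℝ) : Real.sign r * r = |r| := by
  rcases lt_trichotomy r 0 with h | rfl | h
  · rw [Real.sign_of_neg h, abs_of_neg h, neg_one_mul]
  · simp
  · rw [Real.sign_of_pos h, abs_of_pos h, one_mul]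

theorem integrableOn_ball_inner_mul_sign (w ζ : H) :
    IntegrableOn (fun θ : H => ⟪θ, w⟫_ℝ * Real.sign ⟪θ, ζ⟫_ℝ) (Metric.ball 0 1) := by
  refine Measure.integrableOn_of_bounded (M := ‖w‖) measure_ball_lt_top.ne ?_ ?_
  · exact ((by fun_prop : Measurable fun θ : H => ⟪θ, w⟫_ℝ).mul
      (measurable_realSign.comp (by fun_prop))).aestronglyMeasurable
  · refine ae_restrict_of_forall_mem measurableSet_ball fun θ hθ => ?_
    rw [mem_ball_zero_iff] at hθ
    rw [norm_mul, Real.norm_eq_abs (Real.sign _)]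
    calc ‖⟪θ, w⟫_ℝ‖ * |Real.sign ⟪θ, ζ⟫_ℝ| ≤ (‖θ‖ * ‖w‖) * 1 := by
          gcongr
          · exact norm_inner_le_norm θ w
          · exact abs_realSign_le _
      _ ≤ ‖w‖ := by nlinarith [norm_nonneg w]

theorem setIntegral_ball_comp_isometry (T : H ≃ₗᵢ[ℝ] H) (f : H → ℝ) :
    ∫ θ in Metric.ball (0 : H) 1, f (T θ) = ∫ θ in Metric.ball (0 : H) 1, f θ := by
  have h := T.measurePreserving.setIntegral_preimage_emb
    T.toHomeomorph.measurableEmbedding f (Metric.ball 0 1)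
  rw [← h]
  congr 2
  ext θ
  simp

/-- The first absolute moment of the ball in direction `e`. -/
def ballMoment (e : H) : ℝ := ∫ θ in Metric.ball (0 : H) 1, |⟪θ, e⟫_ℝ|

theorem ballMoment_eq {e e' : H} (h : ‖e‖ = ‖e'‖) : ballMoment e = ballMoment e' := by
  let T := (ℝ ∙ (e - e'))ᗮ.reflection
  have hT : T e = e' := Submodule.reflection_sub h
  unfold ballMoment
  rw [← setIntegral_ball_comp_isometry T (fun θ => |⟪θ, e'⟫_ℝ|)]
  simp_rw [← hT, LinearIsometryEquiv.inner_map_map]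

theorem ballMoment_pos {e : H} (h : e ≠ 0) : 0 < ballMoment e := by
  have hc : Continuous fun θ : H => |⟪θ, e⟫_ℝ| := by fun_prop
  unfold ballMoment
  rw [setIntegral_pos_iff_support_of_nonneg_ae (.of_forall fun _ => abs_nonneg _)]
  · refine IsOpen.measure_pos _ ((hc.isOpen_support).inter Metric.isOpen_ball)
      ⟨(2 * ‖e‖)⁻¹ • e, ?_, ?_⟩
    · simp [inner_smul_left, h]
    · have : 0 < ‖e‖ := norm_pos_iff.mpr h
      rw [mem_ball_zero_iff, norm_smul, norm_inv, Real.norm_of_nonneg (by positivity)]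
      field_simp
      norm_num
  · exact (hc.continuousOn.integrableOn_compact (isCompact_closedBall 0 1)).mono_set
      Metric.ball_subset_closedBall

theorem setIntegral_ball_inner_mul_sign {ζ : H} (hζ : ζ ≠ 0) {e : H} (he : ‖e‖ = 1) (w : H) :
    ∫ θ in Metric.ball (0 : H) 1, ⟪θ, w⟫_ℝ * Real.sign ⟪θ, ζ⟫_ℝ =
      ballMoment e * (⟪w, ζ⟫_ℝ / ‖ζ‖) := by
  have hn : 0 < ‖ζ‖ := norm_pos_iff.mpr hζ
  have hpar : ∫ θ in Metric.ball (0 : H) 1, ⟪θ, ζ⟫_ℝ * Real.sign ⟪θ, ζ⟫_ℝ =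
      ballMoment e * ‖ζ‖ := by
    have h1 : ballMoment e = ballMoment (‖ζ‖⁻¹ • ζ) :=
      ballMoment_eq (by rw [he, norm_smul, norm_inv, norm_norm, inv_mul_cancel₀ hn.ne'])
    rw [h1, ballMoment, ← integral_mul_const]
    refine integral_congr_ae (.of_forall fun θ => ?_)
    simp only [inner_smul_right, abs_mul, abs_inv, abs_norm]
    rw [mul_comm ⟪θ, ζ⟫_ℝ, realSign_mul_self]
    field_simp
  have hperp (η : H) (hη : ⟪η, ζ⟫_ℝ = 0) :
      ∫ θ in Metric.ball (0 : H) 1, ⟪θ, η⟫_ℝ * Real.sign ⟪θ, ζ⟫_ℝ = 0 := by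
    let T := (ℝ ∙ η)ᗮ.reflection
    have hT : T η = -η := Submodule.reflection_orthogonalComplement_singleton_eq_neg η
    have hTζ : T ζ = ζ := by
      rw [Submodule.reflection_eq_self_iff, Submodule.mem_orthogonal_singleton_iff_inner_right]
      exact hη
    have h1 := setIntegral_ball_comp_isometry T (fun θ => ⟪θ, η⟫_ℝ * Real.sign ⟪θ, ζ⟫_ℝ)
    have h2 (θ : H) : ⟪T θ, η⟫_ℝ * Real.sign ⟪T θ, ζ⟫_ℝ = -(⟪θ, η⟫_ℝ * Real.sign ⟪θ, ζ⟫_ℝ) := by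
      have h3 : ⟪T θ, η⟫_ℝ = -⟪θ, η⟫_ℝ := by
        rw [← T.inner_map_map θ η, hT, inner_neg_right, neg_neg]
      have h4 : ⟪T θ, ζ⟫_ℝ = ⟪θ, ζ⟫_ℝ := by rw [← T.inner_map_map θ ζ, hTζ]
      rw [h3, h4, neg_mul]
    simp_rw [h2, integral_neg] at h1
    linarith
  set a := ⟪w, ζ⟫_ℝ / ‖ζ‖ ^ 2 with ha
  have hw := hperp (w - a • ζ) (by
    rw [inner_sub_left, inner_smul_left, real_inner_self_eq_norm_sq, ha]
    simp
    field_simp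
    ring)
  simp only [inner_sub_right, inner_smul_right, sub_mul] at hw
  rw [integral_sub (integrableOn_ball_inner_mul_sign w ζ)
    (by simpa only [mul_assoc] using (integrableOn_ball_inner_mul_sign ζ ζ).const_mul a)] at hw
  simp only [mul_assoc] at hw
  rw [integral_const_mul, hpar] at hw
  rw [sub_eq_zero.mp hw, ha]
  field_simp

end Ball

/-- The vector `(1, 2πz)`, whose length is the symbol of `(1 - Δ)^{1/2}`. -/
def freqVec {d : ℕ} (z : Fin d → ℤ) : EuclideanSpace ℝ (Fin (d + 1)) :=
  WithLp.toLp 2 (Fin.cons 1 fun i => 2 * Real.pi * z i)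

theorem inner_freqVec {d : ℕ} (θ : EuclideanSpace ℝ (Fin (d + 1))) (z : Fin d → ℤ) :
    ⟪θ, freqVec z⟫_ℝ = ∑ i : Fin d, (2 * Real.pi * θ i.succ) * z i + θ 0 := by
  rw [PiLp.inner_apply, Fin.sum_univ_succ, add_comm]
  simp only [freqVec, Fin.cons_zero, Fin.cons_succ, RCLike.inner_apply, conj_trivial]
  rw [one_mul]
  congr 1
  exact Finset.sum_congr rfl fun i _ => by ring

theorem norm_freqVec_sq {d : ℕ} (z : Fin d → ℤ) :
    ‖freqVec z‖ ^ 2 = 1 + 4 * Real.pi ^ 2 * ∑ k, (z k : ℝ) ^ 2 := by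
  rw [EuclideanSpace.norm_sq_eq, Fin.sum_univ_succ, Finset.mul_sum]
  simp only [freqVec, Fin.cons_zero, Fin.cons_succ, Real.norm_eq_abs, sq_abs]
  congr 1
  · norm_num
  · exact Finset.sum_congr rfl fun i _ => by ring

theorem freqVec_ne_zero {d : ℕ} (z : Fin d → ℤ) : freqVec z ≠ 0 := fun h => by
  have := norm_freqVec_sq z
  rw [h, norm_zero] at this
  have h2 : 0 ≤ 4 * Real.pi ^ 2 * ∑ k, (z k : ℝ) ^ 2 := by positivity
  norm_num at this
  linarith

theorem ae_inner_freqVec_ne_zero (d : ℕ) : ∀ᵐ θ : EuclideanSpace ℝ (Fin (d + 1)),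
    ∀ z : Fin d → ℤ, ⟪θ, freqVec z⟫_ℝ ≠ 0 := by
  rw [ae_all_iff]
  intro z
  have h : (ℝ ∙ freqVec z)ᗮ ≠ ⊤ := by
    rw [Ne, Submodule.orthogonal_eq_top_iff, Submodule.span_singleton_eq_bot]
    exact freqVec_ne_zero z
  refine measure_mono_null ?_ (Measure.addHaar_submodule volume _ h)
  intro θ hθ
  simp only [Set.mem_compl_iff, Set.mem_ofPred_eq, not_not] at hθ
  exact Submodule.mem_orthogonal_singleton_iff_inner_left.mpr hθ

/-- The `L_p` norm of the multipliers `isMultiplier_freqVec`. -/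
def besselNorm (d : ℕ) (p : ℝ) : ℝ :=
  (volume.real (Metric.ball (0 : EuclideanSpace ℝ (Fin (d + 1))) 1) * halfSpaceNorm p) /
    ballMoment (EuclideanSpace.single (0 : Fin (d + 1)) (1 : ℝ))

theorem besselNorm_nonneg (d : ℕ) (p : ℝ) : 0 ≤ besselNorm d p :=
  div_nonneg (mul_nonneg measureReal_nonneg (halfSpaceNorm_nonneg p))
    (ballMoment_pos (by simp)).le

/-- The components of `(1, 2πz) / (1 + 4π²|z|²)^{1/2}` are Fourier multipliers on `L_p`. -/
theorem isMultiplier_freqVec {d : ℕ} {p : ℝ} [Fact (1 < p)] (hp : 2 ≤ p) (j : Fin (d + 1)) :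
    IsMultiplier (ENNReal.ofReal p) (besselNorm d p)
      fun z : Fin d → ℤ => ((freqVec z j / ‖freqVec z‖ : ℝ) : ℂ) := fun S c => by
  set e := EuclideanSpace.single (0 : Fin (d + 1)) (1 : ℝ)
  have he : ‖e‖ = 1 := by simp [e]
  have hκ : 0 < ballMoment e := ballMoment_pos (by simp [e])
  have hej : ‖EuclideanSpace.single j (1 : ℝ)‖ = 1 := by simp
  let w : EuclideanSpace ℝ (Fin (d + 1)) := EuclideanSpace.single j 1
  let G : EuclideanSpace ℝ (Fin (d + 1)) → Lp ℂ (ENNReal.ofReal p) (torusMeasure d) := fun θ =>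
    ∑ z ∈ S, ((⟪θ, w⟫_ℝ * Real.sign ⟪θ, freqVec z⟫_ℝ : ℝ) : ℂ) •
      (c z • monoLp (ENNReal.ofReal p) z)
  have hInt : ∫ θ in Metric.ball 0 1, G θ = (ballMoment e : ℂ) •
      ∑ z ∈ S, (((freqVec z j / ‖freqVec z‖ : ℝ) : ℂ) * c z) • monoLp (ENNReal.ofReal p) z := by
    rw [integral_finsetSum, Finset.smul_sum]
    · refine Finset.sum_congr rfl fun z _ => ?_
      rw [integral_smul_const, integral_complex_ofReal,
        setIntegral_ball_inner_mul_sign (freqVec_ne_zero z) he, smul_smul, smul_smul,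
        Complex.ofReal_mul, mul_assoc]
      congr 5
      simp only [w]
      rw [EuclideanSpace.inner_single_left]
      simp
    · intro z _
      exact ((integrableOn_ball_inner_mul_sign w (freqVec z)).ofReal).smul_const _
  have hbound : ‖∫ θ in Metric.ball 0 1, G θ‖ ≤
      (halfSpaceNorm p * ‖∑ z ∈ S, c z • monoLp (ENNReal.ofReal p) z‖) *
        volume.real (Metric.ball (0 : EuclideanSpace ℝ (Fin (d + 1))) 1) := by
    refine norm_setIntegral_le_of_norm_le_const_ae measure_ball_lt_top ?_
    filter_upwards [ae_restrict_mem measurableSet_ball,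
      ae_restrict_of_ae (ae_inner_freqVec_ne_zero d)] with θ hθ hne
    have h1 : G θ = (⟪θ, w⟫_ℝ : ℂ) • ∑ z ∈ S,
        ((Real.sign (∑ i : Fin d, (2 * Real.pi * θ i.succ) * z i + θ 0) : ℂ) * c z) •
          monoLp (ENNReal.ofReal p) z := by
      rw [Finset.smul_sum]
      refine Finset.sum_congr rfl fun z _ => ?_
      rw [inner_freqVec, Complex.ofReal_mul, smul_smul, smul_smul, mul_assoc]
    have h2 := norm_halfSpace_le hp (fun i : Fin d => 2 * Real.pi * θ i.succ) (θ 0) S c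
      fun z _ => by rw [← inner_freqVec]; exact hne z
    rw [h1, norm_smul, Complex.norm_real]
    rw [mem_ball_zero_iff] at hθ
    have h3 : ‖⟪θ, w⟫_ℝ‖ ≤ 1 := by
      refine (norm_inner_le_norm θ w).trans ?_
      rw [show ‖w‖ = 1 from hej, mul_one]
      exact hθ.le
    calc _ ≤ 1 * _ := mul_le_mul_of_nonneg_right h3 (norm_nonneg _)
      _ ≤ _ := by rw [one_mul]; exact h2
  rw [hInt, norm_smul, Complex.norm_real, Real.norm_of_nonneg hκ.le] at hbound
  rw [besselNorm, div_mul_eq_mul_div, le_div_iff₀ hκ]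
  linarith

/-- The symbol of the projection onto the frequencies in a cube. -/
def cubeSymbol {d : ℕ} (N : ℕ) (z : Fin d → ℤ) : ℂ := if ∀ i, |z i| ≤ N then 1 else 0

theorem isMultiplier_coord_le {d : ℕ} {p : ℝ} [Fact (1 < p)] (hp : 2 ≤ p) (s : ℝ) (hs : |s| = 1)
    (i : Fin d) (N : ℕ) : IsMultiplier (ENNReal.ofReal p) (1 + halfSpaceNorm p)
      fun z : Fin d → ℤ => if s * z i ≤ N then (1 : ℂ) else 0 := by
  have hs' : s = 1 ∨ s = -1 := by
    rcases abs_choice s with h | h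
    · left; rw [← h, hs]
    · right; linarith
  have hsum (z : Fin d → ℤ) : ∑ k, (if k = i then -s else 0) * (z k : ℝ) + (N + 1 / 2 : ℝ) =
      N + 1 / 2 - s * z i := by
    simp; ring
  have hint (z : Fin d → ℤ) : (s * z i ≤ N ∧ 0 < (N + 1 / 2 : ℝ) - s * z i) ∨
      (¬ s * z i ≤ N ∧ (N + 1 / 2 : ℝ) - s * z i < 0) := by
    have key (a : ℤ) : ((a : ℝ) ≤ N ∧ 0 < (N + 1 / 2 : ℝ) - a) ∨
        (¬ (a : ℝ) ≤ N ∧ (N + 1 / 2 : ℝ) - a < 0) := by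
      rcases le_or_gt a (N : ℤ) with h | h
      · left
        have : (a : ℝ) ≤ N := by exact_mod_cast h
        exact ⟨this, by linarith⟩
      · right
        have : (N : ℝ) + 1 ≤ a := by exact_mod_cast h
        exact ⟨by linarith, by linarith⟩
    rcases hs' with rfl | rfl
    · simpa using key (z i)
    · simpa using key (-z i)
  have h1 := isMultiplier_sign hp (fun k => if k = i then -s else 0) (N + 1 / 2 : ℝ) fun z => by
    rw [hsum]
    rcases hint z with h | h
    · exact h.2.ne'
    · exact h.2.ne
  have h2 := ((IsMultiplier.const (1 / 2)).mul (norm_nonneg _)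
    ((IsMultiplier.const (d := d) (q := ENNReal.ofReal p) 1).add h1)).mono
    (C' := 1 + halfSpaceNorm p) (by
      have := halfSpaceNorm_nonneg p
      norm_num; linarith)
  convert h2 using 2 with z
  rw [hsum]
  rcases hint z with h | h
  · rw [if_pos h.1, Real.sign_of_pos h.2]; norm_num
  · rw [if_neg h.1, Real.sign_of_neg h.2]; norm_num

theorem isMultiplier_prod {d : ℕ} {q : ℝ≥0∞} [Fact (1 ≤ q)] {ι : Type*} (s : Finset ι) {C : ℝ}
    (hC : 0 ≤ C) (m : ι → (Fin d → ℤ) → ℂ) (h : ∀ i ∈ s, IsMultiplier q C (m i)) :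
    IsMultiplier q (C ^ s.card) fun z => ∏ i ∈ s, m i z := by
  classical
  induction s using Finset.induction_on with
  | empty => simpa using IsMultiplier.const (d := d) (q := q) 1
  | insert a s ha ih =>
    simp only [Finset.prod_insert ha, Finset.card_insert_of_notMem ha, pow_succ']
    exact (h a (Finset.mem_insert_self a s)).mul hC
      (ih fun i hi => h i (Finset.mem_insert_of_mem hi))

/-- The `L_p` norm of cube projections. -/
def cubeNorm (d : ℕ) (p : ℝ) : ℝ := ((1 + halfSpaceNorm p) * (1 + halfSpaceNorm p)) ^ d

theorem cubeNorm_nonneg (d : ℕ) (p : ℝ) : 0 ≤ cubeNorm d p := by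
  have := halfSpaceNorm_nonneg p
  unfold cubeNorm; positivity

/-- Cube projections are bounded on `L_p`, uniformly in the size of the cube. -/
theorem isMultiplier_cubeSymbol {d : ℕ} {p : ℝ} [Fact (1 < p)] (hp : 2 ≤ p) (N : ℕ) :
    IsMultiplier (ENNReal.ofReal p) (cubeNorm d p) (cubeSymbol (d := d) N) := by
  have h0 : 0 ≤ 1 + halfSpaceNorm p := by linarith [halfSpaceNorm_nonneg p]
  have h := isMultiplier_prod (Finset.univ : Finset (Fin d)) (mul_nonneg h0 h0) _ fun i _ =>
    (isMultiplier_coord_le hp 1 (by simp) i N).mul h0 (isMultiplier_coord_le hp (-1) (by simp) i N)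
  rw [Finset.card_univ, Fintype.card_fin] at h
  rw [cubeNorm]
  convert h using 1
  funext z
  unfold cubeSymbol
  simp only [← ite_and, mul_ite, mul_one, mul_zero, Finset.prod_ite_zero, Finset.prod_const_one]
  refine if_congr (forall_congr' fun i => ?_) rfl rfl
  simp only [Finset.mem_univ, true_implies, one_mul, neg_one_mul, abs_le]
  constructor
  · rintro ⟨h1, h2⟩
    exact ⟨by rw [neg_le]; exact_mod_cast h1, by exact_mod_cast h2⟩
  · rintro ⟨h1, h2⟩
    exact ⟨by rw [neg_le] at h1; exact_mod_cast h1, by exact_mod_cast h2⟩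

/-! ## Fourier coefficients of integrable functions -/

theorem integral_mFourier {d : ℕ} (z : Fin d → ℤ) :
    ∫ x, UnitAddTorus.mFourier z x ∂torusMeasure d = if z = 0 then 1 else 0 := by
  classical
  have h := orthonormal_iff_ite.mp (UnitAddTorus.orthonormal_mFourier (d := Fin d)) 0 z
  rw [ContinuousMap.inner_toLp] at h
  have h2 : ∀ x : UnitAddTorus (Fin d), UnitAddTorus.mFourier z x *
      (starRingEnd ℂ) (UnitAddTorus.mFourier (0 : Fin d → ℤ) x) = UnitAddTorus.mFourier z x :=
    fun x => by simp [UnitAddTorus.mFourier_zero]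
  simp_rw [h2] at h
  simp_rw [eq_comm (a := z)]
  exact h

theorem norm_mFourier_apply {d : ℕ} (z : Fin d → ℤ) (x : UnitAddTorus (Fin d)) :
    ‖UnitAddTorus.mFourier z x‖ = 1 := by
  simp only [UnitAddTorus.mFourier, ContinuousMap.coe_mk, norm_prod, fourier_apply,
    Circle.norm_coe, Finset.prod_const_one]

theorem integrable_mFourier_mul {d : ℕ} (z : Fin d → ℤ) {f : UnitAddTorus (Fin d) → ℂ}
    (hf : Integrable f (torusMeasure d)) :
    Integrable (fun x => UnitAddTorus.mFourier z x * f x) (torusMeasure d) :=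
  hf.bdd_mul (UnitAddTorus.mFourier z).continuous.aestronglyMeasurable
    (.of_forall fun x => (norm_mFourier_apply z x).le)

/-- An integrable function on the torus all of whose Fourier coefficients vanish is zero. -/
theorem ae_eq_zero_of_mFourierCoeff {d : ℕ} {f : UnitAddTorus (Fin d) → ℂ}
    (hf : Integrable f (torusMeasure d)) (h : ∀ z, UnitAddTorus.mFourierCoeff f z = 0) :
    f =ᵐ[torusMeasure d] 0 := by
  let Λ : C(UnitAddTorus (Fin d), ℂ) →L[ℂ] ℂ := LinearMap.mkContinuous
    { toFun := fun g => ∫ x, g x * f x ∂torusMeasure d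
      map_add' := fun g g' => by
        rw [← integral_add]
        · exact integral_congr_ae (.of_forall fun x => by simp [add_mul])
        · exact hf.bdd_mul g.continuous.aestronglyMeasurable
            (.of_forall fun x => g.norm_coe_le_norm x)
        · exact hf.bdd_mul g'.continuous.aestronglyMeasurable
            (.of_forall fun x => g'.norm_coe_le_norm x)
      map_smul' := fun a g => by
        simp only [ContinuousMap.smul_apply, smul_eq_mul, mul_assoc, RingHom.id_apply]
        exact integral_const_mul _ _ }
    (∫ x, ‖f x‖ ∂torusMeasure d) (fun g => by
      refine (norm_integral_le_integral_norm _).trans ?_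
      rw [mul_comm, ← integral_const_mul]
      refine integral_mono_of_nonneg (.of_forall fun x => norm_nonneg _) (hf.norm.const_mul _)
        (.of_forall fun x => ?_)
      simp only [norm_mul]
      exact mul_le_mul_of_nonneg_right (g.norm_coe_le_norm x) (norm_nonneg _))
  have hΛ (g : C(UnitAddTorus (Fin d), ℂ)) : Λ g = 0 := by
    have hle : (Submodule.span ℂ (Set.range (UnitAddTorus.mFourier (d := Fin d)))) ≤
        LinearMap.ker Λ.toLinearMap := by
      rw [Submodule.span_le]
      rintro _ ⟨z, rfl⟩
      have := h (-z)
      rw [UnitAddTorus.mFourierCoeff, neg_neg] at this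
      exact this
    have hcl : (Submodule.span ℂ (Set.range
        (UnitAddTorus.mFourier (d := Fin d)))).topologicalClosure ≤ LinearMap.ker Λ.toLinearMap :=
      Submodule.topologicalClosure_minimal _ hle Λ.isClosed_ker
    rw [UnitAddTorus.span_mFourier_closure_eq_top] at hcl
    exact hcl (Submodule.mem_top (x := g))
  refine ae_eq_zero_of_forall_setIntegral_isClosed_eq_zero hf fun F hF => ?_
  have ht : Filter.Tendsto (fun n => ∫ x, ((hF.apprSeq n x : ℝ) : ℂ) * f x ∂torusMeasure d)
      Filter.atTop (nhds (∫ x, F.indicator (fun _ => (1 : ℂ)) x * f x ∂torusMeasure d)) := by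
    refine tendsto_integral_of_dominated_convergence (fun x => ‖f x‖) (fun n => ?_) hf.norm
      (fun n => .of_forall fun x => ?_) (.of_forall fun x => ?_)
    · exact (Complex.continuous_ofReal.comp (NNReal.continuous_coe.comp
        (hF.apprSeq n).continuous)).aestronglyMeasurable.mul hf.1
    · rw [norm_mul, Complex.norm_real, NNReal.norm_eq]
      exact mul_le_of_le_one_left (norm_nonneg _)
        (by exact_mod_cast HasOuterApproxClosed.apprSeq_apply_le_one hF n x)
    · refine Filter.Tendsto.mul_const _ ?_
      have h1 := (tendsto_pi_nhds.mp (HasOuterApproxClosed.tendsto_apprSeq hF)) x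
      have h2 := (Complex.continuous_ofReal.tendsto _).comp
        ((NNReal.continuous_coe.tendsto _).comp h1)
      have h3 : F.indicator (fun _ => (1 : ℂ)) x =
          (((F.indicator (fun _ => (1 : NNReal)) x : NNReal) : ℝ) : ℂ) := by
        by_cases hx : x ∈ F
        · rw [Set.indicator_of_mem hx, Set.indicator_of_mem hx]; simp
        · rw [Set.indicator_of_notMem hx, Set.indicator_of_notMem hx]; simp
      rw [h3]
      exact h2
  have hz (n : ℕ) : ∫ x, ((hF.apprSeq n x : ℝ) : ℂ) * f x ∂torusMeasure d = 0 :=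
    hΛ ⟨fun x => ((hF.apprSeq n x : ℝ) : ℂ), by fun_prop⟩
  simp only [hz] at ht
  have h0 := tendsto_nhds_unique ht tendsto_const_nhds
  rw [← h0, ← integral_indicator hF.measurableSet]
  refine integral_congr_ae (.of_forall fun x => ?_)
  by_cases hx : x ∈ F
  · simp only [Set.indicator_of_mem hx, one_mul]
  · simp only [Set.indicator_of_notMem hx, zero_mul]

theorem mFourierCoeff_conj {d : ℕ} (f : UnitAddTorus (Fin d) → ℂ) (z : Fin d → ℤ) :
    UnitAddTorus.mFourierCoeff (fun x => (starRingEnd ℂ) (f x)) z =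
      (starRingEnd ℂ) (UnitAddTorus.mFourierCoeff f (-z)) := by
  unfold UnitAddTorus.mFourierCoeff
  rw [← integral_conj]
  refine integral_congr_ae (.of_forall fun x => ?_)
  simp [UnitAddTorus.mFourier_neg]

theorem mFourierCoeff_sub {d : ℕ} {f g : UnitAddTorus (Fin d) → ℂ}
    (hf : Integrable f (torusMeasure d)) (hg : Integrable g (torusMeasure d)) (z : Fin d → ℤ) :
    UnitAddTorus.mFourierCoeff (fun x => f x - g x) z =
      UnitAddTorus.mFourierCoeff f z - UnitAddTorus.mFourierCoeff g z := by
  unfold UnitAddTorus.mFourierCoeff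
  simp only [smul_sub]
  exact integral_sub (integrable_mFourier_mul (-z) hf) (integrable_mFourier_mul (-z) hg)

theorem mFourierCoeff_add {d : ℕ} {f g : UnitAddTorus (Fin d) → ℂ}
    (hf : Integrable f (torusMeasure d)) (hg : Integrable g (torusMeasure d)) (z : Fin d → ℤ) :
    UnitAddTorus.mFourierCoeff (fun x => f x + g x) z =
      UnitAddTorus.mFourierCoeff f z + UnitAddTorus.mFourierCoeff g z := by
  unfold UnitAddTorus.mFourierCoeff
  simp only [smul_add]
  exact integral_add (integrable_mFourier_mul (-z) hf) (integrable_mFourier_mul (-z) hg)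

theorem mFourierCoeff_congr_ae {d : ℕ} {f g : UnitAddTorus (Fin d) → ℂ}
    (h : f =ᵐ[torusMeasure d] g) (z : Fin d → ℤ) :
    UnitAddTorus.mFourierCoeff f z = UnitAddTorus.mFourierCoeff g z :=
  integral_congr_ae (h.mono fun x hx => by simp only [hx])

theorem ae_eq_of_mFourierCoeff {d : ℕ} {f g : UnitAddTorus (Fin d) → ℂ}
    (hf : Integrable f (torusMeasure d)) (hg : Integrable g (torusMeasure d))
    (h : ∀ z, UnitAddTorus.mFourierCoeff f z = UnitAddTorus.mFourierCoeff g z) :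
    f =ᵐ[torusMeasure d] g := by
  have := ae_eq_zero_of_mFourierCoeff (hf.sub hg) fun z => by
    rw [← sub_eq_zero.mpr (h z)]
    exact mFourierCoeff_sub hf hg z
  filter_upwards [this] with x hx
  exact sub_eq_zero.mp hx

theorem ofCoeff_ae_eq {d : ℕ} {c : (Fin d → ℤ) → ℂ} {f : UnitAddTorus (Fin d) → ℝ}
    (hf : Integrable f (torusMeasure d))
    (h : ∀ z, UnitAddTorus.mFourierCoeff (fun x => (f x : ℂ)) z = c z) :
    ofCoeff c =ᵐ[torusMeasure d] f := by
  have hex : ∃ f : UnitAddTorus (Fin d) → ℝ, Integrable f (torusMeasure d) ∧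
      ∀ z, UnitAddTorus.mFourierCoeff (fun x => (f x : ℂ)) z = c z := ⟨f, hf, h⟩
  have h1 : ofCoeff c = hex.choose := dif_pos hex
  have h2 := hex.choose_spec
  rw [h1]
  have h3 := ae_eq_of_mFourierCoeff h2.1.ofReal hf.ofReal fun z => (h2.2 z).trans (h z).symm
  filter_upwards [h3] with x hx
  exact Complex.ofReal_injective hx

/-- A function whose Fourier coefficients are hermitian is real. -/
theorem ae_real_of_hermitian {d : ℕ} {f : UnitAddTorus (Fin d) → ℂ}
    (hf : Integrable f (torusMeasure d))
    (h : ∀ z, (starRingEnd ℂ) (UnitAddTorus.mFourierCoeff f z) =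
      UnitAddTorus.mFourierCoeff f (-z)) :
    ∀ᵐ x ∂torusMeasure d, ((f x).re : ℂ) = f x := by
  have hconj : Integrable (fun x => (starRingEnd ℂ) (f x)) (torusMeasure d) :=
    Complex.conjCLE.toContinuousLinearMap.integrable_comp hf
  have h1 := ae_eq_of_mFourierCoeff hconj hf fun z => by
    rw [mFourierCoeff_conj, h, neg_neg]
  filter_upwards [h1] with x hx
  exact Complex.conj_eq_iff_re.mp hx

/-- Parseval's identity for real functions. -/
theorem hasSum_sq_coeff {d : ℕ} {f : UnitAddTorus (Fin d) → ℝ}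
    (hf : MemLp f 2 (torusMeasure d)) :
    HasSum (fun z => ‖UnitAddTorus.mFourierCoeff (fun x => (f x : ℂ)) z‖ ^ 2)
      (∫ x, f x ^ 2 ∂torusMeasure d) := by
  have hc : MemLp (fun x => (f x : ℂ)) 2 (torusMeasure d) := hf.ofReal
  have h := UnitAddTorus.hasSum_sq_mFourierCoeff (hc.toLp _)
  have he := hc.coeFn_toLp
  have h1 : ∫ x, ‖hc.toLp _ x‖ ^ 2 ∂torusMeasure d = ∫ x, f x ^ 2 ∂torusMeasure d := by
    refine integral_congr_ae ?_
    filter_upwards [he] with x hx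
    rw [hx, Complex.norm_real, Real.norm_eq_abs, sq_abs]
  have h2 (z : Fin d → ℤ) : UnitAddTorus.mFourierCoeff (hc.toLp _) z =
      UnitAddTorus.mFourierCoeff (fun x => (f x : ℂ)) z := mFourierCoeff_congr_ae he z
  rw [← h1]
  simp_rw [← h2]
  exact h

/-! ### Continuity on `L_q` and multiplier operators -/

section MulOp

variable {d : ℕ} {q : ℝ≥0∞} [Fact (1 ≤ q)]

theorem integrable_Lp {E : Type*} [NormedAddCommGroup E] (f : Lp E q (torusMeasure d)) :
    Integrable f (torusMeasure d) :=
  (Lp.memLp f).integrable Fact.out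

theorem integral_norm_Lp_le {E : Type*} [NormedAddCommGroup E] (f : Lp E q (torusMeasure d)) :
    ∫ x, ‖f x‖ ∂torusMeasure d ≤ ‖f‖ := by
  rw [integral_norm_eq_lintegral_enorm (Lp.aestronglyMeasurable f), ← eLpNorm_one_eq_lintegral_enorm,
    Lp.norm_def]
  exact ENNReal.toReal_mono (Lp.eLpNorm_ne_top f)
    (eLpNorm_le_eLpNorm_of_exponent_le Fact.out (Lp.aestronglyMeasurable f))

/-- The Fourier coefficient as a continuous functional on `L_q`. -/
def coeffCLM (q : ℝ≥0∞) [Fact (1 ≤ q)] (z : Fin d → ℤ) : Lp ℂ q (torusMeasure d) →L[ℂ] ℂ :=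
  LinearMap.mkContinuous
    { toFun := fun f => UnitAddTorus.mFourierCoeff f z
      map_add' := fun f g => by
        rw [← mFourierCoeff_add (integrable_Lp f) (integrable_Lp g)]
        exact mFourierCoeff_congr_ae (Lp.coeFn_add f g) z
      map_smul' := fun a f => by
        rw [mFourierCoeff_congr_ae (Lp.coeFn_smul a f) z]
        simp only [UnitAddTorus.mFourierCoeff, Pi.smul_apply, smul_eq_mul, RingHom.id_apply]
        rw [← integral_const_mul]
        exact integral_congr_ae (.of_forall fun x => by ring) }
    1 (fun f => by
      rw [one_mul]
      refine (norm_integral_le_integral_norm _).trans (le_trans (le_of_eq ?_)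
        (integral_norm_Lp_le f))
      refine integral_congr_ae (.of_forall fun x => ?_)
      simp only [smul_eq_mul, norm_mul, norm_mFourier_apply, one_mul])

theorem coeffCLM_apply (z : Fin d → ℤ) (f : Lp ℂ q (torusMeasure d)) :
    coeffCLM q z f = UnitAddTorus.mFourierCoeff f z := rfl

theorem mFourierCoeff_mFourier (z w : Fin d → ℤ) :
    UnitAddTorus.mFourierCoeff (UnitAddTorus.mFourier w : UnitAddTorus (Fin d) → ℂ) z =
      if w = z then 1 else 0 := by
  have : ∀ x, UnitAddTorus.mFourier (-z) x • UnitAddTorus.mFourier w x =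
      UnitAddTorus.mFourier (-z + w) x := fun x => UnitAddTorus.mFourier_add.symm
  unfold UnitAddTorus.mFourierCoeff
  simp_rw [this]
  refine (integral_mFourier (-z + w)).trans (if_congr ?_ rfl rfl)
  rw [neg_add_eq_zero, eq_comm]

theorem coeffCLM_monoLp (z w : Fin d → ℤ) :
    coeffCLM q z (monoLp q w) = if w = z then 1 else 0 := by
  rw [coeffCLM_apply, ← mFourierCoeff_mFourier z w]
  exact mFourierCoeff_congr_ae (ContinuousMap.coeFn_toLp (torusMeasure d) _) z

theorem denseRange_linearCombination_monoLp (hq : q ≠ ∞) :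
    DenseRange (Finsupp.linearCombination ℂ (monoLp (d := d) q)) := by
  have h := UnitAddTorus.span_mFourierLp_closure_eq_top (d := Fin d) hq
  have h2 : Set.range (Finsupp.linearCombination ℂ (monoLp (d := d) q)) =
      (Submodule.span ℂ (Set.range (monoLp (d := d) q)) : Set (Lp ℂ q (torusMeasure d))) := by
    rw [← Finsupp.range_linearCombination]
    rfl
  rw [DenseRange, h2]
  exact Submodule.dense_iff_topologicalClosure_eq_top.mpr h

theorem IsMultiplier.norm_linearCombination_le {C : ℝ} {m : (Fin d → ℤ) → ℂ}
    (h : IsMultiplier q C m) (c : (Fin d → ℤ) →₀ ℂ) :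
    ‖Finsupp.linearCombination ℂ (fun z => m z • monoLp q z) c‖ ≤
      C * ‖Finsupp.linearCombination ℂ (monoLp q) c‖ := by
  have h1 := h c.support c
  rw [Finsupp.linearCombination_apply, Finsupp.linearCombination_apply, Finsupp.sum, Finsupp.sum]
  simp only [smul_smul]
  simpa only [mul_comm (m _)] using h1

/-- The bounded operator on `L_q` with symbol `m`. -/
def mulOp (q : ℝ≥0∞) [Fact (1 ≤ q)] (m : (Fin d → ℤ) → ℂ) :
    Lp ℂ q (torusMeasure d) →L[ℂ] Lp ℂ q (torusMeasure d) :=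
  (Finsupp.linearCombination ℂ (fun z => m z • monoLp q z)).extendOfNorm
    (Finsupp.linearCombination ℂ (monoLp q))

variable {C : ℝ} {m : (Fin d → ℤ) → ℂ}

theorem norm_mulOp_le (hq : q ≠ ∞) (h : IsMultiplier q C m) (f : Lp ℂ q (torusMeasure d)) :
    ‖mulOp q m f‖ ≤ C * ‖f‖ := by
  have h1 := denseRange_linearCombination_monoLp (d := d) hq
  have h2 := h.norm_linearCombination_le
  unfold mulOp
  generalize Finsupp.linearCombination ℂ (fun z => m z • monoLp q z) = A at *
  generalize Finsupp.linearCombination ℂ (monoLp (d := d) q) = B at *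
  exact LinearMap.norm_extendOfNorm_apply_le h1 C h2 f

theorem mulOp_linearCombination (hq : q ≠ ∞) (h : IsMultiplier q C m) (c : (Fin d → ℤ) →₀ ℂ) :
    mulOp q m (Finsupp.linearCombination ℂ (monoLp q) c) =
      Finsupp.linearCombination ℂ (fun z => m z • monoLp q z) c := by
  have h1 := denseRange_linearCombination_monoLp (d := d) hq
  have h2 := h.norm_linearCombination_le
  unfold mulOp
  generalize Finsupp.linearCombination ℂ (fun z => m z • monoLp q z) = A at *
  generalize Finsupp.linearCombination ℂ (monoLp (d := d) q) = B at *
  exact LinearMap.extendOfNorm_eq h1 ⟨C, h2⟩ c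

theorem coeffCLM_mulOp (hq : q ≠ ∞) (h : IsMultiplier q C m) (z : Fin d → ℤ)
    (f : Lp ℂ q (torusMeasure d)) : coeffCLM q z (mulOp q m f) = m z * coeffCLM q z f := by
  refine (denseRange_linearCombination_monoLp hq).induction_on f
    (isClosed_eq (by fun_prop) (by fun_prop)) fun c => ?_
  rw [mulOp_linearCombination hq h, Finsupp.linearCombination_apply,
    Finsupp.linearCombination_apply, Finsupp.sum, Finsupp.sum, map_sum, map_sum, Finset.mul_sum]
  refine Finset.sum_congr rfl fun w _ => ?_
  rw [map_smul, map_smul, map_smul, coeffCLM_monoLp]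
  simp only [smul_eq_mul]
  split_ifs with hw
  · subst hw; ring
  · ring

/-- Convergence of the cube partial sums of Fourier series in `L_p`. -/
theorem tendsto_cube {p : ℝ} [Fact (1 < p)] (hp : 2 ≤ p)
    (f : Lp ℂ (ENNReal.ofReal p) (torusMeasure d)) :
    Filter.Tendsto (fun N => mulOp (ENNReal.ofReal p) (cubeSymbol N) f) Filter.atTop (nhds f) := by
  have hq : ENNReal.ofReal p ≠ ∞ := ENNReal.ofReal_ne_top
  have hN (N : ℕ) := isMultiplier_cubeSymbol (d := d) hp N
  refine Metric.tendsto_atTop.mpr fun ε hε => ?_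
  have hK : 0 < cubeNorm d p + 1 := by linarith [cubeNorm_nonneg d p]
  obtain ⟨c, hc⟩ := (denseRange_linearCombination_monoLp (d := d) hq).exists_dist_lt f
    (div_pos hε hK)
  set g := Finsupp.linearCombination ℂ (monoLp (ENNReal.ofReal p)) c with hg
  obtain ⟨N₀, hN₀⟩ : ∃ N₀ : ℕ, ∀ z ∈ c.support, ∀ i, |z i| ≤ N₀ := by
    refine ⟨c.support.sup fun z => Finset.univ.sup fun i => (z i).natAbs, fun z hz i => ?_⟩
    have h1 : (z i).natAbs ≤ Finset.univ.sup fun i => (z i).natAbs :=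
      Finset.le_sup (f := fun i => (z i).natAbs) (Finset.mem_univ i)
    have h2 : (Finset.univ.sup fun i => (z i).natAbs) ≤
        c.support.sup fun z => Finset.univ.sup fun i => (z i).natAbs :=
      Finset.le_sup (f := fun z : Fin d → ℤ => Finset.univ.sup fun i => (z i).natAbs) hz
    rw [Int.abs_eq_natAbs]
    exact_mod_cast h1.trans h2
  refine ⟨N₀, fun N hNN => ?_⟩
  have hfix : mulOp (ENNReal.ofReal p) (cubeSymbol N) g = g := by
    rw [hg, mulOp_linearCombination hq (hN N), Finsupp.linearCombination_apply,
      Finsupp.linearCombination_apply]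
    refine Finset.sum_congr rfl fun z hz => ?_
    have : cubeSymbol N z = 1 := if_pos fun i => (hN₀ z hz i).trans (by exact_mod_cast hNN)
    simp only [this, one_smul]
  rw [dist_eq_norm] at hc ⊢
  have h1 : mulOp (ENNReal.ofReal p) (cubeSymbol N) f - f =
      mulOp (ENNReal.ofReal p) (cubeSymbol N) (f - g) - (f - g) := by
    rw [map_sub, hfix]; abel
  rw [h1]
  calc _ ≤ cubeNorm d p * ‖f - g‖ + ‖f - g‖ :=
        (norm_sub_le _ _).trans (add_le_add_left (norm_mulOp_le hq (hN N) _) _)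
    _ = (cubeNorm d p + 1) * ‖f - g‖ := by ring
    _ < (cubeNorm d p + 1) * (ε / (cubeNorm d p + 1)) := mul_lt_mul_of_pos_left hc hK
    _ = ε := by field_simp

end MulOp

/-! ### Real-valued functions -/

section Real

variable {d : ℕ} {q : ℝ≥0∞} [Fact (1 ≤ q)]

/-- The inclusion of real into complex `L_q`. -/
def complexify (q : ℝ≥0∞) [Fact (1 ≤ q)] :
    Lp ℝ q (torusMeasure d) →L[ℝ] Lp ℂ q (torusMeasure d) :=
  Complex.ofRealCLM.compLpL q (torusMeasure d)

theorem complexify_coeFn (f : Lp ℝ q (torusMeasure d)) :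
    complexify q f =ᵐ[torusMeasure d] fun x => (f x : ℂ) :=
  Complex.ofRealCLM.coeFn_compLp f

/-- The real part on `L_q`. -/
def realPart (q : ℝ≥0∞) [Fact (1 ≤ q)] :
    Lp ℂ q (torusMeasure d) →L[ℝ] Lp ℝ q (torusMeasure d) :=
  Complex.reCLM.compLpL q (torusMeasure d)

theorem realPart_coeFn (f : Lp ℂ q (torusMeasure d)) :
    realPart q f =ᵐ[torusMeasure d] fun x => (f x).re :=
  Complex.reCLM.coeFn_compLp f

theorem norm_realPart_le (f : Lp ℂ q (torusMeasure d)) : ‖realPart q f‖ ≤ ‖f‖ := by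
  refine Lp.norm_le_norm_of_ae_le ?_
  filter_upwards [realPart_coeFn f] with x hx
  rw [hx]
  exact Complex.abs_re_le_norm _

theorem norm_complexify (f : Lp ℝ q (torusMeasure d)) : ‖complexify q f‖ = ‖f‖ := by
  refine le_antisymm (Lp.norm_le_norm_of_ae_le ?_) (Lp.norm_le_norm_of_ae_le ?_) <;>
  · filter_upwards [complexify_coeFn f] with x hx
    rw [hx, Complex.norm_real]

theorem realPart_complexify (f : Lp ℝ q (torusMeasure d)) : realPart q (complexify q f) = f := by
  refine Lp.ext ?_
  filter_upwards [realPart_coeFn (complexify q f), complexify_coeFn f] with x h1 h2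
  rw [h1, h2, Complex.ofReal_re]

theorem complexify_realPart {f : Lp ℂ q (torusMeasure d)}
    (h : ∀ z, (starRingEnd ℂ) (coeffCLM q z f) = coeffCLM q (-z) f) :
    complexify q (realPart q f) = f := by
  refine Lp.ext ?_
  filter_upwards [realPart_coeFn f, complexify_coeFn (realPart q f),
    ae_real_of_hermitian (integrable_Lp f) h] with x h1 h2 h3
  rw [h2, h1, h3]

/-- The Fourier coefficients of a real function in `L_q`. -/
def rcoeff (z : Fin d → ℤ) (f : Lp ℝ q (torusMeasure d)) : ℂ := coeffCLM q z (complexify q f)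

theorem continuous_rcoeff (z : Fin d → ℤ) :
    Continuous (rcoeff z : Lp ℝ q (torusMeasure d) → ℂ) :=
  (coeffCLM q z).continuous.comp (complexify q).continuous

theorem rcoeff_eq (z : Fin d → ℤ) (f : Lp ℝ q (torusMeasure d)) :
    rcoeff z f = UnitAddTorus.mFourierCoeff (fun x => (f x : ℂ)) z :=
  mFourierCoeff_congr_ae (complexify_coeFn f) z

theorem conj_rcoeff (z : Fin d → ℤ) (f : Lp ℝ q (torusMeasure d)) :
    (starRingEnd ℂ) (rcoeff z f) = rcoeff (-z) f := by
  rw [rcoeff_eq, rcoeff_eq]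
  have := mFourierCoeff_conj (fun x => (f x : ℂ)) (-z)
  rw [neg_neg] at this
  rw [← this]
  simp only [Complex.conj_ofReal]

/-- The symbol is hermitian, so that the operator preserves real functions. -/
def IsHermitianSymbol (m : (Fin d → ℤ) → ℂ) : Prop := ∀ z, (starRingEnd ℂ) (m z) = m (-z)

/-- The operator with symbol `m` on real functions. -/
def realMulOp (q : ℝ≥0∞) [Fact (1 ≤ q)] (m : (Fin d → ℤ) → ℂ) :
    Lp ℝ q (torusMeasure d) →L[ℝ] Lp ℝ q (torusMeasure d) :=
  (realPart q).comp (((mulOp q m).restrictScalars ℝ).comp (complexify q))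

variable {C : ℝ} {m : (Fin d → ℤ) → ℂ}

theorem rcoeff_realMulOp (hq : q ≠ ∞) (h : IsMultiplier q C m) (hm : IsHermitianSymbol m)
    (z : Fin d → ℤ) (f : Lp ℝ q (torusMeasure d)) :
    rcoeff z (realMulOp q m f) = m z * rcoeff z f := by
  have h1 : complexify q (realMulOp q m f) = mulOp q m (complexify q f) := by
    refine complexify_realPart fun z => ?_
    have h2 (w : Fin d → ℤ) := coeffCLM_mulOp hq h w (complexify q f)
    have h3 := conj_rcoeff z f
    change (starRingEnd ℂ) (coeffCLM q z (mulOp q m (complexify q f))) =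
      coeffCLM q (-z) (mulOp q m (complexify q f))
    rw [h2, h2, map_mul, hm]
    congr 1
  rw [rcoeff, h1, coeffCLM_mulOp hq h]
  rfl

theorem norm_realMulOp_le (hq : q ≠ ∞) (h : IsMultiplier q C m) (f : Lp ℝ q (torusMeasure d)) :
    ‖realMulOp q m f‖ ≤ C * ‖f‖ := by
  refine (norm_realPart_le _).trans ?_
  rw [← norm_complexify f]
  exact norm_mulOp_le hq h _

theorem isHermitianSymbol_cubeSymbol (N : ℕ) : IsHermitianSymbol (cubeSymbol (d := d) N) :=
  fun z => by
    unfold cubeSymbol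
    simp only [Pi.neg_apply, abs_neg]
    split_ifs <;> simp

theorem tendsto_realCube {p : ℝ} [Fact (1 < p)] (hp : 2 ≤ p)
    (f : Lp ℝ (ENNReal.ofReal p) (torusMeasure d)) :
    Filter.Tendsto (fun N => realMulOp (ENNReal.ofReal p) (cubeSymbol N) f) Filter.atTop
      (nhds f) := by
  have h := ((realPart (d := d) (ENNReal.ofReal p)).continuous.tendsto _).comp
    (tendsto_cube hp (complexify _ f))
  rw [realPart_complexify] at h
  exact h

end Real

/-! ## Fields in `V_{q,α}` and their gradients -/

/-- A formal Fourier series is that of a real, divergence-free, mean-zero field. -/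
structure IsSolenoidal {d : ℕ} (c : FormalField d) : Prop where
  mean_zero : c 0 = 0
  real : ∀ z i, (starRingEnd ℂ) (c z i) = c (-z) i
  div_free : ∀ z, ∑ i, (z i : ℂ) * c z i = 0

theorem IsSolenoidal.sub {d : ℕ} {c c' : FormalField d} (h : IsSolenoidal c)
    (h' : IsSolenoidal c') : IsSolenoidal (c - c') where
  mean_zero := by rw [Pi.sub_apply, h.mean_zero, h'.mean_zero, sub_zero]
  real z i := by simp only [Pi.sub_apply, map_sub, h.real, h'.real]
  div_free z := by
    simp only [Pi.sub_apply, mul_sub, Finset.sum_sub_distrib, h.div_free, h'.div_free, sub_zero]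

theorem re_sum_mFourier {d : ℕ} {S : Finset (Fin d → ℤ)} (hS : ∀ z ∈ S, -z ∈ S)
    {c : (Fin d → ℤ) → ℂ} (hc : IsHermitianSymbol c) (x : UnitAddTorus (Fin d)) :
    (((∑ z ∈ S, c z * UnitAddTorus.mFourier z x).re : ℝ) : ℂ) =
      ∑ z ∈ S, c z * UnitAddTorus.mFourier z x := by
  rw [← Complex.conj_eq_iff_re, map_sum]
  refine Finset.sum_nbij' (fun z => -z) (fun z => -z) hS hS (fun _ _ => neg_neg _)
    (fun _ _ => neg_neg _) fun z _ => ?_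
  rw [map_mul, hc, UnitAddTorus.mFourier_neg]

section Coeff

variable {d : ℕ}

theorem mFourierCoeff_sum (S : Finset (Fin d → ℤ)) (c : (Fin d → ℤ) → ℂ) (z : Fin d → ℤ) :
    UnitAddTorus.mFourierCoeff (fun x => ∑ w ∈ S, c w * UnitAddTorus.mFourier w x) z =
      if z ∈ S then c z else 0 := by
  unfold UnitAddTorus.mFourierCoeff
  simp only [Finset.smul_sum]
  have hi (w : Fin d → ℤ) : Integrable (fun x => UnitAddTorus.mFourier (-z) x •
      (c w * UnitAddTorus.mFourier w x)) (torusMeasure d) :=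
    (by fun_prop : Continuous fun x => UnitAddTorus.mFourier (-z) x •
      (c w * UnitAddTorus.mFourier w x)).integrable_of_hasCompactSupport
      (HasCompactSupport.of_compactSpace _)
  refine (integral_finsetSum S fun w _ => hi w).trans ?_
  have h (w : Fin d → ℤ) : ∫ x, UnitAddTorus.mFourier (-z) x •
      (c w * UnitAddTorus.mFourier w x) ∂torusMeasure d = if w = z then c w else 0 := by
    have h1 := mFourierCoeff_mFourier z w
    unfold UnitAddTorus.mFourierCoeff at h1
    calc _ = ∫ x, c w * (UnitAddTorus.mFourier (-z) x • UnitAddTorus.mFourier w x)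
          ∂torusMeasure d :=
          integral_congr_ae (.of_forall fun x => by simp only [smul_eq_mul]; ring)
      _ = c w * (if w = z then 1 else 0) := by rw [integral_const_mul]; exact congrArg _ h1
      _ = _ := by rw [mul_ite, mul_one, mul_zero]
  rw [Finset.sum_congr rfl fun w _ => h w, Finset.sum_ite_eq']

theorem TestField.neg_mem_support (φ : TestField d) {z : Fin d → ℤ} (hz : z ∈ φ.coeff.support) :
    -z ∈ φ.coeff.support := by
  rw [Finsupp.mem_support_iff] at hz ⊢
  contrapose! hz
  funext i
  have := φ.real z i
  rw [hz, Pi.zero_apply, map_eq_zero] at this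
  exact this

theorem TestField.field_apply (φ : TestField d) (i : Fin d) (x : UnitAddTorus (Fin d)) :
    ((φ.field x i : ℝ) : ℂ) = ∑ z ∈ φ.coeff.support, φ.coeff z i * UnitAddTorus.mFourier z x :=
  re_sum_mFourier (fun _ => φ.neg_mem_support) (fun z => φ.real z i) x

theorem TestField.partialDeriv_apply (φ : TestField d) (j i : Fin d)
    (x : UnitAddTorus (Fin d)) : (φ.partialDeriv j i x : ℂ) = ∑ z ∈ φ.coeff.support,
      2 * Real.pi * Complex.I * (z j : ℂ) * φ.coeff z i * UnitAddTorus.mFourier z x := by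
  refine re_sum_mFourier (c := fun z => 2 * Real.pi * Complex.I * (z j : ℂ) * φ.coeff z i)
    (fun _ => φ.neg_mem_support) (fun z => ?_) x
  simp only [map_mul, Complex.conj_I, Complex.conj_ofReal, map_intCast, map_ofNat, φ.real,
    Pi.neg_apply, Int.cast_neg]
  ring

theorem TestField.mFourierCoeff_field (φ : TestField d) (i : Fin d) (z : Fin d → ℤ) :
    UnitAddTorus.mFourierCoeff (fun x => ((φ.field x i : ℝ) : ℂ)) z = φ.coeff z i := by
  simp only [φ.field_apply i]
  rw [mFourierCoeff_sum _ (fun z => φ.coeff z i)]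
  split_ifs with h
  · rfl
  · rw [Finsupp.notMem_support_iff.mp h, Pi.zero_apply]

theorem TestField.mFourierCoeff_partialDeriv (φ : TestField d) (j i : Fin d) (z : Fin d → ℤ) :
    UnitAddTorus.mFourierCoeff (fun x => (φ.partialDeriv j i x : ℂ)) z =
      2 * Real.pi * Complex.I * (z j : ℂ) * φ.coeff z i := by
  simp only [φ.partialDeriv_apply j i]
  rw [mFourierCoeff_sum _ (fun z => 2 * Real.pi * Complex.I * (z j : ℂ) * φ.coeff z i)]
  split_ifs with h
  · rfl
  · rw [Finsupp.notMem_support_iff.mp h, Pi.zero_apply, mul_zero]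

theorem TestField.continuous_partialDeriv (φ : TestField d) (j i : Fin d) :
    Continuous (φ.partialDeriv j i) := by
  unfold TestField.partialDeriv
  fun_prop

end Coeff

section VCoeff

variable {d : ℕ} {q : ℝ≥0∞} [Fact (1 ≤ q)]

/-- The components of an `L_q` vector field. -/
def coordLp (q : ℝ≥0∞) [Fact (1 ≤ q)] (i : Fin d) :
    Lp (Vec d) q (torusMeasure d) →L[ℝ] Lp ℝ q (torusMeasure d) :=
  (EuclideanSpace.proj (𝕜 := ℝ) i).compLpL q (torusMeasure d)

theorem coordLp_coeFn (i : Fin d) (f : Lp (Vec d) q (torusMeasure d)) :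
    coordLp q i f =ᵐ[torusMeasure d] fun x => f x i :=
  (EuclideanSpace.proj (𝕜 := ℝ) i).coeFn_compLp f

theorem norm_coordLp_le (i : Fin d) (f : Lp (Vec d) q (torusMeasure d)) :
    ‖coordLp q i f‖ ≤ ‖f‖ := by
  refine Lp.norm_le_norm_of_ae_le ?_
  filter_upwards [coordLp_coeFn i f] with x hx
  rw [hx]
  exact PiLp.norm_apply_le (f x) i

theorem fieldCoeff_eq (f : Lp (Vec d) q (torusMeasure d)) (z : Fin d → ℤ) (i : Fin d) :
    fieldCoeff f z i = rcoeff z (coordLp q i f) := by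
  rw [rcoeff_eq]
  refine mFourierCoeff_congr_ae ?_ z
  filter_upwards [coordLp_coeFn i f] with x hx
  rw [hx]

theorem isSolenoidal_fieldCoeff (u : solenoidal d q) :
    IsSolenoidal (fieldCoeff (u : Lp (Vec d) q (torusMeasure d))) := by
  have hc (z : Fin d → ℤ) (i : Fin d) : Continuous fun f : Lp (Vec d) q (torusMeasure d) =>
      rcoeff z (coordLp q i f) := (continuous_rcoeff z).comp (coordLp q i).continuous
  have hadd (z : Fin d → ℤ) (i : Fin d) (f g : Lp (Vec d) q (torusMeasure d)) :
      rcoeff z (coordLp q i (f + g)) = rcoeff z (coordLp q i f) + rcoeff z (coordLp q i g) := by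
    simp only [rcoeff, map_add]
  have hsmul (z : Fin d → ℤ) (i : Fin d) (a : ℝ) (f : Lp (Vec d) q (torusMeasure d)) :
      rcoeff z (coordLp q i (a • f)) = a * rcoeff z (coordLp q i f) := by
    have h1 (g : Lp ℂ q (torusMeasure d)) : coeffCLM q z (a • g) = a * coeffCLM q z g :=
      ((coeffCLM q z).restrictScalars ℝ).map_smul a g
    simp only [rcoeff, map_smul, h1]
  let W : Submodule ℝ (Lp (Vec d) q (torusMeasure d)) :=
    { carrier := {f | (∀ i, rcoeff 0 (coordLp q i f) = 0) ∧
        ∀ z, ∑ i, (z i : ℂ) * rcoeff z (coordLp q i f) = 0}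
      add_mem' := fun {f g} hf hg => by
        refine ⟨fun i => by rw [hadd, hf.1, hg.1, add_zero], fun z => ?_⟩
        simp only [hadd, mul_add, Finset.sum_add_distrib, hf.2, hg.2, add_zero]
      zero_mem' := by simp [rcoeff]
      smul_mem' := fun a f hf => by
        refine ⟨fun i => by rw [hsmul, hf.1, mul_zero], fun z => ?_⟩
        simp only [hsmul, mul_left_comm _ (a : ℂ), ← Finset.mul_sum, hf.2, mul_zero] }
  have hW : IsClosed (W : Set (Lp (Vec d) q (torusMeasure d))) := by
    have : (W : Set (Lp (Vec d) q (torusMeasure d))) =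
        (⋂ i, {f | rcoeff 0 (coordLp q i f) = 0}) ∩
        ⋂ z : Fin d → ℤ, {f | ∑ i, (z i : ℂ) * rcoeff z (coordLp q i f) = 0} := by
      ext f
      simp only [Set.mem_inter_iff, Set.mem_iInter]
      exact Iff.rfl
    rw [this]
    refine IsClosed.inter (isClosed_iInter fun i => isClosed_eq (hc 0 i) continuous_const)
      (isClosed_iInter fun z => isClosed_eq ?_ continuous_const)
    exact continuous_finsetSum _ fun i _ => continuous_const.mul (hc z i)
  have hle : solenoidal d q ≤ W := by
    refine Submodule.topologicalClosure_minimal _ (Submodule.span_le.mpr ?_) hW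
    rintro _ ⟨φ, rfl⟩
    have h (z : Fin d → ℤ) (i : Fin d) : rcoeff z (coordLp q i
        (ContinuousMap.toLp q (torusMeasure d) ℝ φ.field)) = φ.coeff z i := by
      rw [← fieldCoeff_eq, ← φ.mFourierCoeff_field i z]
      refine mFourierCoeff_congr_ae ?_ z
      filter_upwards [ContinuousMap.coeFn_toLp (p := q) (𝕜 := ℝ) (torusMeasure d) φ.field] with x hx
      rw [hx]
    exact ⟨fun i => by rw [h, φ.mean_zero, Pi.zero_apply],
      fun z => by simp only [h]; exact φ.div_free z⟩
  have hu := hle u.2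
  refine ⟨?_, fun z i => ?_, fun z => ?_⟩
  · funext i
    rw [fieldCoeff_eq]
    exact hu.1 i
  · rw [fieldCoeff_eq, fieldCoeff_eq, conj_rcoeff]
  · simp only [fieldCoeff_eq]
    exact hu.2 z

theorem isSolenoidal_coeff (α : ℝ) (u : V d q α) : IsSolenoidal (V.coeff α u) := by
  have h := isSolenoidal_fieldCoeff u
  refine ⟨?_, fun z i => ?_, fun z => ?_⟩
  · funext i
    have : fieldCoeff (u : Lp (Vec d) q (torusMeasure d)) 0 i = 0 := by rw [h.mean_zero]; rfl
    simp only [V.coeff, this, mul_zero, Pi.zero_apply]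
  · simp only [V.coeff, map_mul, Complex.conj_ofReal, h.real, Pi.neg_apply, Int.cast_neg, neg_sq]
  · unfold V.coeff
    generalize (((1 + 4 * Real.pi ^ 2 * ∑ k, (z k : ℝ) ^ 2) ^ (-α / 2) : ℝ) : ℂ) = K
    simp only [mul_left_comm _ K, ← Finset.mul_sum, h.div_free, mul_zero]

theorem coeff_sub (α : ℝ) (u u' : V d q α) :
    V.coeff α (u - u') = V.coeff α u - V.coeff α u' := by
  funext z i
  simp only [V.coeff, fieldCoeff_eq, Pi.sub_apply, ← mul_sub]
  congr 1
  simp only [rcoeff, Submodule.coe_sub, map_sub]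

theorem coeff_zero (u : V d q 0) : V.coeff 0 u = fieldCoeff (u : Lp (Vec d) q (torusMeasure d)) := by
  funext z i
  simp [V.coeff]

theorem coeff_one (u : V d q 1) (z : Fin d → ℤ) (i : Fin d) :
    V.coeff 1 u z i = ((‖freqVec z‖⁻¹ : ℝ) : ℂ) *
      rcoeff z (coordLp q i (u : Lp (Vec d) q (torusMeasure d))) := by
  rw [V.coeff, fieldCoeff_eq]
  congr 2
  rw [← norm_freqVec_sq, ← Real.rpow_natCast, ← Real.rpow_mul (norm_nonneg _)]
  norm_num
  exact Real.rpow_neg_one _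

end VCoeff

section Val

variable {d : ℕ} {p : ℝ} [Fact (1 < p)]

/-- The symbol of `(1 - Δ)^{-1/2}`. -/
def besselSymbol (z : Fin d → ℤ) : ℂ := ((freqVec z 0 / ‖freqVec z‖ : ℝ) : ℂ)

/-- The symbol of `∂_j (1 - Δ)^{-1/2}`. -/
def gradSymbol (j : Fin d) (z : Fin d → ℤ) : ℂ :=
  Complex.I * ((freqVec z j.succ / ‖freqVec z‖ : ℝ) : ℂ)

theorem besselSymbol_eq (z : Fin d → ℤ) : besselSymbol z = ((‖freqVec z‖⁻¹ : ℝ) : ℂ) := by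
  simp [besselSymbol, freqVec]

theorem gradSymbol_eq (j : Fin d) (z : Fin d → ℤ) :
    gradSymbol j z = 2 * Real.pi * Complex.I * (z j : ℂ) * ((‖freqVec z‖⁻¹ : ℝ) : ℂ) := by
  have : freqVec z j.succ = 2 * Real.pi * z j := rfl
  rw [gradSymbol, this, div_eq_mul_inv]
  push_cast
  ring

theorem norm_freqVec_neg (z : Fin d → ℤ) : ‖freqVec (-z)‖ = ‖freqVec z‖ := by
  rw [← sq_eq_sq₀ (norm_nonneg _) (norm_nonneg _), norm_freqVec_sq, norm_freqVec_sq]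
  simp

theorem isHermitianSymbol_bessel : IsHermitianSymbol (besselSymbol (d := d)) := fun z => by
  rw [besselSymbol_eq, besselSymbol_eq, norm_freqVec_neg, Complex.conj_ofReal]

theorem isHermitianSymbol_grad (j : Fin d) : IsHermitianSymbol (gradSymbol (d := d) j) := fun z => by
  rw [gradSymbol_eq, gradSymbol_eq, norm_freqVec_neg]
  simp only [map_mul, Complex.conj_I, Complex.conj_ofReal, map_intCast, map_ofNat, Pi.neg_apply,
    Int.cast_neg]
  ring

theorem isMultiplier_bessel (hp : 2 ≤ p) :
    IsMultiplier (ENNReal.ofReal p) (besselNorm d p) (besselSymbol (d := d)) :=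
  isMultiplier_freqVec hp 0

theorem isMultiplier_grad (hp : 2 ≤ p) (j : Fin d) :
    IsMultiplier (ENNReal.ofReal p) (besselNorm d p) (gradSymbol (d := d) j) := by
  have := (IsMultiplier.const (d := d) (q := ENNReal.ofReal p) Complex.I).mul (norm_nonneg _)
    (isMultiplier_freqVec hp j.succ)
  rwa [Complex.norm_I, one_mul] at this

/-- The component `v_i` of a field in `V_{p,1}` as an element of `L_p`. -/
def V.val (i : Fin d) : V d (ENNReal.ofReal p) 1 →L[ℝ] Lp ℝ (ENNReal.ofReal p) (torusMeasure d) :=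
  ((realMulOp (ENNReal.ofReal p) besselSymbol).comp (coordLp (ENNReal.ofReal p) i)).comp
    (solenoidal d (ENNReal.ofReal p)).subtypeL

/-- The derivative `∂_j v_i` of a field in `V_{p,1}` as an element of `L_p`. -/
def V.grad (j i : Fin d) :
    V d (ENNReal.ofReal p) 1 →L[ℝ] Lp ℝ (ENNReal.ofReal p) (torusMeasure d) :=
  ((realMulOp (ENNReal.ofReal p) (gradSymbol j)).comp (coordLp (ENNReal.ofReal p) i)).comp
    (solenoidal d (ENNReal.ofReal p)).subtypeL

theorem rcoeff_val (hp : 2 ≤ p) (i : Fin d) (u : V d (ENNReal.ofReal p) 1) (z : Fin d → ℤ) :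
    rcoeff z (V.val i u) = V.coeff 1 u z i := by
  have := rcoeff_realMulOp ENNReal.ofReal_ne_top (isMultiplier_bessel (d := d) hp)
    isHermitianSymbol_bessel z (coordLp (ENNReal.ofReal p) i u.1)
  rw [besselSymbol_eq, ← coeff_one] at this
  exact this

theorem rcoeff_grad (hp : 2 ≤ p) (j i : Fin d) (u : V d (ENNReal.ofReal p) 1) (z : Fin d → ℤ) :
    rcoeff z (V.grad j i u) = 2 * Real.pi * Complex.I * (z j : ℂ) * V.coeff 1 u z i := by
  have := rcoeff_realMulOp ENNReal.ofReal_ne_top (isMultiplier_grad (d := d) hp j)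
    (isHermitianSymbol_grad j) z (coordLp (ENNReal.ofReal p) i u.1)
  rw [gradSymbol_eq, mul_assoc, ← coeff_one] at this
  exact this

theorem norm_grad_le (hp : 2 ≤ p) (j i : Fin d) (u : V d (ENNReal.ofReal p) 1) :
    ‖V.grad j i u‖ ≤ besselNorm d p * ‖u‖ :=
  (norm_realMulOp_le ENNReal.ofReal_ne_top (isMultiplier_grad (d := d) hp j) _).trans
    (mul_le_mul_of_nonneg_left (norm_coordLp_le i _) (besselNorm_nonneg d p))

theorem component_ae_eq (hp : 2 ≤ p) (i : Fin d) (u : V d (ENNReal.ofReal p) 1) :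
    component (V.coeff 1 u) i =ᵐ[torusMeasure d] V.val i u :=
  ofCoeff_ae_eq (integrable_Lp _) fun z => by rw [← rcoeff_eq, rcoeff_val hp]

/-- The strain tensor of a field in `V_{p,1}` as an element of `L_p`. -/
def V.strainLp (i j : Fin d) :
    V d (ENNReal.ofReal p) 1 →L[ℝ] Lp ℝ (ENNReal.ofReal p) (torusMeasure d) :=
  (2⁻¹ : ℝ) • (V.grad i j + V.grad j i)

theorem strainLp_coeFn (i j : Fin d) (u : V d (ENNReal.ofReal p) 1) :
    V.strainLp i j u =ᵐ[torusMeasure d] fun x => (V.grad i j u x + V.grad j i u x) / 2 := by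
  filter_upwards [Lp.coeFn_smul (2⁻¹ : ℝ) (V.grad i j u + V.grad j i u),
    Lp.coeFn_add (V.grad i j u) (V.grad j i u)] with x h1 h2
  change ((2⁻¹ : ℝ) • (V.grad i j u + V.grad j i u)) x = _
  rw [h1, Pi.smul_apply, h2, Pi.add_apply, smul_eq_mul]
  ring

theorem rcoeff_strainLp (hp : 2 ≤ p) (i j : Fin d) (u : V d (ENNReal.ofReal p) 1)
    (z : Fin d → ℤ) : rcoeff z (V.strainLp i j u) =
      Real.pi * Complex.I * ((z i : ℂ) * V.coeff 1 u z j + (z j : ℂ) * V.coeff 1 u z i) := by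
  have h1 : rcoeff z (V.strainLp i j u) =
      (2⁻¹ : ℝ) * (rcoeff z (V.grad i j u) + rcoeff z (V.grad j i u)) := by
    have h1 (g : Lp ℂ (ENNReal.ofReal p) (torusMeasure d)) :
        coeffCLM (ENNReal.ofReal p) z ((2⁻¹ : ℝ) • g) = (2⁻¹ : ℝ) * coeffCLM _ z g :=
      ((coeffCLM (ENNReal.ofReal p) z).restrictScalars ℝ).map_smul (2⁻¹ : ℝ) g
    simp only [rcoeff, V.strainLp, smul_apply, add_apply, map_smul, map_add, h1]
  rw [h1, rcoeff_grad hp, rcoeff_grad hp]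
  push_cast
  ring

theorem strain_ae_eq (hp : 2 ≤ p) (i j : Fin d) (u : V d (ENNReal.ofReal p) 1) :
    strain (V.coeff 1 u) i j =ᵐ[torusMeasure d] V.strainLp i j u := by
  refine ofCoeff_ae_eq (integrable_Lp _) fun z => ?_
  rw [← rcoeff_eq, rcoeff_strainLp hp]
  ring

end Val

/-! ### Truncation of fields -/

section Trunc

variable {d : ℕ}

/-- The lattice points in a cube. -/
def cube (d N : ℕ) : Finset (Fin d → ℤ) := Fintype.piFinset fun _ => Finset.Icc (-N : ℤ) N

theorem mem_cube {N : ℕ} {z : Fin d → ℤ} : z ∈ cube d N ↔ ∀ i, |z i| ≤ N := by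
  simp [cube, Fintype.mem_piFinset, abs_le]

/-- The projection of a field to the frequencies in a cube. -/
def IsSolenoidal.trunc {c : FormalField d} (h : IsSolenoidal c) (N : ℕ) : TestField d where
  coeff := Finsupp.onFinset (cube d N) (fun z => if z ∈ cube d N then c z else 0)
    fun z hz => by by_contra h'; exact hz (if_neg h')
  mean_zero := by simp [h.mean_zero]
  real z i := by
    have : -z ∈ cube d N ↔ z ∈ cube d N := by simp [mem_cube]
    simp only [Finsupp.onFinset_apply, this]
    split_ifs
    · exact h.real z i
    · simp
  div_free z := by
    simp only [Finsupp.onFinset_apply]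
    split_ifs
    · exact h.div_free z
    · simp

theorem IsSolenoidal.trunc_coeff {c : FormalField d} (h : IsSolenoidal c) (N : ℕ)
    (z : Fin d → ℤ) (i : Fin d) : (h.trunc N).coeff z i = cubeSymbol N z * c z i := by
  simp only [IsSolenoidal.trunc, Finsupp.onFinset_apply, cubeSymbol, mem_cube]
  split_ifs <;> simp

variable {p : ℝ} [Fact (1 < p)]

theorem trunc_partialDeriv_ae_eq (hp : 2 ≤ p) (u : V d (ENNReal.ofReal p) 1) (N : ℕ)
    (j i : Fin d) :
    ((isSolenoidal_coeff 1 u).trunc N).partialDeriv j i =ᵐ[torusMeasure d]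
      realMulOp (ENNReal.ofReal p) (cubeSymbol N) (V.grad j i u) := by
  have hc := ((isSolenoidal_coeff 1 u).trunc N).continuous_partialDeriv j i
  have h1 := ae_eq_of_mFourierCoeff (d := d)
    (f := fun x => (((isSolenoidal_coeff 1 u).trunc N).partialDeriv j i x : ℂ))
    (g := fun x => (realMulOp (ENNReal.ofReal p) (cubeSymbol N) (V.grad j i u) x : ℂ))
    ((Complex.continuous_ofReal.comp hc).integrable_of_hasCompactSupport
      (HasCompactSupport.of_compactSpace _)) (integrable_Lp _).ofReal fun z => by
    rw [TestField.mFourierCoeff_partialDeriv, ← rcoeff_eq, rcoeff_realMulOp ENNReal.ofReal_ne_top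
      (isMultiplier_cubeSymbol hp N) (isHermitianSymbol_cubeSymbol N), rcoeff_grad hp,
      IsSolenoidal.trunc_coeff]
    ring
  filter_upwards [h1] with x hx
  exact Complex.ofReal_injective hx

end Trunc

/-! ## The Gagliardo–Nirenberg inequality -/

section GagliardoNirenberg

variable {d : ℕ}

/-- The square of the Euclidean length of a frequency. -/
def freqSq (z : Fin d → ℤ) : ℝ := ∑ k, (z k : ℝ) ^ 2

theorem freqSq_nonneg (z : Fin d → ℤ) : 0 ≤ freqSq z :=
  Finset.sum_nonneg fun _ _ => sq_nonneg _

theorem one_le_freqSq {z : Fin d → ℤ} (hz : z ≠ 0) : 1 ≤ freqSq z := by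
  obtain ⟨i, hi⟩ := Function.ne_iff.mp hz
  have h1 : (1 : ℝ) ≤ (z i : ℝ) ^ 2 := by
    have : (1 : ℤ) ≤ z i ^ 2 := by
      have : 0 < z i ^ 2 := sq_pos_of_ne_zero hi
      omega
    exact_mod_cast this
  exact h1.trans (Finset.single_le_sum (f := fun k => (z k : ℝ) ^ 2)
    (fun _ _ => sq_nonneg _) (Finset.mem_univ i))

theorem sq_le_freqSq {n : ℕ} {z : Fin d → ℤ} (hz : z ∉ cube d n) : ((n : ℝ) + 1) ^ 2 ≤ freqSq z := by
  rw [mem_cube] at hz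
  push Not at hz
  obtain ⟨i, hi⟩ := hz
  have h1 : ((n : ℝ) + 1) ^ 2 ≤ (z i : ℝ) ^ 2 := by
    rw [← sq_abs (z i : ℝ)]
    have : (n : ℝ) + 1 ≤ |(z i : ℝ)| := by exact_mod_cast hi
    gcongr
  exact h1.trans (Finset.single_le_sum (f := fun k => (z k : ℝ) ^ 2)
    (fun _ _ => sq_nonneg _) (Finset.mem_univ i))

theorem card_cube (d n : ℕ) : (cube d n).card = (2 * n + 1) ^ d := by
  rw [cube, Fintype.card_piFinset]
  simp only [Int.card_Icc, Finset.prod_const, Finset.card_univ, Fintype.card_fin]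
  congr 1
  omega

theorem sum_norm_coeff_cube_le {f : UnitAddTorus (Fin d) → ℝ} (hf : MemLp f 2 (torusMeasure d))
    (h0 : UnitAddTorus.mFourierCoeff (fun x => (f x : ℂ)) 0 = 0) (n : ℕ) :
    ∑ z ∈ cube d n, ‖UnitAddTorus.mFourierCoeff (fun x => (f x : ℂ)) z‖ ≤
      √((3 * n) ^ d) * √(∫ x, f x ^ 2 ∂torusMeasure d) := by
  set c := UnitAddTorus.mFourierCoeff fun x => (f x : ℂ) with hc
  rcases Nat.eq_zero_or_pos n with rfl | hn
  · have : cube d 0 = {0} := by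
      ext z
      simp [mem_cube, funext_iff]
    rw [this, Finset.sum_singleton, h0, norm_zero]
    positivity
  · have h1 := hasSum_sq_coeff hf
    have h2 : ∑ z ∈ cube d n, ‖c z‖ ^ 2 ≤ ∫ x, f x ^ 2 ∂torusMeasure d :=
      sum_le_hasSum _ (fun _ _ => sq_nonneg _) h1
    have h3 := sq_sum_le_card_mul_sum_sq (s := cube d n) (f := fun z => ‖c z‖)
    have h4 : ((cube d n).card : ℝ) ≤ (3 * n) ^ d := by
      rw [card_cube]
      push_cast
      have : (1 : ℝ) ≤ n := by exact_mod_cast hn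
      gcongr
      linarith
    rw [← Real.sqrt_mul (by positivity)]
    refine Real.le_sqrt_of_sq_le (h3.trans ?_)
    exact mul_le_mul h4 h2 (Finset.sum_nonneg fun _ _ => sq_nonneg _) (by positivity)

theorem hasSum_sq_coeff_high {f : UnitAddTorus (Fin d) → ℝ} (hf : MemLp f 2 (torusMeasure d))
    (n : ℕ) : ∃ g : UnitAddTorus (Fin d) → ℝ, MemLp g 2 (torusMeasure d) ∧
      (∀ x, |f x - g x| ≤
        ∑ z ∈ cube d n, ‖UnitAddTorus.mFourierCoeff (fun x => (f x : ℂ)) z‖) ∧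
      HasSum (fun z => if z ∈ cube d n then 0 else
        ‖UnitAddTorus.mFourierCoeff (fun x => (f x : ℂ)) z‖ ^ 2) (∫ x, g x ^ 2 ∂torusMeasure d) := by
  set c := UnitAddTorus.mFourierCoeff fun x => (f x : ℂ) with hc
  have hherm : IsHermitianSymbol c := fun z => by
    have := mFourierCoeff_conj (fun x => (f x : ℂ)) (-z)
    rw [neg_neg] at this
    rw [hc, ← this]
    simp only [Complex.conj_ofReal]
  have hneg : ∀ z ∈ cube d n, -z ∈ cube d n := fun z hz => by
    rw [mem_cube] at hz ⊢
    simpa using hz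
  let l : UnitAddTorus (Fin d) → ℝ := fun x => (∑ z ∈ cube d n, c z * UnitAddTorus.mFourier z x).re
  have hl (x) : ((l x : ℝ) : ℂ) = ∑ z ∈ cube d n, c z * UnitAddTorus.mFourier z x :=
    re_sum_mFourier hneg hherm x
  have hlc : Continuous l := by fun_prop
  have hlm : MemLp l 2 (torusMeasure d) := hlc.memLp_of_hasCompactSupport
    (HasCompactSupport.of_compactSpace _)
  have hg : MemLp (fun x => f x - l x) 2 (torusMeasure d) := hf.sub hlm
  refine ⟨_, hg, fun x => ?_, ?_⟩
  · rw [sub_sub_cancel, ← Real.norm_eq_abs, ← Complex.norm_real, hl]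
    refine (norm_sum_le _ _).trans_eq (Finset.sum_congr rfl fun z _ => ?_)
    rw [norm_mul, norm_mFourier_apply, mul_one]
  · have h1 := hasSum_sq_coeff hg
    refine h1.congr_fun ?_
    intro z
    have h2 : UnitAddTorus.mFourierCoeff (fun x => ((f x - l x : ℝ) : ℂ)) z =
        c z - if z ∈ cube d n then c z else 0 := by
      have h3 := mFourierCoeff_sub (hf.integrable one_le_two).ofReal
        (hlm.integrable one_le_two).ofReal z
      rw [← mFourierCoeff_sum (cube d n) c z]
      simp only [← hl]
      rw [hc]
      refine Eq.trans ?_ h3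
      simp only [Complex.ofReal_sub]
      rfl
    rw [h2]
    split_ifs <;> simp

theorem lintegral_rpow_Ioo {s h : ℝ} (hs : 2 < s) (hh : 0 ≤ h) (a : ℝ) (ha : 0 ≤ a) :
    ∫⁻ t in Set.Ioi (0 : ℝ), (if t < h then ENNReal.ofReal (4 / t ^ 2 * a) else 0) *
      ENNReal.ofReal (t ^ (s - 1)) = ENNReal.ofReal (4 * a * (h ^ (s - 2) / (s - 2))) := by
  have h1 : ∫⁻ t in Set.Ioi (0 : ℝ), (if t < h then ENNReal.ofReal (4 / t ^ 2 * a) else 0) *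
      ENNReal.ofReal (t ^ (s - 1)) =
      ∫⁻ t in Set.Ioi (0 : ℝ), (Set.Iio h).indicator
        (fun t => ENNReal.ofReal (4 * a * t ^ (s - 3))) t := by
    refine setLIntegral_congr_fun measurableSet_Ioi fun t (ht : 0 < t) => ?_
    by_cases hth : t < h
    · rw [Set.indicator_of_mem (show t ∈ Set.Iio h from hth)]
      simp only [hth, if_true]
      rw [← ENNReal.ofReal_mul (by positivity)]
      congr 1
      have : t ^ (s - 1) = t ^ (s - 3) * t ^ 2 := by
        rw [← Real.rpow_natCast t 2, ← Real.rpow_add ht]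
        congr 1
        push_cast
        ring
      rw [this]
      field_simp
    · rw [Set.indicator_of_notMem (show t ∉ Set.Iio h from hth)]
      simp [hth]
  rw [h1, setLIntegral_indicator measurableSet_Iio]
  have hI : Set.Iio h ∩ Set.Ioi 0 = Set.Ioo 0 h := by ext; simp [and_comm]
  rw [hI, restrict_Ioo_eq_restrict_Ioc]
  have hint := intervalIntegral.intervalIntegrable_rpow' (a := 0) (b := h)
    (show -1 < s - 3 by linarith)
  have hio : IntegrableOn (fun t => 4 * a * t ^ (s - 3)) (Set.Ioc 0 h) :=
    ((intervalIntegrable_iff_integrableOn_Ioc_of_le hh).mp hint).const_mul _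
  rw [← ofReal_integral_eq_lintegral_ofReal hio]
  · congr 1
    rw [integral_const_mul, ← intervalIntegral.integral_of_le hh,
      integral_rpow (Or.inl (by linarith))]
    rw [Real.zero_rpow (by linarith), sub_zero, show s - 3 + 1 = s - 2 by ring]
  · refine ae_restrict_of_forall_mem measurableSet_Ioc fun t ht => ?_
    have := ht.1.le
    positivity

/-- The constant of the Gagliardo–Nirenberg inequality. -/
def gnConst (s : ℝ) : ℝ := 36 * s * 2 ^ (s - 2) / (s - 2)

theorem measure_lt_le (hd : 0 < d) {f : UnitAddTorus (Fin d) → ℝ}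
    (hf : MemLp f 2 (torusMeasure d))
    (h0 : UnitAddTorus.mFourierCoeff (fun x => (f x : ℂ)) 0 = 0) {A : ℝ}
    (hA : A = √(∫ x, f x ^ 2 ∂torusMeasure d)) (hA0 : 0 < A) {t : ℝ} (ht : 0 < t) :
    torusMeasure d {x | t < |f x|} ≤ ∑' z,
      if t < 2 * A * (9 * freqSq z) ^ ((d : ℝ) / 4) then
        ENNReal.ofReal (4 / t ^ 2 * ‖UnitAddTorus.mFourierCoeff (fun x => (f x : ℂ)) z‖ ^ 2)
      else 0 := by
  have hd' : (0 : ℝ) < d := by exact_mod_cast hd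
  set ρ : ℝ := (t / (2 * A)) ^ (2 / (d : ℝ)) / 3 with hρ
  have hρ0 : 0 ≤ ρ := by positivity
  set n := ⌊ρ⌋₊ with hn
  obtain ⟨g, hg, hfg, hsum⟩ := hasSum_sq_coeff_high hf n
  have hlow : ∑ z ∈ cube d n, ‖UnitAddTorus.mFourierCoeff (fun x => (f x : ℂ)) z‖ ≤ t / 2 := by
    refine (sum_norm_coeff_cube_le hf h0 n).trans ?_
    rw [← hA]
    have h1 : (3 * n : ℝ) ^ d ≤ (t / (2 * A)) ^ 2 := by
      have h2 : (3 * n : ℝ) ≤ (t / (2 * A)) ^ (2 / (d : ℝ)) := by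
        have : (n : ℝ) ≤ ρ := Nat.floor_le hρ0
        rw [hρ] at this
        linarith
      calc (3 * n : ℝ) ^ d ≤ ((t / (2 * A)) ^ (2 / (d : ℝ))) ^ d := by gcongr
        _ = _ := by
          rw [← Real.rpow_natCast, ← Real.rpow_mul (by positivity), ← Real.rpow_natCast _ 2]
          congr 1
          field_simp
          norm_num
    calc √((3 * n : ℝ) ^ d) * A ≤ √((t / (2 * A)) ^ 2) * A := by gcongr
      _ = t / 2 := by rw [Real.sqrt_sq (by positivity)]; field_simp
  have hsub : {x | t < |f x|} ⊆ {x | (t / 2) ^ 2 ≤ g x ^ 2} := fun x (hx : t < |f x|) => by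
    have h1 := (hfg x).trans hlow
    have h2 : |f x| ≤ |f x - g x| + |g x| := by
      have := abs_add_le (f x - g x) (g x)
      rwa [sub_add_cancel] at this
    have h3 : t / 2 ≤ |g x| := by linarith
    change (t / 2) ^ 2 ≤ g x ^ 2
    rw [← sq_abs (g x)]
    gcongr
  have hgi : Integrable (fun x => g x ^ 2) (torusMeasure d) := hg.integrable_sq
  have hcheb := mul_meas_ge_le_integral_of_nonneg (.of_forall fun x => sq_nonneg (g x)) hgi
    ((t / 2) ^ 2)
  have hm : (torusMeasure d).real {x | (t / 2) ^ 2 ≤ g x ^ 2} ≤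
      4 / t ^ 2 * ∫ x, g x ^ 2 ∂torusMeasure d := by
    rw [show 4 / t ^ 2 = ((t / 2) ^ 2)⁻¹ by field_simp; norm_num]
    rw [← div_eq_inv_mul, le_div_iff₀ (by positivity), mul_comm]
    exact hcheb
  have hsum' := hsum.mul_left (4 / t ^ 2)
  calc torusMeasure d {x | t < |f x|} ≤ torusMeasure d {x | (t / 2) ^ 2 ≤ g x ^ 2} :=
        measure_mono hsub
    _ = ENNReal.ofReal ((torusMeasure d).real {x | (t / 2) ^ 2 ≤ g x ^ 2}) :=
        (ofReal_measureReal (measure_ne_top _ _)).symm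
    _ ≤ ENNReal.ofReal (4 / t ^ 2 * ∫ x, g x ^ 2 ∂torusMeasure d) := ENNReal.ofReal_le_ofReal hm
    _ = _ := by
        rw [← hsum'.tsum_eq, ENNReal.ofReal_tsum_of_nonneg _ hsum'.summable]
        intro z
        split_ifs <;> positivity
    _ ≤ _ := by
        refine ENNReal.tsum_le_tsum fun z => ?_
        by_cases hz : z ∈ cube d n
        · simp [hz]
        · rw [if_neg hz, if_pos]
          have h1 := sq_le_freqSq hz
          have h2 : ρ < n + 1 := Nat.lt_floor_add_one ρ
          have h3 : (t / (2 * A)) ^ (2 / (d : ℝ)) < (9 * freqSq z) ^ (1 / 2 : ℝ) := by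
            rw [← Real.sqrt_eq_rpow]
            refine Real.lt_sqrt_of_sq_lt ?_
            have : (t / (2 * A)) ^ (2 / (d : ℝ)) < 3 * (n + 1) := by rw [hρ] at h2; linarith
            calc _ < (3 * ((n : ℝ) + 1)) ^ 2 := by gcongr
              _ ≤ _ := by linarith
          have h4 := Real.rpow_lt_rpow (by positivity) h3 (show 0 < (d : ℝ) / 2 by positivity)
          rw [← Real.rpow_mul (by positivity),
            ← Real.rpow_mul (mul_nonneg (by norm_num) (freqSq_nonneg z)),
            show 2 / (d : ℝ) * (d / 2) = 1 by field_simp, Real.rpow_one,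
            show 1 / 2 * ((d : ℝ) / 2) = d / 4 by ring, div_lt_iff₀ (by positivity)] at h4
          linarith

/-- The Gagliardo–Nirenberg inequality for functions with mean zero. -/
theorem lintegral_rpow_le (hd : 0 < d) {s : ℝ} (hs : 2 < s) (hs' : d * (s - 2) ≤ 4)
    {f : UnitAddTorus (Fin d) → ℝ} (hf : MemLp f 2 (torusMeasure d))
    (h0 : UnitAddTorus.mFourierCoeff (fun x => (f x : ℂ)) 0 = 0) :
    ∫⁻ x, ENNReal.ofReal (|f x| ^ s) ∂torusMeasure d ≤
      ∑' z, ENNReal.ofReal (gnConst s * √(∫ x, f x ^ 2 ∂torusMeasure d) ^ (s - 2) *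
        (freqSq z * ‖UnitAddTorus.mFourierCoeff (fun x => (f x : ℂ)) z‖ ^ 2)) := by
  set A := √(∫ x, f x ^ 2 ∂torusMeasure d) with hA
  set c := UnitAddTorus.mFourierCoeff fun x => (f x : ℂ) with hc
  have hA0 : 0 ≤ A := Real.sqrt_nonneg _
  rcases hA0.eq_or_lt with hA0 | hA0
  · have h1 : ∫ x, f x ^ 2 ∂torusMeasure d = 0 :=
      (Real.sqrt_eq_zero (integral_nonneg fun x => sq_nonneg _)).mp hA0.symm
    rw [integral_eq_zero_iff_of_nonneg (fun x => sq_nonneg _) hf.integrable_sq] at h1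
    have : ∫⁻ x, ENNReal.ofReal (|f x| ^ s) ∂torusMeasure d = 0 := by
      refine (lintegral_congr_ae ?_).trans lintegral_zero
      filter_upwards [h1] with x hx
      have : f x = 0 := by simpa using hx
      rw [this, abs_zero, Real.zero_rpow (by linarith), ENNReal.ofReal_zero]
    rw [this]
    exact zero_le
  · have h1 := lintegral_rpow_eq_lintegral_meas_lt_mul (torusMeasure d)
      (.of_forall fun x => abs_nonneg (f x)) hf.1.aemeasurable.abs (show 0 < s by linarith)
    rw [h1]
    have h2 : ∫⁻ t in Set.Ioi 0, torusMeasure d {x | t < |f x|} * ENNReal.ofReal (t ^ (s - 1)) ≤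
        ∫⁻ t in Set.Ioi 0, ∑' z, (if t < 2 * A * (9 * freqSq z) ^ ((d : ℝ) / 4) then
          ENNReal.ofReal (4 / t ^ 2 * ‖c z‖ ^ 2) else 0) * ENNReal.ofReal (t ^ (s - 1)) := by
      refine setLIntegral_mono' measurableSet_Ioi fun t ht => ?_
      rw [ENNReal.tsum_mul_right]
      gcongr
      exact measure_lt_le hd hf h0 hA hA0 ht
    have h3 (z : Fin d → ℤ) : Measurable fun t : ℝ =>
        (if t < 2 * A * (9 * freqSq z) ^ ((d : ℝ) / 4) then
          ENNReal.ofReal (4 / t ^ 2 * ‖c z‖ ^ 2) else 0) * ENNReal.ofReal (t ^ (s - 1)) := by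
      refine Measurable.mul (Measurable.ite measurableSet_Iio ?_ measurable_const) ?_
      · fun_prop
      · fun_prop
    rw [lintegral_tsum fun z => (h3 z).aemeasurable] at h2
    refine (mul_le_mul_right h2 _).trans ?_
    rw [← ENNReal.tsum_mul_left]
    refine ENNReal.tsum_le_tsum fun z => ?_
    have hh : 0 ≤ 2 * A * (9 * freqSq z) ^ ((d : ℝ) / 4) := by
      have := freqSq_nonneg z
      positivity
    rw [lintegral_rpow_Ioo hs hh _ (sq_nonneg _), ← ENNReal.ofReal_mul (by linarith)]
    refine ENNReal.ofReal_le_ofReal ?_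
    by_cases hz : z = 0
    · rw [hz, h0, norm_zero]
      simp
    have h4 : (2 * A * (9 * freqSq z) ^ ((d : ℝ) / 4)) ^ (s - 2) ≤
        2 ^ (s - 2) * A ^ (s - 2) * (9 * freqSq z) := by
      have hz1 : 1 ≤ 9 * freqSq z := by linarith [one_le_freqSq hz]
      rw [Real.mul_rpow (by positivity) (by positivity), Real.mul_rpow (by positivity) hA0.le,
        ← Real.rpow_mul (by linarith)]
      gcongr
      nth_rewrite 2 [← Real.rpow_one (9 * freqSq z)]
      exact Real.rpow_le_rpow_of_exponent_le hz1 (by linarith)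
    have hs2 : 0 < s - 2 := by linarith
    calc s * (4 * ‖c z‖ ^ 2 * ((2 * A * (9 * freqSq z) ^ ((d : ℝ) / 4)) ^ (s - 2) / (s - 2))) ≤
        s * (4 * ‖c z‖ ^ 2 * (2 ^ (s - 2) * A ^ (s - 2) * (9 * freqSq z) / (s - 2))) := by gcongr
      _ = _ := by unfold gnConst; ring

end GagliardoNirenberg

/-! ## Exponents -/

section Exponents

/-- The dual exponent `p' = p/(p-1)`. -/
def dualExp (p : ℝ) : ℝ := p / (p - 1)

/-- The exponent `2p'`. -/
def squareExp (p : ℝ) : ℝ := 2 * dualExp p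

variable (p : ℝ) [h : Fact (1 < p)]

theorem holderConjugate_dualExp : p.HolderConjugate (dualExp p) :=
  Real.HolderConjugate.conjExponent h.out

theorem one_lt_dualExp : 1 < dualExp p := (holderConjugate_dualExp p).symm.lt

theorem two_lt_squareExp : 2 < squareExp p := by
  have := one_lt_dualExp p
  unfold squareExp
  linarith

theorem squareExp_sub_two : (squareExp p - 2) * (p - 1) = 2 := by
  have : p - 1 ≠ 0 := (sub_pos.mpr h.out).ne'
  unfold squareExp dualExp
  field_simp
  ring

instance : Fact (1 ≤ ENNReal.ofReal (dualExp p)) :=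
  ⟨by rw [ENNReal.one_le_ofReal]; exact (one_lt_dualExp p).le⟩

instance : Fact (1 ≤ ENNReal.ofReal (squareExp p)) :=
  ⟨by rw [ENNReal.one_le_ofReal]; linarith [two_lt_squareExp p]⟩

instance : ENNReal.HolderConjugate (ENNReal.ofReal (dualExp p)) (ENNReal.ofReal p) :=
  (holderConjugate_dualExp p).symm.ennrealOfReal

instance : ENNReal.HolderTriple (ENNReal.ofReal (squareExp p)) (ENNReal.ofReal (squareExp p))
    (ENNReal.ofReal (dualExp p)) := by
  have h1 : 0 < dualExp p := one_pos.trans (one_lt_dualExp p)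
  refine Real.HolderTriple.ennrealOfReal ⟨?_, ?_, ?_⟩ <;> unfold squareExp
  · field_simp
    norm_num
  · positivity
  · positivity

end Exponents

/-! ## Energy and dissipation -/

section Energy

variable {d : ℕ}

theorem tendsto_cube_atTop : Filter.Tendsto (cube d) Filter.atTop Filter.atTop := by
  refine Filter.tendsto_atTop_finset_of_monotone (fun m n hmn z hz => ?_) fun z => ?_
  · rw [mem_cube] at hz ⊢
    exact fun i => (hz i).trans (by exact_mod_cast hmn)
  · refine ⟨∑ i, (z i).natAbs, mem_cube.mpr fun i => ?_⟩
    have := Finset.single_le_sum (f := fun i => (z i).natAbs) (fun _ _ => Nat.zero_le _)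
      (Finset.mem_univ i)
    rw [Int.abs_eq_natAbs]
    exact_mod_cast this

theorem tendsto_tsum_cube_compl {g : (Fin d → ℤ) → ℝ} (hg : Summable g) :
    Filter.Tendsto (fun N => ∑' z, if z ∈ cube d N then 0 else g z) Filter.atTop (nhds 0) := by
  have h1 (N : ℕ) : (∑' z, if z ∈ cube d N then 0 else g z) = ∑' z, g z - ∑ z ∈ cube d N, g z := by
    have h2 : HasSum (fun z => if z ∈ cube d N then g z else 0) (∑ z ∈ cube d N, g z) := by
      have : HasSum (fun z => if z ∈ cube d N then g z else 0)
          (∑ z ∈ cube d N, if z ∈ cube d N then g z else 0) :=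
        hasSum_sum_of_ne_finset_zero fun z hz => if_neg hz
      rwa [Finset.sum_congr rfl fun z hz => if_pos hz] at this
    rw [← (hg.hasSum.sub h2).tsum_eq]
    refine tsum_congr fun z => ?_
    split_ifs <;> simp
  simp only [h1]
  have := (hg.hasSum.comp (tendsto_cube_atTop (d := d))).const_sub (∑' z, g z)
  rwa [sub_self] at this

theorem memLp_two_Lp {p : ℝ} (hp : 2 ≤ p) (f : Lp ℝ (ENNReal.ofReal p) (torusMeasure d)) :
    MemLp f 2 (torusMeasure d) :=
  (Lp.memLp f).mono_exponent (by rw [ENNReal.ofNat_le_ofReal]; exact hp)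

variable {p : ℝ} [Fact (1 < p)]

theorem hasSum_sq_rcoeff (hp : 2 ≤ p) (f : Lp ℝ (ENNReal.ofReal p) (torusMeasure d)) :
    HasSum (fun z => ‖rcoeff z f‖ ^ 2) (∫ x, f x ^ 2 ∂torusMeasure d) := by
  simp only [rcoeff_eq]
  exact hasSum_sq_coeff (memLp_two_Lp hp f)

/-- The square of the `L_2` norm of a field. -/
def energy (u : V d (ENNReal.ofReal p) 1) : ℝ := ∑ i, ∫ x, V.val i u x ^ 2 ∂torusMeasure d

/-- The square of the `L_2` norm of the gradient of a field. -/
def dissipation (u : V d (ENNReal.ofReal p) 1) : ℝ :=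
  ∑ i, ∑ j, ∫ x, V.grad j i u x ^ 2 ∂torusMeasure d

theorem energy_nonneg (u : V d (ENNReal.ofReal p) 1) : 0 ≤ energy u :=
  Finset.sum_nonneg fun _ _ => integral_nonneg fun _ => sq_nonneg _

theorem dissipation_nonneg (u : V d (ENNReal.ofReal p) 1) : 0 ≤ dissipation u :=
  Finset.sum_nonneg fun _ _ => Finset.sum_nonneg fun _ _ => integral_nonneg fun _ => sq_nonneg _

theorem hasSum_val (hp : 2 ≤ p) (i : Fin d) (u : V d (ENNReal.ofReal p) 1) :
    HasSum (fun z => ‖V.coeff 1 u z i‖ ^ 2) (∫ x, V.val i u x ^ 2 ∂torusMeasure d) := by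
  have := hasSum_sq_rcoeff hp (V.val i u)
  simp only [rcoeff_val hp] at this
  exact this

theorem hasSum_energy (hp : 2 ≤ p) (u : V d (ENNReal.ofReal p) 1) :
    HasSum (fun z => ∑ i, ‖V.coeff 1 u z i‖ ^ 2) (energy u) :=
  hasSum_sum fun i _ => hasSum_val hp i u

theorem integral_val_le_energy (i : Fin d) (u : V d (ENNReal.ofReal p) 1) :
    ∫ x, V.val i u x ^ 2 ∂torusMeasure d ≤ energy u :=
  Finset.single_le_sum (f := fun i => ∫ x, V.val i u x ^ 2 ∂torusMeasure d)
    (fun _ _ => integral_nonneg fun _ => sq_nonneg _) (Finset.mem_univ i)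

theorem hasSum_grad (hp : 2 ≤ p) (i : Fin d) (u : V d (ENNReal.ofReal p) 1) :
    HasSum (fun z => 4 * Real.pi ^ 2 * (freqSq z * ‖V.coeff 1 u z i‖ ^ 2))
      (∑ j, ∫ x, V.grad j i u x ^ 2 ∂torusMeasure d) := by
  have h1 (j : Fin d) : HasSum (fun z => 4 * Real.pi ^ 2 * ((z j : ℝ) ^ 2 *
      ‖V.coeff 1 u z i‖ ^ 2)) (∫ x, V.grad j i u x ^ 2 ∂torusMeasure d) := by
    have := hasSum_sq_rcoeff hp (V.grad j i u)
    refine this.congr_fun fun z => ?_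
    rw [rcoeff_grad hp]
    simp only [norm_mul, Complex.norm_I, Complex.norm_real, Complex.norm_ofNat, Real.norm_eq_abs,
      abs_of_pos Real.pi_pos, Complex.norm_intCast, mul_pow, sq_abs]
    ring
  have h2 := hasSum_sum (s := Finset.univ) fun j _ => h1 j
  refine h2.congr_fun fun z => ?_
  rw [← Finset.mul_sum, ← Finset.sum_mul]
  rfl

theorem sum_grad_le_dissipation (i : Fin d) (u : V d (ENNReal.ofReal p) 1) :
    ∑ j, ∫ x, V.grad j i u x ^ 2 ∂torusMeasure d ≤ dissipation u :=
  Finset.single_le_sum (f := fun i => ∑ j, ∫ x, V.grad j i u x ^ 2 ∂torusMeasure d)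
    (fun _ _ => Finset.sum_nonneg fun _ _ => integral_nonneg fun _ => sq_nonneg _)
    (Finset.mem_univ i)

/-- The Gagliardo–Nirenberg inequality with the exponent `2p'`. -/
theorem lintegral_squareExp_le (hd : 0 < d) (hdp : 1 + (d : ℝ) / 2 ≤ p)
    {f : UnitAddTorus (Fin d) → ℝ} (hf : MemLp f 2 (torusMeasure d))
    (h0 : UnitAddTorus.mFourierCoeff (fun x => (f x : ℂ)) 0 = 0) :
    ∫⁻ x, ENNReal.ofReal (|f x| ^ squareExp p) ∂torusMeasure d ≤
      ∑' z, ENNReal.ofReal (gnConst (squareExp p) *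
        √(∫ x, f x ^ 2 ∂torusMeasure d) ^ (squareExp p - 2) *
        (freqSq z * ‖UnitAddTorus.mFourierCoeff (fun x => (f x : ℂ)) z‖ ^ 2)) := by
  refine lintegral_rpow_le hd (two_lt_squareExp p) ?_ hf h0
  have h1 := squareExp_sub_two p
  have h2 := two_lt_squareExp p
  nlinarith

theorem gnConst_nonneg (p : ℝ) [Fact (1 < p)] : 0 ≤ gnConst (squareExp p) := by
  have h2 := two_lt_squareExp p
  have : 0 < squareExp p - 2 := by linarith
  unfold gnConst
  positivity

theorem memLp_squareExp_of_lintegral {f : UnitAddTorus (Fin d) → ℝ}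
    (hf : AEStronglyMeasurable f (torusMeasure d))
    (h : ∫⁻ x, ENNReal.ofReal (|f x| ^ squareExp p) ∂torusMeasure d < ∞) :
    MemLp f (ENNReal.ofReal (squareExp p)) (torusMeasure d) := by
  have h2 := two_lt_squareExp p
  have h3 : 0 < squareExp p := by linarith
  rw [← integrable_norm_rpow_iff hf (by simpa using h3) ENNReal.ofReal_ne_top,
    ENNReal.toReal_ofReal h3.le]
  refine ⟨(hf.norm.aemeasurable.pow_const _).aestronglyMeasurable, ?_⟩
  rw [hasFiniteIntegral_iff_ofReal (.of_forall fun x => by positivity)]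
  exact h

theorem lintegral_val_le (hd : 0 < d) (hp : 2 ≤ p) (hdp : 1 + (d : ℝ) / 2 ≤ p) (i : Fin d)
    (u : V d (ENNReal.ofReal p) 1) :
    ∫⁻ x, ENNReal.ofReal (|V.val i u x| ^ squareExp p) ∂torusMeasure d ≤
      ENNReal.ofReal (gnConst (squareExp p) * √(energy u) ^ (squareExp p - 2) *
        dissipation u) := by
  have hc (z : Fin d → ℤ) : UnitAddTorus.mFourierCoeff (fun x => (V.val i u x : ℂ)) z =
      V.coeff 1 u z i := by rw [← rcoeff_eq, rcoeff_val hp]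
  have h1 := lintegral_squareExp_le hd hdp (memLp_two_Lp hp (V.val i u))
    (by rw [hc, (isSolenoidal_coeff 1 u).mean_zero]; rfl)
  simp only [hc] at h1
  refine h1.trans ?_
  have hK := gnConst_nonneg p
  have h2 := two_lt_squareExp p
  have h3 : √(∫ x, V.val i u x ^ 2 ∂torusMeasure d) ^ (squareExp p - 2) ≤
      √(energy u) ^ (squareExp p - 2) :=
    Real.rpow_le_rpow (Real.sqrt_nonneg _) (Real.sqrt_le_sqrt (integral_val_le_energy i u))
      (by linarith)
  set A := √(∫ x, V.val i u x ^ 2 ∂torusMeasure d) ^ (squareExp p - 2)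
  have hA : 0 ≤ A := Real.rpow_nonneg (Real.sqrt_nonneg _) _
  have h4 := (hasSum_grad hp i u).mul_left ((4 * Real.pi ^ 2)⁻¹ * (gnConst (squareExp p) * A))
  have h5 : ∀ z, (4 * Real.pi ^ 2)⁻¹ * (gnConst (squareExp p) * A) *
      (4 * Real.pi ^ 2 * (freqSq z * ‖V.coeff 1 u z i‖ ^ 2)) =
      gnConst (squareExp p) * A * (freqSq z * ‖V.coeff 1 u z i‖ ^ 2) := fun z => by
    have := Real.pi_pos
    field_simp
  simp only [h5] at h4
  rw [← ENNReal.ofReal_tsum_of_nonneg _ h4.summable, h4.tsum_eq]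
  · refine ENNReal.ofReal_le_ofReal ?_
    have h6 := sum_grad_le_dissipation i u
    have h7 : 0 ≤ ∑ j, ∫ x, V.grad j i u x ^ 2 ∂torusMeasure d :=
      Finset.sum_nonneg fun _ _ => integral_nonneg fun _ => sq_nonneg _
    have h8 : (4 * Real.pi ^ 2)⁻¹ ≤ 1 := inv_le_one_of_one_le₀ (by nlinarith [Real.pi_gt_three])
    calc _ ≤ 1 * (gnConst (squareExp p) * A) * ∑ j, ∫ x, V.grad j i u x ^ 2 ∂torusMeasure d := by
          gcongr
      _ ≤ _ := by rw [one_mul]; gcongr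
  · intro z
    have := freqSq_nonneg z
    positivity

theorem memLp_val (hd : 0 < d) (hp : 2 ≤ p) (hdp : 1 + (d : ℝ) / 2 ≤ p) (i : Fin d)
    (u : V d (ENNReal.ofReal p) 1) :
    MemLp (V.val i u) (ENNReal.ofReal (squareExp p)) (torusMeasure d) :=
  memLp_squareExp_of_lintegral (Lp.aestronglyMeasurable _)
    ((lintegral_val_le hd hp hdp i u).trans_lt ENNReal.ofReal_lt_top)

theorem integrable_val_rpow (hd : 0 < d) (hp : 2 ≤ p) (hdp : 1 + (d : ℝ) / 2 ≤ p) (i : Fin d)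
    (u : V d (ENNReal.ofReal p) 1) :
    Integrable (fun x => |V.val i u x| ^ squareExp p) (torusMeasure d) := by
  have h2 := two_lt_squareExp p
  have := (memLp_val hd hp hdp i u).integrable_norm_rpow (by simp; linarith) ENNReal.ofReal_ne_top
  rwa [ENNReal.toReal_ofReal (by linarith)] at this

theorem integral_val_rpow_le (hd : 0 < d) (hp : 2 ≤ p) (hdp : 1 + (d : ℝ) / 2 ≤ p) (i : Fin d)
    (u : V d (ENNReal.ofReal p) 1) :
    ∫ x, |V.val i u x| ^ squareExp p ∂torusMeasure d ≤
      gnConst (squareExp p) * √(energy u) ^ (squareExp p - 2) * dissipation u := by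
  have h1 := lintegral_val_le hd hp hdp i u
  rw [← ofReal_integral_eq_lintegral_ofReal (integrable_val_rpow hd hp hdp i u)
    (.of_forall fun x => by positivity)] at h1
  refine (ENNReal.ofReal_le_ofReal_iff ?_).mp h1
  have := gnConst_nonneg p
  have := dissipation_nonneg u
  positivity

/-- The component `v_i` of a field in `V_{p,1}` as an element of `L_{2p'}`. -/
def valR (hd : 0 < d) (hp : 2 ≤ p) (hdp : 1 + (d : ℝ) / 2 ≤ p) (i : Fin d)
    (u : V d (ENNReal.ofReal p) 1) : Lp ℝ (ENNReal.ofReal (squareExp p)) (torusMeasure d) :=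
  (memLp_val hd hp hdp i u).toLp _

theorem memLp_of_continuous {f : UnitAddTorus (Fin d) → ℝ} (hf : Continuous f) (q : ℝ≥0∞) :
    MemLp f q (torusMeasure d) := hf.memLp_of_hasCompactSupport (HasCompactSupport.of_compactSpace _)

theorem TestField.continuous_field (φ : TestField d) (i : Fin d) :
    Continuous fun x => φ.field x i := by fun_prop

/-- The truncations of `v` converge to `v` in `L_{2p'}`. -/
theorem tendsto_trunc_squareExp (hd : 0 < d) (hp : 2 ≤ p) (hdp : 1 + (d : ℝ) / 2 ≤ p) (i : Fin d)
    (u : V d (ENNReal.ofReal p) 1) :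
    Filter.Tendsto (fun N => (memLp_of_continuous
      (((isSolenoidal_coeff 1 u).trunc N).continuous_field i)
        (ENNReal.ofReal (squareExp p))).toLp _) Filter.atTop (nhds (valR hd hp hdp i u)) := by
  have h2 := two_lt_squareExp p
  have h3 : 0 < squareExp p := by linarith
  have hK := gnConst_nonneg p
  rw [valR, Lp.tendsto_Lp_iff_tendsto_eLpNorm'']
  simp only [eLpNorm_eq_lintegral_rpow_enorm_toReal (show ENNReal.ofReal (squareExp p) ≠ 0 by
    simpa using h3) ENNReal.ofReal_ne_top, ENNReal.toReal_ofReal h3.le]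
  have hz : (0 : ℝ≥0∞) ^ (1 / squareExp p) = 0 := ENNReal.zero_rpow_of_pos (by positivity)
  rw [← hz]
  refine Filter.Tendsto.ennrpow_const _ ?_
  set K := gnConst (squareExp p) * √(energy u) ^ (squareExp p - 2) with hKdef
  have hK0 : 0 ≤ K := by positivity
  have hs : Summable fun z => K * (freqSq z * ‖V.coeff 1 u z i‖ ^ 2) := by
    have h4 := ((hasSum_grad hp i u).summable.mul_left ((4 * Real.pi ^ 2)⁻¹ * K))
    refine h4.congr fun z => ?_
    have := Real.pi_pos
    field_simp
  have ht := ENNReal.tendsto_ofReal (tendsto_tsum_cube_compl hs)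
  rw [ENNReal.ofReal_zero] at ht
  refine tendsto_of_tendsto_of_tendsto_of_le_of_le tendsto_const_nhds ht (fun _ => zero_le)
    fun N => ?_
  set w := fun x => ((isSolenoidal_coeff 1 u).trunc N).field x i with hw
  have hwm := memLp_of_continuous (((isSolenoidal_coeff 1 u).trunc N).continuous_field i) 2
  have hm : MemLp (fun x => w x - V.val i u x) 2 (torusMeasure d) :=
    hwm.sub (memLp_two_Lp hp (V.val i u))
  have hc (z : Fin d → ℤ) : UnitAddTorus.mFourierCoeff (fun x => ((w x - V.val i u x : ℝ) : ℂ)) z =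
      if z ∈ cube d N then 0 else -V.coeff 1 u z i := by
    have h5 := mFourierCoeff_sub (hwm.integrable one_le_two).ofReal
      ((memLp_two_Lp hp (V.val i u)).integrable one_le_two).ofReal z
    have h6 : UnitAddTorus.mFourierCoeff (fun x => (V.val i u x : ℂ)) z = V.coeff 1 u z i := by
      rw [← rcoeff_eq, rcoeff_val hp]
    have h7 := TestField.mFourierCoeff_field ((isSolenoidal_coeff 1 u).trunc N) i z
    simp only [Complex.ofReal_sub]
    refine h5.trans ?_
    have h8 : ((isSolenoidal_coeff 1 u).trunc N).coeff z i =
        if z ∈ cube d N then V.coeff 1 u z i else 0 := by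
      rw [IsSolenoidal.trunc_coeff, cubeSymbol]
      simp only [mem_cube]
      split_ifs <;> simp
    refine (congrArg₂ (· - ·) (h7.trans h8) h6).trans ?_
    split_ifs <;> simp
  have h0 : UnitAddTorus.mFourierCoeff (fun x => ((w x - V.val i u x : ℝ) : ℂ)) 0 = 0 := by
    rw [hc, (isSolenoidal_coeff 1 u).mean_zero]
    simp
  have hE : ∫ x, (w x - V.val i u x) ^ 2 ∂torusMeasure d ≤ energy u := by
    refine le_trans ?_ (integral_val_le_energy i u)
    refine hasSum_le (fun z => ?_) (hasSum_sq_coeff hm) (hasSum_val hp i u)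
    rw [hc]
    split_ifs
    · simp
    · rw [norm_neg]
  have hE' : √(∫ x, (w x - V.val i u x) ^ 2 ∂torusMeasure d) ^ (squareExp p - 2) ≤
      √(energy u) ^ (squareExp p - 2) :=
    Real.rpow_le_rpow (Real.sqrt_nonneg _) (Real.sqrt_le_sqrt hE) (by linarith)
  calc ∫⁻ x, ‖(w - V.val i u) x‖ₑ ^ squareExp p ∂torusMeasure d =
      ∫⁻ x, ENNReal.ofReal (|w x - V.val i u x| ^ squareExp p) ∂torusMeasure d := by
        refine lintegral_congr fun x => ?_
        rw [← ENNReal.ofReal_rpow_of_nonneg (abs_nonneg _) h3.le, ← Real.norm_eq_abs,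
          ofReal_norm]
        rfl
    _ ≤ _ := lintegral_squareExp_le hd hdp hm h0
    _ ≤ ∑' z, ENNReal.ofReal (if z ∈ cube d N then 0 else
          K * (freqSq z * ‖V.coeff 1 u z i‖ ^ 2)) := by
        refine ENNReal.tsum_le_tsum fun z => ENNReal.ofReal_le_ofReal ?_
        have := freqSq_nonneg z
        rw [hc]
        split_ifs
        · simp
        · rw [norm_neg, hKdef]
          gcongr
    _ = _ := by
        rw [ENNReal.ofReal_tsum_of_nonneg]
        · intro z
          have := freqSq_nonneg z
          split_ifs <;> positivity
        · refine Summable.of_nonneg_of_le (fun z => ?_) (fun z => ?_) hs <;>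
          · have := freqSq_nonneg z
            split_ifs <;> first | positivity | exact le_rfl

/-- The derivatives of the truncations of `v` converge in `L_p`. -/
theorem tendsto_trunc_partialDeriv (hp : 2 ≤ p) (j i : Fin d) (u : V d (ENNReal.ofReal p) 1) :
    Filter.Tendsto (fun N => (memLp_of_continuous
      (((isSolenoidal_coeff 1 u).trunc N).continuous_partialDeriv j i)
        (ENNReal.ofReal p)).toLp _) Filter.atTop (nhds (V.grad j i u)) := by
  have h := tendsto_realCube hp (V.grad j i u)
  refine h.congr fun N => ?_
  refine Lp.ext ?_
  filter_upwards [trunc_partialDeriv_ae_eq hp u N j i, MemLp.coeFn_toLp (memLp_of_continuous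
      (((isSolenoidal_coeff 1 u).trunc N).continuous_partialDeriv j i)
        (ENNReal.ofReal p))] with x h1 h2
  rw [h2, h1]

end Energy

/-! ## Transport by a divergence-free field -/

section Transport

variable {d : ℕ}

theorem integral_transport_testField (φ ψ χ : TestField d) (i k : Fin d) :
    ∫ x, ∑ j, (φ.field x j * χ.field x k * ψ.partialDeriv j i x +
      φ.field x j * ψ.field x i * χ.partialDeriv j k x) ∂torusMeasure d = 0 := by
  let C (z w y : Fin d → ℤ) : ℂ := ∑ j, φ.coeff z j * ψ.coeff w i * χ.coeff y k *
    (2 * Real.pi * Complex.I * ((w j : ℂ) + (y j : ℂ)))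
  have h1 (x : UnitAddTorus (Fin d)) :
      ((∑ j, (φ.field x j * χ.field x k * ψ.partialDeriv j i x +
        φ.field x j * ψ.field x i * χ.partialDeriv j k x) : ℝ) : ℂ) =
      ∑ z ∈ φ.coeff.support, ∑ w ∈ ψ.coeff.support, ∑ y ∈ χ.coeff.support,
        C z w y * UnitAddTorus.mFourier (z + w + y) x := by
    have h2 (j : Fin d) : (φ.field x j : ℂ) * χ.field x k * ψ.partialDeriv j i x +
        φ.field x j * ψ.field x i * χ.partialDeriv j k x =
        ∑ z ∈ φ.coeff.support, ∑ w ∈ ψ.coeff.support, ∑ y ∈ χ.coeff.support,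
          φ.coeff z j * ψ.coeff w i * χ.coeff y k *
            (2 * Real.pi * Complex.I * ((w j : ℂ) + (y j : ℂ))) *
              UnitAddTorus.mFourier (z + w + y) x := by
      have h3 : (φ.field x j : ℂ) * χ.field x k * ψ.partialDeriv j i x =
          φ.field x j * (ψ.partialDeriv j i x * χ.field x k) := by ring
      have h4 : (φ.field x j : ℂ) * ψ.field x i * χ.partialDeriv j k x =
          φ.field x j * (ψ.field x i * χ.partialDeriv j k x) := by ring
      rw [h3, h4, φ.field_apply, ψ.partialDeriv_apply, χ.field_apply, ψ.field_apply,
        χ.partialDeriv_apply, ← mul_add, Finset.sum_mul_sum, Finset.sum_mul_sum,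
        ← Finset.sum_add_distrib, Finset.sum_mul]
      refine Finset.sum_congr rfl fun z _ => ?_
      rw [Finset.mul_sum]
      refine Finset.sum_congr rfl fun w _ => ?_
      rw [← Finset.sum_add_distrib, Finset.mul_sum]
      refine Finset.sum_congr rfl fun y _ => ?_
      rw [UnitAddTorus.mFourier_add, UnitAddTorus.mFourier_add]
      ring
    push_cast
    simp only [h2, C, Finset.sum_mul]
    rw [Finset.sum_comm]
    refine Finset.sum_congr rfl fun z _ => ?_
    rw [Finset.sum_comm]
    refine Finset.sum_congr rfl fun w _ => ?_
    rw [Finset.sum_comm]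
  have h2 (z w y : Fin d → ℤ) : Integrable (fun x => C z w y *
      UnitAddTorus.mFourier (z + w + y) x) (torusMeasure d) :=
    (by fun_prop : Continuous fun x => C z w y *
      UnitAddTorus.mFourier (z + w + y) x).integrable_of_hasCompactSupport
      (HasCompactSupport.of_compactSpace _)
  refine Complex.ofReal_injective ?_
  rw [← integral_complex_ofReal]
  simp only [h1]
  rw [integral_finsetSum _ fun z _ => integrable_finsetSum _ fun w _ =>
    integrable_finsetSum _ fun y _ => h2 z w y, Complex.ofReal_zero]
  refine Finset.sum_eq_zero fun z _ => ?_
  rw [integral_finsetSum _ fun w _ => integrable_finsetSum _ fun y _ => h2 z w y]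
  refine Finset.sum_eq_zero fun w _ => ?_
  rw [integral_finsetSum _ fun y _ => h2 z w y]
  refine Finset.sum_eq_zero fun y _ => ?_
  rw [integral_const_mul, integral_mFourier]
  split_ifs with h
  · rw [mul_one]
    have h3 (j : Fin d) : (w j : ℂ) + (y j : ℂ) = -(z j : ℂ) := by
      have := congrFun h j
      simp only [Pi.add_apply, Pi.zero_apply] at this
      have h4 : w j + y j = -z j := by linarith
      exact_mod_cast h4
    have h4 : C z w y = -(2 * Real.pi * Complex.I * ψ.coeff w i * χ.coeff y k) *
        ∑ j, (z j : ℂ) * φ.coeff z j := by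
      simp only [C, h3, Finset.mul_sum]
      exact Finset.sum_congr rfl fun j _ => by ring
    rw [h4, φ.div_free, mul_zero]
  · rw [mul_zero]

theorem tendsto_clm_apply₂ {E F G : Type*} [NormedAddCommGroup E] [NormedAddCommGroup F]
    [NormedAddCommGroup G] [NormedSpace ℝ E] [NormedSpace ℝ F] [NormedSpace ℝ G]
    (B : E →L[ℝ] F →L[ℝ] G) {f : ℕ → E} {g : ℕ → F} {a : E} {b : F}
    (hf : Filter.Tendsto f Filter.atTop (nhds a)) (hg : Filter.Tendsto g Filter.atTop (nhds b)) :
    Filter.Tendsto (fun n => B (f n) (g n)) Filter.atTop (nhds (B a b)) :=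
  (B.continuous₂.tendsto (a, b)).comp (hf.prodMk_nhds hg)

variable {p : ℝ} [Fact (1 < p)]

theorem tendsto_integral_mul_mul {f f' : ℕ → Lp ℝ (ENNReal.ofReal (squareExp p)) (torusMeasure d)}
    {g : ℕ → Lp ℝ (ENNReal.ofReal p) (torusMeasure d)}
    {f₀ f₀' : Lp ℝ (ENNReal.ofReal (squareExp p)) (torusMeasure d)}
    {g₀ : Lp ℝ (ENNReal.ofReal p) (torusMeasure d)}
    (hf : Filter.Tendsto f Filter.atTop (nhds f₀)) (hf' : Filter.Tendsto f' Filter.atTop (nhds f₀'))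
    (hg : Filter.Tendsto g Filter.atTop (nhds g₀)) :
    Filter.Tendsto (fun n => ∫ x, f n x * f' n x * g n x ∂torusMeasure d) Filter.atTop
      (nhds (∫ x, f₀ x * f₀' x * g₀ x ∂torusMeasure d)) := by
  let B := (ContinuousLinearMap.mul ℝ ℝ).holderL (torusMeasure d) (ENNReal.ofReal (squareExp p))
    (ENNReal.ofReal (squareExp p)) (ENNReal.ofReal (dualExp p))
  let Q := (ContinuousLinearMap.mul ℝ ℝ).lpPairing (torusMeasure d) (ENNReal.ofReal (dualExp p))
    (ENNReal.ofReal p)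
  have h1 (a b : Lp ℝ (ENNReal.ofReal (squareExp p)) (torusMeasure d))
      (c : Lp ℝ (ENNReal.ofReal p) (torusMeasure d)) :
      Q (B a b) c = ∫ x, a x * b x * c x ∂torusMeasure d := by
    rw [ContinuousLinearMap.lpPairing_eq_integral]
    refine integral_congr_ae ?_
    filter_upwards [(ContinuousLinearMap.mul ℝ ℝ).coeFn_holder (r := ENNReal.ofReal (dualExp p))
      a b] with x hx
    change ((ContinuousLinearMap.mul ℝ ℝ).holder (ENNReal.ofReal (dualExp p)) a b) x * c x = _
    rw [hx]
    rfl
  simp only [← h1]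
  have h2 : Filter.Tendsto (fun n => B (f n) (f' n)) Filter.atTop (nhds (B f₀ f₀')) :=
    tendsto_clm_apply₂ B hf hf'
  exact tendsto_clm_apply₂ Q h2 hg

/-- A divergence-free field transports skew-symmetrically. -/
theorem integral_transport (hd : 0 < d) (hp : 2 ≤ p) (hdp : 1 + (d : ℝ) / 2 ≤ p)
    (u v w : V d (ENNReal.ofReal p) 1) (i k : Fin d) :
    ∑ j, ((∫ x, V.val j u x * V.val k w x * V.grad j i v x ∂torusMeasure d) +
      ∫ x, V.val j u x * V.val i v x * V.grad j k w x ∂torusMeasure d) = 0 := by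
  have h1 (u : V d (ENNReal.ofReal p) 1) (i : Fin d) := tendsto_trunc_squareExp hd hp hdp i u
  have h2 (u : V d (ENNReal.ofReal p) 1) (j i : Fin d) := tendsto_trunc_partialDeriv hp j i u
  have h3 (u v w : V d (ENNReal.ofReal p) 1) (i j k : Fin d) :=
    tendsto_integral_mul_mul (h1 u j) (h1 w k) (h2 v j i)
  have h4 : Filter.Tendsto _ Filter.atTop (nhds _) :=
    tendsto_finsetSum Finset.univ fun j _ => (h3 u v w i j k).add (h3 u w v k j i)
  have hv (u : V d (ENNReal.ofReal p) 1) (i : Fin d) :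
      valR hd hp hdp i u =ᵐ[torusMeasure d] V.val i u := MemLp.coeFn_toLp _
  have h5 (u v w : V d (ENNReal.ofReal p) 1) (i j k : Fin d) :
      ∫ x, valR hd hp hdp j u x * valR hd hp hdp k w x * V.grad j i v x ∂torusMeasure d =
        ∫ x, V.val j u x * V.val k w x * V.grad j i v x ∂torusMeasure d := by
    refine integral_congr_ae ?_
    filter_upwards [hv u j, hv w k] with x h6 h7
    rw [h6, h7]
  simp only [h5] at h4
  refine tendsto_nhds_unique h4 (tendsto_const_nhds.congr fun N => ?_)
  rw [← integral_transport_testField ((isSolenoidal_coeff 1 u).trunc N)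
    ((isSolenoidal_coeff 1 v).trunc N) ((isSolenoidal_coeff 1 w).trunc N) i k]
  have hi (f : UnitAddTorus (Fin d) → ℝ) (hf : Continuous f) : Integrable f (torusMeasure d) :=
    hf.integrable_of_hasCompactSupport (HasCompactSupport.of_compactSpace _)
  have hc := fun (φ : TestField d) j i => φ.continuous_partialDeriv j i
  have hc' := fun (φ : TestField d) i => φ.continuous_field i
  generalize (isSolenoidal_coeff 1 u).trunc N = φ
  generalize (isSolenoidal_coeff 1 v).trunc N = ψ
  generalize (isSolenoidal_coeff 1 w).trunc N = χ
  have h6 (φ ψ χ : TestField d) (i j k : Fin d) : Continuous fun x =>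
    φ.field x j * χ.field x k * ψ.partialDeriv j i x := ((hc' φ j).mul (hc' χ k)).mul (hc ψ j i)
  refine (integral_finsetSum _ fun j _ =>
    (hi _ (h6 φ ψ χ i j k)).add (hi _ (h6 φ χ ψ k j i))).trans ?_
  refine Finset.sum_congr rfl fun j _ => ?_
  refine (integral_add (hi _ (h6 φ ψ χ i j k)) (hi _ (h6 φ χ ψ k j i))).trans ?_
  have h7 (φ ψ χ : TestField d) (i j k : Fin d) :
      ∫ x, φ.field x j * χ.field x k * ψ.partialDeriv j i x ∂torusMeasure d =
      ∫ x, (memLp_of_continuous (φ.continuous_field j) (ENNReal.ofReal (squareExp p))).toLp _ x *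
        (memLp_of_continuous (χ.continuous_field k) (ENNReal.ofReal (squareExp p))).toLp _ x *
        (memLp_of_continuous (ψ.continuous_partialDeriv j i) (ENNReal.ofReal p)).toLp _ x
        ∂torusMeasure d := by
    refine integral_congr_ae ?_
    filter_upwards [MemLp.coeFn_toLp
        (memLp_of_continuous (φ.continuous_field j) (ENNReal.ofReal (squareExp p))),
      MemLp.coeFn_toLp
        (memLp_of_continuous (χ.continuous_field k) (ENNReal.ofReal (squareExp p))),
      MemLp.coeFn_toLp
        (memLp_of_continuous (ψ.continuous_partialDeriv j i) (ENNReal.ofReal p))] with x a b c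
    rw [a, b, c]
  rw [h7 φ ψ χ i j k, h7 φ χ ψ k j i]

end Transport

/-! ## The stress tensor -/

section Stress

variable {d : ℕ}

/-- The constitutive law `S ↦ 2ν (1 + |S|²)^{(p-2)/2} S`. -/
def stressTensor (ν p : ℝ) (S : Fin d → Fin d → ℝ) (i j : Fin d) : ℝ :=
  2 * ν * (1 + ∑ k, ∑ l, S k l ^ 2) ^ ((p - 2) / 2) * S i j

theorem continuous_stressTensor (ν p : ℝ) (i j : Fin d) :
    Continuous fun S : Fin d → Fin d → ℝ => stressTensor ν p S i j := by
  have h1 : Continuous fun S : Fin d → Fin d → ℝ => 1 + ∑ k, ∑ l, S k l ^ 2 := by fun_prop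
  have h2 : Continuous fun S : Fin d → Fin d → ℝ =>
      (1 + ∑ k, ∑ l, S k l ^ 2) ^ ((p - 2) / 2) := h1.rpow_const fun S => by
    left
    have : 0 ≤ ∑ k, ∑ l, S k l ^ 2 :=
      Finset.sum_nonneg fun _ _ => Finset.sum_nonneg fun _ _ => sq_nonneg _
    linarith
  have h3 : Continuous fun S : Fin d → Fin d → ℝ => S i j := by fun_prop
  exact (continuous_const.mul h2).mul h3

/-- The constitutive law is strongly monotone. -/
theorem stressTensor_monotone {ν p : ℝ} (hν : 0 ≤ ν) (hp : 2 ≤ p) (A B : Fin d → Fin d → ℝ) :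
    2 * ν * ∑ i, ∑ j, (A i j - B i j) ^ 2 ≤
      ∑ i, ∑ j, (stressTensor ν p A i j - stressTensor ν p B i j) * (A i j - B i j) := by
  have hn (A : Fin d → Fin d → ℝ) : 0 ≤ ∑ k, ∑ l, A k l ^ 2 :=
    Finset.sum_nonneg fun _ _ => Finset.sum_nonneg fun _ _ => sq_nonneg _
  have hp2 : 0 ≤ (p - 2) / 2 := by linarith
  set a := ∑ k, ∑ l, A k l ^ 2 with ha
  set b := ∑ k, ∑ l, B k l ^ 2 with hb
  have ha0 : 0 ≤ a := hn A
  have hb0 : 0 ≤ b := hn B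
  set α := (1 + a) ^ ((p - 2) / 2) with hα
  set β := (1 + b) ^ ((p - 2) / 2) with hβ
  have hα1 : 1 ≤ α := Real.one_le_rpow (by linarith) hp2
  have hβ1 : 1 ≤ β := Real.one_le_rpow (by linarith) hp2
  have hm : 0 ≤ (α - β) * (a - b) := by
    rcases le_total a b with h | h
    · have : α ≤ β := Real.rpow_le_rpow (by linarith) (by linarith) hp2
      nlinarith
    · have : β ≤ α := Real.rpow_le_rpow (by linarith) (by linarith) hp2
      nlinarith
  have h1 : ∑ i, ∑ j, (stressTensor ν p A i j - stressTensor ν p B i j) * (A i j - B i j) =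
      ν * (α + β) * ∑ i, ∑ j, (A i j - B i j) ^ 2 + ν * (α - β) * (a - b) := by
    rw [ha, hb, ← Finset.sum_sub_distrib, Finset.mul_sum, Finset.mul_sum, ← Finset.sum_add_distrib]
    refine Finset.sum_congr rfl fun i _ => ?_
    rw [← Finset.sum_sub_distrib, Finset.mul_sum, Finset.mul_sum, ← Finset.sum_add_distrib]
    refine Finset.sum_congr rfl fun j _ => ?_
    simp only [stressTensor, ← ha, ← hb, ← hα, ← hβ]
    ring
  have h2 : 0 ≤ ∑ i, ∑ j, (A i j - B i j) ^ 2 :=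
    Finset.sum_nonneg fun _ _ => Finset.sum_nonneg fun _ _ => sq_nonneg _
  rw [h1, mul_assoc ν (α - β)]
  have h3 : 2 * ν * ∑ i, ∑ j, (A i j - B i j) ^ 2 ≤
      ν * (α + β) * ∑ i, ∑ j, (A i j - B i j) ^ 2 := by
    refine mul_le_mul_of_nonneg_right ?_ h2
    nlinarith
  have := mul_nonneg hν hm
  linarith

end Stress

/-! ## Korn's identity -/

section Korn

variable {d : ℕ} {p : ℝ} [Fact (1 < p)]

theorem korn_pointwise {c : FormalField d} (h : IsSolenoidal c) (z : Fin d → ℤ) :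
    ∑ i, ∑ j, ‖(z i : ℂ) * c z j + (z j : ℂ) * c z i‖ ^ 2 =
      2 * (freqSq z * ∑ i, ‖c z i‖ ^ 2) := by
  refine Complex.ofReal_injective ?_
  push_cast [freqSq]
  simp only [← Complex.mul_conj']
  have hdc : ∑ i, (z i : ℂ) * (starRingEnd ℂ) (c z i) = 0 := by
    have := congrArg (starRingEnd ℂ) (h.div_free z)
    simpa only [map_sum, map_mul, map_intCast, map_zero] using this
  have h1 (i j : Fin d) : ((z i : ℂ) * c z j + (z j : ℂ) * c z i) *
      (starRingEnd ℂ) ((z i : ℂ) * c z j + (z j : ℂ) * c z i) =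
      (z i : ℂ) ^ 2 * (c z j * (starRingEnd ℂ) (c z j)) +
      (z j : ℂ) ^ 2 * (c z i * (starRingEnd ℂ) (c z i)) +
      ((z j : ℂ) * c z j) * ((z i : ℂ) * (starRingEnd ℂ) (c z i)) +
      ((z i : ℂ) * c z i) * ((z j : ℂ) * (starRingEnd ℂ) (c z j)) := by
    simp only [map_add, map_mul, map_intCast]
    ring
  simp only [h1, Finset.sum_add_distrib, ← Finset.mul_sum, ← Finset.sum_mul, hdc, h.div_free]
  ring

theorem integral_sq_strain (hp : 2 ≤ p) (u : V d (ENNReal.ofReal p) 1) :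
    ∑ i, ∑ j, ∫ x, V.strainLp i j u x ^ 2 ∂torusMeasure d = dissipation u / 2 := by
  have h1 : HasSum (fun z => ∑ i, ∑ j, ‖rcoeff z (V.strainLp i j u)‖ ^ 2)
      (∑ i, ∑ j, ∫ x, V.strainLp i j u x ^ 2 ∂torusMeasure d) :=
    hasSum_sum fun i _ => hasSum_sum fun j _ => hasSum_sq_rcoeff hp (V.strainLp i j u)
  have h2 : HasSum (fun z => (∑ i, 4 * Real.pi ^ 2 * (freqSq z * ‖V.coeff 1 u z i‖ ^ 2)) / 2)
      (dissipation u / 2) := (hasSum_sum fun i _ => hasSum_grad hp i u).div_const 2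
  refine h1.unique (h2.congr_fun fun z => ?_)
  have h3 := korn_pointwise (isSolenoidal_coeff 1 u) z
  simp only [rcoeff_strainLp hp, norm_mul, mul_pow, Complex.norm_I, Complex.norm_real,
    Real.norm_eq_abs, sq_abs, mul_one, ← Finset.mul_sum, h3]
  ring

end Korn

/-! ## The momentum flux -/

section Flux

variable {d : ℕ}

theorem add_rpow_le_two_rpow {a b s : ℝ} (ha : 0 ≤ a) (hb : 0 ≤ b) (hs : 0 ≤ s) :
    (a + b) ^ s ≤ 2 ^ s * (a ^ s + b ^ s) := by
  have h0 := Real.rpow_nonneg ha s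
  have h1 := Real.rpow_nonneg hb s
  rcases le_total a b with h | h
  · calc (a + b) ^ s ≤ (2 * b) ^ s := Real.rpow_le_rpow (by linarith) (by linarith) hs
      _ = 2 ^ s * b ^ s := Real.mul_rpow (by norm_num) hb
      _ ≤ _ := by gcongr; linarith
  · calc (a + b) ^ s ≤ (2 * a) ^ s := Real.rpow_le_rpow (by linarith) (by linarith) hs
      _ = 2 ^ s * a ^ s := Real.mul_rpow (by norm_num) ha
      _ ≤ _ := by gcongr; linarith

theorem abs_mul_rpow_le {p : ℝ} [Fact (1 < p)] (a b : ℝ) :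
    |a * b| ^ dualExp p ≤ |a| ^ squareExp p + |b| ^ squareExp p := by
  have hq : 0 ≤ dualExp p := by linarith [one_lt_dualExp p]
  have key (a b : ℝ) (h : |a| ≤ |b|) : |a * b| ^ dualExp p ≤ |b| ^ squareExp p := by
    rw [abs_mul, squareExp, Real.rpow_mul (abs_nonneg b)]
    refine Real.rpow_le_rpow (by positivity) ?_ hq
    rw [Real.rpow_two, sq]
    gcongr
  have h0 := Real.rpow_nonneg (abs_nonneg a) (squareExp p)
  have h1 := Real.rpow_nonneg (abs_nonneg b) (squareExp p)
  rcases le_total |a| |b| with h | h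
  · linarith [key a b h]
  · rw [mul_comm]
    linarith [key b a h]

theorem abs_stressTensor_rpow_le {ν p : ℝ} [Fact (1 < p)] (hν : 0 ≤ ν) (S : Fin d → Fin d → ℝ)
    (i j : Fin d) : |stressTensor ν p S i j| ^ dualExp p ≤
      (2 * ν) ^ dualExp p * (1 + ∑ k, ∑ l, S k l ^ 2) ^ (p / 2) := by
  have hq : 0 ≤ dualExp p := by linarith [one_lt_dualExp p]
  have hn : 0 ≤ ∑ k, ∑ l, S k l ^ 2 :=
    Finset.sum_nonneg fun _ _ => Finset.sum_nonneg fun _ _ => sq_nonneg _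
  set W := 1 + ∑ k, ∑ l, S k l ^ 2 with hW
  have hW1 : 0 < W := by linarith
  have h1 : S i j ^ 2 ≤ W := by
    have h2 : S i j ^ 2 ≤ ∑ l, S i l ^ 2 := Finset.single_le_sum (f := fun l => S i l ^ 2)
      (fun _ _ => sq_nonneg _) (Finset.mem_univ j)
    have h3 : ∑ l, S i l ^ 2 ≤ ∑ k, ∑ l, S k l ^ 2 :=
      Finset.single_le_sum (f := fun k => ∑ l, S k l ^ 2)
        (fun _ _ => Finset.sum_nonneg fun _ _ => sq_nonneg _) (Finset.mem_univ i)
    linarith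
  have h2 : |S i j| ≤ W ^ (1 / 2 : ℝ) := by
    rw [← Real.sqrt_eq_rpow]
    exact Real.abs_le_sqrt h1
  have h3 : |stressTensor ν p S i j| ≤ 2 * ν * W ^ ((p - 1) / 2) := by
    have h4 : W ^ ((p - 1) / 2) = W ^ ((p - 2) / 2) * W ^ (1 / 2 : ℝ) := by
      rw [← Real.rpow_add hW1]
      congr 1
      ring
    have h5 := Real.rpow_nonneg hW1.le ((p - 2) / 2)
    rw [stressTensor, ← hW, abs_mul, abs_of_nonneg (by positivity), h4, ← mul_assoc]
    gcongr
  have hp1 : p - 1 ≠ 0 := (holderConjugate_dualExp p).sub_one_ne_zero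
  calc |stressTensor ν p S i j| ^ dualExp p ≤ (2 * ν * W ^ ((p - 1) / 2)) ^ dualExp p :=
        Real.rpow_le_rpow (abs_nonneg _) h3 hq
    _ = _ := by
      rw [Real.mul_rpow (by positivity) (by positivity), ← Real.rpow_mul hW1.le]
      congr 2
      unfold dualExp
      field_simp

theorem sum_sq_rpow_le {p : ℝ} (hp : 2 ≤ p) (S : Fin d → Fin d → ℝ) :
    (1 + ∑ k, ∑ l, S k l ^ 2) ^ (p / 2) ≤
      2 ^ (p / 2) * (1 + ((d : ℝ) ^ (p / 2 - 1)) ^ 2 * ∑ k, ∑ l, |S k l| ^ p) := by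
  have hp2 : 1 ≤ p / 2 := by linarith
  have hn : 0 ≤ ∑ k, ∑ l, S k l ^ 2 :=
    Finset.sum_nonneg fun _ _ => Finset.sum_nonneg fun _ _ => sq_nonneg _
  refine (add_rpow_le_two_rpow zero_le_one hn (by linarith)).trans ?_
  rw [Real.one_rpow]
  gcongr
  have h1 (f : Fin d → ℝ) (hf : ∀ i, 0 ≤ f i) :
      (∑ i, f i) ^ (p / 2) ≤ (d : ℝ) ^ (p / 2 - 1) * ∑ i, f i ^ (p / 2) := by
    have := Real.rpow_sum_le_const_mul_sum_rpow_of_nonneg Finset.univ hp2 fun i _ => hf i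
    simpa using this
  refine (h1 _ fun k => Finset.sum_nonneg fun _ _ => sq_nonneg _).trans ?_
  have h2 (k : Fin d) : (∑ l, S k l ^ 2) ^ (p / 2) ≤
      (d : ℝ) ^ (p / 2 - 1) * ∑ l, |S k l| ^ p := by
    refine (h1 _ fun l => sq_nonneg _).trans_eq ?_
    congr 1
    refine Finset.sum_congr rfl fun l _ => ?_
    rw [← sq_abs, ← Real.rpow_natCast, ← Real.rpow_mul (abs_nonneg _)]
    congr 1
    push_cast
    ring
  calc _ ≤ (d : ℝ) ^ (p / 2 - 1) * ∑ k, (d : ℝ) ^ (p / 2 - 1) * ∑ l, |S k l| ^ p :=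
        mul_le_mul_of_nonneg_left (Finset.sum_le_sum fun k _ => h2 k) (by positivity)
    _ = _ := by rw [← Finset.mul_sum]; ring

theorem measurable_Lp {p : ℝ} (f : Lp ℝ (ENNReal.ofReal p) (torusMeasure d)) : Measurable f :=
  (Lp.stronglyMeasurable f).measurable

variable {p : ℝ} [Fact (1 < p)]

theorem integrable_Lp_rpow (f : Lp ℝ (ENNReal.ofReal p) (torusMeasure d)) :
    Integrable (fun x => |f x| ^ p) (torusMeasure d) := by
  have hp : 0 < p := one_pos.trans Fact.out
  have := (Lp.memLp f).integrable_norm_rpow (by simpa using hp) ENNReal.ofReal_ne_top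
  rwa [ENNReal.toReal_ofReal hp.le] at this

theorem integral_Lp_rpow (f : Lp ℝ (ENNReal.ofReal p) (torusMeasure d)) :
    ∫ x, |f x| ^ p ∂torusMeasure d = ‖f‖ ^ p := by
  have hp : 0 < p := one_pos.trans Fact.out
  rw [Lp.norm_def, toReal_eLpNorm (Lp.aestronglyMeasurable _),
    lpNorm_eq_integral_norm_rpow_toReal (by simpa using hp) ENNReal.ofReal_ne_top
    (Lp.aestronglyMeasurable _), ENNReal.toReal_ofReal hp.le,
    Real.rpow_inv_rpow (integral_nonneg fun x => by positivity) hp.ne']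
  rfl

theorem integral_Lp_sq_le (hp : 2 ≤ p) (f : Lp ℝ (ENNReal.ofReal p) (torusMeasure d)) :
    ∫ x, f x ^ 2 ∂torusMeasure d ≤ 1 + ‖f‖ ^ p := by
  rw [← integral_Lp_rpow]
  have hi := integrable_Lp_rpow f
  have h1 : 1 + ∫ x, |f x| ^ p ∂torusMeasure d = ∫ x, 1 + |f x| ^ p ∂torusMeasure d := by
    rw [integral_add (integrable_const _) hi]
    simp
  rw [h1]
  refine integral_mono (memLp_two_Lp hp f).integrable_sq ((integrable_const _).add hi) fun x => ?_
  change f x ^ 2 ≤ 1 + |f x| ^ p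
  have h0 := Real.rpow_nonneg (abs_nonneg (f x)) p
  rcases le_total |f x| 1 with h | h
  · rw [← sq_abs]
    nlinarith [abs_nonneg (f x)]
  · have := Real.rpow_le_rpow_of_exponent_le h hp
    rw [Real.rpow_two, sq_abs] at this
    linarith

theorem norm_rpow_le (hp : 2 ≤ p) {u : V d (ENNReal.ofReal p) 1}
    {f : Lp ℝ (ENNReal.ofReal p) (torusMeasure d)} (h : ‖f‖ ≤ besselNorm d p * ‖u‖) :
    ‖f‖ ^ p ≤ besselNorm d p ^ p * ‖u‖ ^ p := by
  rw [← Real.mul_rpow (besselNorm_nonneg d p) (norm_nonneg _)]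
  exact Real.rpow_le_rpow (norm_nonneg _) h (by linarith)

theorem dissipation_le (hp : 2 ≤ p) (u : V d (ENNReal.ofReal p) 1) :
    dissipation u ≤ d * (d * (1 + besselNorm d p ^ p * ‖u‖ ^ p)) := by
  have h1 (j i : Fin d) : ∫ x, V.grad j i u x ^ 2 ∂torusMeasure d ≤
      1 + besselNorm d p ^ p * ‖u‖ ^ p :=
    (integral_Lp_sq_le hp _).trans (by gcongr; exact norm_rpow_le hp (norm_grad_le hp j i u))
  calc dissipation u ≤ ∑ _i : Fin d, ∑ _j : Fin d, (1 + besselNorm d p ^ p * ‖u‖ ^ p) :=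
        Finset.sum_le_sum fun i _ => Finset.sum_le_sum fun j _ => h1 j i
    _ = _ := by simp only [Finset.sum_const, Finset.card_univ, Fintype.card_fin, nsmul_eq_mul]

theorem norm_strainLp_le (hp : 2 ≤ p) (i j : Fin d) (u : V d (ENNReal.ofReal p) 1) :
    ‖V.strainLp i j u‖ ≤ besselNorm d p * ‖u‖ := by
  have h1 : V.strainLp i j u = (2⁻¹ : ℝ) • (V.grad i j u + V.grad j i u) := rfl
  have h2 := norm_add_le (V.grad i j u) (V.grad j i u)
  have h3 := norm_grad_le hp i j u
  have h4 := norm_grad_le hp j i u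
  rw [h1, norm_smul, Real.norm_of_nonneg (by norm_num)]
  linarith

/-- The momentum flux `v ⊗ v - τ(v)`. -/
def flux (ν : ℝ) (u : V d (ENNReal.ofReal p) 1) (i j : Fin d) (x : UnitAddTorus (Fin d)) : ℝ :=
  V.val i u x * V.val j u x - stressTensor ν p (fun k l => V.strainLp k l u x) i j

theorem measurable_strain (u : V d (ENNReal.ofReal p) 1) :
    Measurable fun x => fun k l => V.strainLp k l u x :=
  measurable_pi_iff.mpr fun _ => measurable_pi_iff.mpr fun _ => measurable_Lp _

theorem measurable_stress (ν : ℝ) (u : V d (ENNReal.ofReal p) 1) (i j : Fin d) :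
    Measurable fun x => stressTensor ν p (fun k l => V.strainLp k l u x) i j := by
  have h := (continuous_stressTensor (d := d) ν p i j).measurable.comp (measurable_strain u)
  exact h

theorem measurable_flux (ν : ℝ) (u : V d (ENNReal.ofReal p) 1) (i j : Fin d) :
    Measurable (flux ν u i j) :=
  ((measurable_Lp _).mul (measurable_Lp _)).sub (measurable_stress ν u i j)

theorem integrable_strain_rpow (hp : 2 ≤ p) (u : V d (ENNReal.ofReal p) 1) :
    Integrable (fun x => (1 + ∑ k, ∑ l, V.strainLp k l u x ^ 2) ^ (p / 2)) (torusMeasure d) ∧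
    ∫ x, (1 + ∑ k, ∑ l, V.strainLp k l u x ^ 2) ^ (p / 2) ∂torusMeasure d ≤
      2 ^ (p / 2) * (1 + ((d : ℝ) ^ (p / 2 - 1)) ^ 2 *
        (d * (d * (besselNorm d p ^ p * ‖u‖ ^ p)))) := by
  have hi : Integrable (fun x => 2 ^ (p / 2) * (1 + ((d : ℝ) ^ (p / 2 - 1)) ^ 2 *
      ∑ k, ∑ l, |V.strainLp k l u x| ^ p)) (torusMeasure d) := by
    refine Integrable.const_mul (Integrable.add (integrable_const _) (Integrable.const_mul ?_ _)) _
    exact integrable_finsetSum _ fun k _ => integrable_finsetSum _ fun l _ => integrable_Lp_rpow _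
  have hn (x) : 0 ≤ ∑ k, ∑ l, V.strainLp k l u x ^ 2 :=
    Finset.sum_nonneg fun _ _ => Finset.sum_nonneg fun _ _ => sq_nonneg _
  have hm : Measurable fun x => (1 + ∑ k, ∑ l, V.strainLp k l u x ^ 2) ^ (p / 2) := by
    refine Measurable.pow_const (measurable_const.add ?_) _
    exact Finset.measurable_fun_sum _ fun k _ => Finset.measurable_fun_sum _ fun l _ =>
      (measurable_Lp _).pow_const 2
  have hI : Integrable (fun x => (1 + ∑ k, ∑ l, V.strainLp k l u x ^ 2) ^ (p / 2))
      (torusMeasure d) := by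
    refine hi.mono' hm.aestronglyMeasurable (.of_forall fun x => ?_)
    have := hn x
    rw [Real.norm_of_nonneg (by positivity)]
    exact sum_sq_rpow_le hp _
  refine ⟨hI, (integral_mono hI hi fun x => sum_sq_rpow_le hp _).trans ?_⟩
  have hS (k l : Fin d) := integrable_Lp_rpow (V.strainLp k l u)
  have hS2 : Integrable (fun x => ∑ k, ∑ l, |V.strainLp k l u x| ^ p) (torusMeasure d) :=
    integrable_finsetSum _ fun k _ => integrable_finsetSum _ fun l _ => hS k l
  rw [integral_const_mul, integral_add (integrable_const _) (hS2.const_mul _), integral_const_mul,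
    integral_finsetSum _ fun k _ => integrable_finsetSum _ fun l _ => hS k l]
  have h2 : ∑ k, ∫ x, ∑ l, |V.strainLp k l u x| ^ p ∂torusMeasure d ≤
      d * (d * (besselNorm d p ^ p * ‖u‖ ^ p)) := by
    calc _ = ∑ k, ∑ l, ‖V.strainLp k l u‖ ^ p := by
          refine Finset.sum_congr rfl fun k _ => ?_
          rw [integral_finsetSum _ fun l _ => hS k l]
          exact Finset.sum_congr rfl fun l _ => integral_Lp_rpow _
      _ ≤ ∑ _k : Fin d, ∑ _l : Fin d, (besselNorm d p ^ p * ‖u‖ ^ p) :=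
        Finset.sum_le_sum fun k _ => Finset.sum_le_sum fun l _ =>
          norm_rpow_le hp (norm_strainLp_le hp k l u)
      _ = _ := by simp
  simp only [integral_const, probReal_univ, one_smul]
  gcongr

theorem abs_flux_rpow_le {ν : ℝ} (hν : 0 ≤ ν) (u : V d (ENNReal.ofReal p) 1)
    (i j : Fin d) (x : UnitAddTorus (Fin d)) : |flux ν u i j x| ^ dualExp p ≤
      2 ^ dualExp p * ((|V.val i u x| ^ squareExp p + |V.val j u x| ^ squareExp p) +
        (2 * ν) ^ dualExp p * (1 + ∑ k, ∑ l, V.strainLp k l u x ^ 2) ^ (p / 2)) := by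
  have hq : 0 ≤ dualExp p := by linarith [one_lt_dualExp p]
  refine (Real.rpow_le_rpow (abs_nonneg _) (abs_sub _ _) hq).trans ?_
  refine (add_rpow_le_two_rpow (abs_nonneg _) (abs_nonneg _) hq).trans ?_
  gcongr
  · exact abs_mul_rpow_le _ _
  · exact abs_stressTensor_rpow_le hν _ i j

theorem integrable_flux_rpow (hd : 0 < d) (hp : 2 ≤ p) (hdp : 1 + (d : ℝ) / 2 ≤ p)
    {ν : ℝ} (hν : 0 ≤ ν) (u : V d (ENNReal.ofReal p) 1) (i j : Fin d) :
    Integrable (fun x => |flux ν u i j x| ^ dualExp p) (torusMeasure d) := by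
  have hv (i : Fin d) := integrable_val_rpow hd hp hdp i u
  have hi := ((((hv i).add (hv j)).add
    ((integrable_strain_rpow hp u).1.const_mul ((2 * ν) ^ dualExp p)))).const_mul (2 ^ dualExp p)
  refine hi.mono' ((measurable_flux ν u i j).norm.pow_const _).aestronglyMeasurable
    (.of_forall fun x => ?_)
  rw [Real.norm_of_nonneg (by positivity)]
  exact abs_flux_rpow_le hν u i j x

theorem integral_flux_rpow_le (hd : 0 < d) (hp : 2 ≤ p) (hdp : 1 + (d : ℝ) / 2 ≤ p)
    {ν : ℝ} (hν : 0 ≤ ν) : ∃ C : ℝ, 0 ≤ C ∧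
    ∀ (u : V d (ENNReal.ofReal p) 1) (i j : Fin d),
      ∫ x, |flux ν u i j x| ^ dualExp p ∂torusMeasure d ≤
        C * ((1 + ‖u‖ ^ p) * (1 + √(energy u) ^ (squareExp p - 2))) := by
  set β := besselNorm d p ^ p with hβ
  have hβ0 : 0 ≤ β := Real.rpow_nonneg (besselNorm_nonneg d p) _
  set K := gnConst (squareExp p) with hK
  have hK0 : 0 ≤ K := gnConst_nonneg p
  set c₁ : ℝ := 2 * (K * (d * (d * (1 + β)))) with hc₁
  set c₂ : ℝ := (2 * ν) ^ dualExp p *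
    (2 ^ (p / 2) * (1 + ((d : ℝ) ^ (p / 2 - 1)) ^ 2 * (d * (d * β)))) with hc₂
  have hc₁0 : 0 ≤ c₁ := by positivity
  have hc₂0 : 0 ≤ c₂ := by positivity
  refine ⟨2 ^ dualExp p * (c₁ + c₂), by positivity, fun u i j => ?_⟩
  have hv (i : Fin d) := integrable_val_rpow hd hp hdp i u
  have hS := (integrable_strain_rpow hp u).1.const_mul ((2 * ν) ^ dualExp p)
  have hi := (((hv i).add (hv j)).add hS).const_mul (2 ^ dualExp p)
  refine (integral_mono (integrable_flux_rpow hd hp hdp hν u i j) hi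
    fun x => abs_flux_rpow_le hν u i j x).trans ?_
  have e1 : ∫ x, 2 ^ dualExp p * (((fun x => |V.val i u x| ^ squareExp p) +
      (fun x => |V.val j u x| ^ squareExp p) + fun x => (2 * ν) ^ dualExp p *
        (1 + ∑ k, ∑ l, V.strainLp k l u x ^ 2) ^ (p / 2)) x) ∂torusMeasure d =
      2 ^ dualExp p * ((∫ x, |V.val i u x| ^ squareExp p ∂torusMeasure d) +
        (∫ x, |V.val j u x| ^ squareExp p ∂torusMeasure d) + (2 * ν) ^ dualExp p *
        ∫ x, (1 + ∑ k, ∑ l, V.strainLp k l u x ^ 2) ^ (p / 2) ∂torusMeasure d) := by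
    rw [integral_const_mul, integral_add' ((hv i).add (hv j)) hS, integral_add' (hv i) (hv j),
      integral_const_mul]
  refine e1.trans_le ?_
  set E := √(energy u) ^ (squareExp p - 2) with hE
  have hE0 : 0 ≤ E := Real.rpow_nonneg (Real.sqrt_nonneg _) _
  set n := ‖u‖ ^ p with hn
  have hn0 : 0 ≤ n := Real.rpow_nonneg (norm_nonneg _) _
  have b1 (i : Fin d) : ∫ x, |V.val i u x| ^ squareExp p ∂torusMeasure d ≤
      c₁ / 2 * ((1 + n) * (1 + E)) := by
    refine (integral_val_rpow_le hd hp hdp i u).trans ?_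
    calc K * E * dissipation u ≤ K * E * (d * (d * (1 + β * n))) := by
          gcongr
          exact dissipation_le hp u
      _ ≤ K * (1 + E) * (d * (d * ((1 + β) * (1 + n)))) := by
          gcongr
          · linarith
          · nlinarith
      _ = _ := by rw [hc₁]; ring
  have b2 : (2 * ν) ^ dualExp p *
      ∫ x, (1 + ∑ k, ∑ l, V.strainLp k l u x ^ 2) ^ (p / 2) ∂torusMeasure d ≤
        c₂ * ((1 + n) * (1 + E)) := by
    calc _ ≤ (2 * ν) ^ dualExp p * (2 ^ (p / 2) * (1 + ((d : ℝ) ^ (p / 2 - 1)) ^ 2 *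
        (d * (d * (β * n))))) := by
          gcongr
          exact (integrable_strain_rpow hp u).2
      _ ≤ (2 * ν) ^ dualExp p * (2 ^ (p / 2) * ((1 + ((d : ℝ) ^ (p / 2 - 1)) ^ 2 *
        (d * (d * β))) * (1 + n))) := by
          gcongr
          have : 0 ≤ ((d : ℝ) ^ (p / 2 - 1)) ^ 2 * (d * (d * β)) := by positivity
          nlinarith
      _ = c₂ * (1 + n) := by rw [hc₂]; ring
      _ ≤ _ := by
          gcongr
          nlinarith
  calc _ ≤ 2 ^ dualExp p * (c₁ / 2 * ((1 + n) * (1 + E)) + c₁ / 2 * ((1 + n) * (1 + E)) +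
        c₂ * ((1 + n) * (1 + E))) := by
        gcongr
        · exact b1 i
        · exact b1 j
    _ = _ := by ring

theorem memLp_flux (hd : 0 < d) (hp : 2 ≤ p) (hdp : 1 + (d : ℝ) / 2 ≤ p)
    {ν : ℝ} (hν : 0 ≤ ν) (u : V d (ENNReal.ofReal p) 1) (i j : Fin d) :
    MemLp (flux ν u i j) (ENNReal.ofReal (dualExp p)) (torusMeasure d) := by
  have hq : 0 < dualExp p := by linarith [one_lt_dualExp p]
  rw [← integrable_norm_rpow_iff (measurable_flux ν u i j).aestronglyMeasurable
    (by simpa using hq) ENNReal.ofReal_ne_top, ENNReal.toReal_ofReal hq.le]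
  exact integrable_flux_rpow hd hp hdp hν u i j

end Flux

/-! ## The drift in terms of the flux -/

section Drift

variable {d : ℕ}

theorem integral_sum_sum {f : Fin d → Fin d → UnitAddTorus (Fin d) → ℝ}
    (h : ∀ i j, Integrable (f i j) (torusMeasure d)) :
    ∫ x, ∑ i, ∑ j, f i j x ∂torusMeasure d = ∑ i, ∑ j, ∫ x, f i j x ∂torusMeasure d := by
  rw [integral_finsetSum _ fun i _ => integrable_finsetSum _ fun j _ => h i j]
  exact Finset.sum_congr rfl fun i _ => integral_finsetSum _ fun j _ => h i j

theorem stressTensor_symm {ν p : ℝ} {S : Fin d → Fin d → ℝ} (h : ∀ i j, S i j = S j i)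
    (i j : Fin d) : stressTensor ν p S i j = stressTensor ν p S j i := by
  rw [stressTensor, stressTensor, h i j]

theorem sum_symm_mul {T : Fin d → Fin d → ℝ} (h : ∀ i j, T i j = T j i) (g : Fin d → Fin d → ℝ) :
    ∑ i, ∑ j, T i j * ((g i j + g j i) / 2) = ∑ i, ∑ j, T i j * g i j := by
  have h1 : ∑ i, ∑ j, T i j * g j i = ∑ i, ∑ j, T i j * g i j := by
    rw [Finset.sum_comm]
    exact Finset.sum_congr rfl fun i _ => Finset.sum_congr rfl fun j _ => by rw [h]
  have h2 : ∑ i, ∑ j, T i j * ((g i j + g j i) / 2) =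
      (∑ i, ∑ j, T i j * g i j + ∑ i, ∑ j, T i j * g j i) / 2 := by
    simp only [← Finset.sum_add_distrib, Finset.sum_div]
    exact Finset.sum_congr rfl fun i _ => Finset.sum_congr rfl fun j _ => by ring
  rw [h2, h1]
  ring

variable {p : ℝ} [Fact (1 < p)]

theorem strainLp_symm (i j : Fin d) (u : V d (ENNReal.ofReal p) 1) :
    V.strainLp i j u = V.strainLp j i u := by
  have h (i j : Fin d) : V.strainLp i j u = (2⁻¹ : ℝ) • (V.grad i j u + V.grad j i u) := rfl
  rw [h, h, add_comm]

theorem integrable_mul_Lp {m : UnitAddTorus (Fin d) → ℝ}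
    (hm : MemLp m (ENNReal.ofReal (dualExp p)) (torusMeasure d))
    {f : UnitAddTorus (Fin d) → ℝ} (hf : MemLp f (ENNReal.ofReal p) (torusMeasure d)) :
    Integrable (fun x => m x * f x) (torusMeasure d) :=
  hm.integrable_mul hf

theorem memLp_val_mul_val (hd : 0 < d) (hp : 2 ≤ p) (hdp : 1 + (d : ℝ) / 2 ≤ p)
    (i j : Fin d) (u v : V d (ENNReal.ofReal p) 1) :
    MemLp (fun x => V.val i u x * V.val j v x) (ENNReal.ofReal (dualExp p)) (torusMeasure d) :=
  (memLp_val hd hp hdp j v).mul (memLp_val hd hp hdp i u)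

theorem memLp_stress (hd : 0 < d) (hp : 2 ≤ p) (hdp : 1 + (d : ℝ) / 2 ≤ p) {ν : ℝ} (hν : 0 ≤ ν)
    (u : V d (ENNReal.ofReal p) 1) (i j : Fin d) :
    MemLp (fun x => stressTensor ν p (fun k l => V.strainLp k l u x) i j)
      (ENNReal.ofReal (dualExp p)) (torusMeasure d) := by
  have h := (memLp_val_mul_val hd hp hdp i j u u).sub (memLp_flux hd hp hdp hν u i j)
  refine h.ae_eq (.of_forall fun x => ?_)
  simp [flux]

theorem drift_eq (hd : 0 < d) (hp : 2 ≤ p) (hdp : 1 + (d : ℝ) / 2 ≤ p) {ν : ℝ} (hν : 0 ≤ ν)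
    (u : V d (ENNReal.ofReal p) 1) (φ : TestField d) : drift ν p (V.coeff 1 u) φ =
      ∑ i, ∑ j, ∫ x, flux ν u i j x * φ.partialDeriv j i x ∂torusMeasure d := by
  have hφ (j i : Fin d) : MemLp (φ.partialDeriv j i) (ENNReal.ofReal p) (torusMeasure d) :=
    memLp_of_continuous (φ.continuous_partialDeriv j i) _
  have h1 (i j : Fin d) := integrable_mul_Lp (memLp_val_mul_val hd hp hdp i j u u) (hφ j i)
  have h2 (i j : Fin d) := integrable_mul_Lp (memLp_stress hd hp hdp hν u i j) (hφ j i)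
  have hS : ∀ᵐ x ∂torusMeasure d, ∀ i j, strain (V.coeff 1 u) i j x = V.strainLp i j u x :=
    ae_all_iff.mpr fun i => ae_all_iff.mpr fun j => strain_ae_eq hp i j u
  have hv : ∀ᵐ x ∂torusMeasure d, ∀ i, component (V.coeff 1 u) i x = V.val i u x :=
    ae_all_iff.mpr fun i => component_ae_eq hp i u
  have e1 : ∫ x, ∑ i, ∑ j, component (V.coeff 1 u) i x * (component (V.coeff 1 u) j x *
      φ.partialDeriv j i x) ∂torusMeasure d =
      ∫ x, ∑ i, ∑ j, V.val i u x * V.val j u x * φ.partialDeriv j i x ∂torusMeasure d := by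
    refine integral_congr_ae ?_
    filter_upwards [hv] with x hx
    simp only [hx, mul_assoc]
  have e2 : ∫ x, ∑ i, ∑ j, (φ.partialDeriv i j x + φ.partialDeriv j i x) / 2 *
      stress ν p (V.coeff 1 u) i j x ∂torusMeasure d = ∫ x, ∑ i, ∑ j,
        stressTensor ν p (fun k l => V.strainLp k l u x) i j * φ.partialDeriv j i x
        ∂torusMeasure d := by
    refine integral_congr_ae ?_
    filter_upwards [hS] with x hx
    have h3 (i j : Fin d) : stress ν p (V.coeff 1 u) i j x =
        stressTensor ν p (fun k l => V.strainLp k l u x) i j := by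
      simp only [stress, stressTensor, hx]
    have h4 := sum_symm_mul (stressTensor_symm (ν := ν) (p := p)
      (S := fun k l => V.strainLp k l u x) fun i j => by rw [strainLp_symm])
      (fun i j => φ.partialDeriv j i x)
    rw [← h4]
    refine Finset.sum_congr rfl fun i _ => Finset.sum_congr rfl fun j _ => ?_
    rw [h3]
    ring
  rw [drift, e1, e2, integral_sum_sum h1, integral_sum_sum h2, ← Finset.sum_sub_distrib]
  refine Finset.sum_congr rfl fun i _ => ?_
  rw [← Finset.sum_sub_distrib]
  refine Finset.sum_congr rfl fun j _ => ?_
  rw [← integral_sub (h1 i j) (h2 i j)]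
  refine integral_congr_ae (.of_forall fun x => ?_)
  simp only [flux]
  ring

theorem abs_mul_le_rpow (a b : ℝ) : |a * b| ≤ |a| ^ dualExp p + |b| ^ p := by
  have h := (holderConjugate_dualExp p).symm
  have h1 := Real.young_inequality_of_nonneg (abs_nonneg a) (abs_nonneg b) h
  rw [abs_mul]
  refine h1.trans (add_le_add ?_ ?_)
  · exact div_le_self (by positivity) h.lt.le
  · exact div_le_self (by positivity) h.symm.lt.le

theorem abs_drift_le (hd : 0 < d) (hp : 2 ≤ p) (hdp : 1 + (d : ℝ) / 2 ≤ p) {ν : ℝ} (hν : 0 ≤ ν)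
    (u : V d (ENNReal.ofReal p) 1) (φ : TestField d) : |drift ν p (V.coeff 1 u) φ| ≤
      ∑ i, ∑ j, ((∫ x, |flux ν u i j x| ^ dualExp p ∂torusMeasure d) +
        ∫ x, |φ.partialDeriv j i x| ^ p ∂torusMeasure d) := by
  have hφ (j i : Fin d) : Continuous fun x => |φ.partialDeriv j i x| ^ p :=
    (φ.continuous_partialDeriv j i).abs.rpow_const fun x => Or.inr (by linarith)
  have hφi (j i : Fin d) : Integrable (fun x => |φ.partialDeriv j i x| ^ p) (torusMeasure d) :=
    (hφ j i).integrable_of_hasCompactSupport (HasCompactSupport.of_compactSpace _)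
  rw [drift_eq hd hp hdp hν]
  refine (Finset.abs_sum_le_sum_abs _ _).trans (Finset.sum_le_sum fun i _ => ?_)
  refine (Finset.abs_sum_le_sum_abs _ _).trans (Finset.sum_le_sum fun j _ => ?_)
  have hi := integrable_flux_rpow hd hp hdp hν u i j
  rw [← integral_add hi (hφi j i)]
  refine abs_integral_le_integral_abs.trans (integral_mono ?_ (hi.add (hφi j i)) fun x => ?_)
  · exact (integrable_mul_Lp (memLp_flux hd hp hdp hν u i j)
      (memLp_of_continuous (φ.continuous_partialDeriv j i) _)).abs
  · exact abs_mul_le_rpow _ _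

theorem integral_trunc_partialDeriv_le (hp : 2 ≤ p) (u : V d (ENNReal.ofReal p) 1) (N : ℕ)
    (j i : Fin d) :
    ∫ x, |((isSolenoidal_coeff 1 u).trunc N).partialDeriv j i x| ^ p ∂torusMeasure d ≤
      (cubeNorm d p * besselNorm d p) ^ p * ‖u‖ ^ p := by
  have h1 : ∫ x, |((isSolenoidal_coeff 1 u).trunc N).partialDeriv j i x| ^ p ∂torusMeasure d =
      ∫ x, |realMulOp (ENNReal.ofReal p) (cubeSymbol N) (V.grad j i u) x| ^ p ∂torusMeasure d := by
    refine integral_congr_ae ?_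
    filter_upwards [trunc_partialDeriv_ae_eq hp u N j i] with x hx
    rw [hx]
  have hc := cubeNorm_nonneg d p
  have hb := besselNorm_nonneg d p
  rw [h1, integral_Lp_rpow, ← Real.mul_rpow (by positivity) (norm_nonneg _), mul_assoc]
  refine Real.rpow_le_rpow (norm_nonneg _) ?_ (by linarith)
  refine (norm_realMulOp_le ENNReal.ofReal_ne_top (isMultiplier_cubeSymbol hp N) _).trans ?_
  exact mul_le_mul_of_nonneg_left (norm_grad_le hp j i u) hc

/-- The pairing of the flux of `u` with the gradient of `w`. -/
def production (ν : ℝ) (u w : V d (ENNReal.ofReal p) 1) : ℝ :=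
  ∑ i, ∑ j, ∫ x, flux ν u i j x * V.grad j i w x ∂torusMeasure d

theorem tendsto_drift_trunc (hd : 0 < d) (hp : 2 ≤ p) (hdp : 1 + (d : ℝ) / 2 ≤ p) {ν : ℝ}
    (hν : 0 ≤ ν) (u w : V d (ENNReal.ofReal p) 1) :
    Filter.Tendsto (fun N => drift ν p (V.coeff 1 u) ((isSolenoidal_coeff 1 w).trunc N))
      Filter.atTop (nhds (production ν u w)) := by
  simp only [drift_eq hd hp hdp hν]
  refine tendsto_finsetSum _ fun i _ => tendsto_finsetSum _ fun j _ => ?_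
  let Q := (ContinuousLinearMap.mul ℝ ℝ).lpPairing (torusMeasure d) (ENNReal.ofReal (dualExp p))
    (ENNReal.ofReal p)
  let F := (memLp_flux hd hp hdp hν u i j).toLp _
  have hF : F =ᵐ[torusMeasure d] flux ν u i j := MemLp.coeFn_toLp _
  have h1 (c : Lp ℝ (ENNReal.ofReal p) (torusMeasure d)) :
      Q F c = ∫ x, flux ν u i j x * c x ∂torusMeasure d := by
    rw [ContinuousLinearMap.lpPairing_eq_integral]
    refine integral_congr_ae ?_
    filter_upwards [hF] with x hx
    rw [hx]
    rfl
  have h2 := ((Q F).continuous.tendsto _).comp (tendsto_trunc_partialDeriv hp j i w)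
  rw [h1] at h2
  refine h2.congr fun N => ?_
  refine (h1 _).trans (integral_congr_ae ?_)
  filter_upwards [MemLp.coeFn_toLp (memLp_of_continuous
    (((isSolenoidal_coeff 1 w).trunc N).continuous_partialDeriv j i) (ENNReal.ofReal p))] with x hx
  rw [hx]

end Drift

/-! ## The energy inequality for differences -/

section Difference

variable {d : ℕ}

theorem flux_difference_le {ν p : ℝ} (hν : 0 ≤ ν) (hp : 2 ≤ p) (v v' : Fin d → ℝ)
    (g S S' : Fin d → Fin d → ℝ) (hS : ∀ i j, S i j = S j i) (hS' : ∀ i j, S' i j = S' j i)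
    (hg : ∀ i j, S i j - S' i j = (g i j + g j i) / 2) :
    ∑ i, ∑ j, ((v i * v j - stressTensor ν p S i j) * g i j -
        (v' i * v' j - stressTensor ν p S' i j) * g i j) ≤
      ∑ i, ∑ j, ((v j * (v i - v' i) * g i j + (v j - v' j) * v' i * g i j) -
        2 * ν * (S i j - S' i j) ^ 2) := by
  have h1 := stressTensor_monotone hν hp S S'
  have h2 := sum_symm_mul (T := fun i j => stressTensor ν p S i j - stressTensor ν p S' i j)
    (fun i j => by rw [stressTensor_symm hS, stressTensor_symm hS']) g
  simp only [← hg] at h2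
  rw [h2] at h1
  have h3 : ∑ i, ∑ j, ((v i * v j - stressTensor ν p S i j) * g i j -
        (v' i * v' j - stressTensor ν p S' i j) * g i j) =
      (∑ i, ∑ j, (v j * (v i - v' i) * g i j + (v j - v' j) * v' i * g i j)) -
        ∑ i, ∑ j, (stressTensor ν p S i j - stressTensor ν p S' i j) * g i j := by
    simp only [← Finset.sum_sub_distrib]
    exact Finset.sum_congr rfl fun i _ => Finset.sum_congr rfl fun j _ => by ring
  rw [h3]
  simp only [Finset.sum_sub_distrib (f := fun j => v j * _ * _ + _), ← Finset.mul_sum]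
  rw [Finset.sum_sub_distrib, ← Finset.mul_sum]
  linarith

variable {p : ℝ} [Fact (1 < p)]

theorem production_sub_le (hd : 0 < d) (hp : 2 ≤ p) (hdp : 1 + (d : ℝ) / 2 ≤ p) {ν : ℝ}
    (hν : 0 ≤ ν) (u u' : V d (ENNReal.ofReal p) 1) :
    production ν u (u - u') - production ν u' (u - u') ≤
      -(∑ i, ∑ j, ∫ x, V.val j (u - u') x * V.val i (u - u') x * V.grad j i u' x
        ∂torusMeasure d) - ν * dissipation (u - u') := by
  set w := u - u' with hw
  have hg (j i : Fin d) (u : V d (ENNReal.ofReal p) 1) :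
      MemLp (V.grad j i u) (ENNReal.ofReal p) (torusMeasure d) := Lp.memLp _
  have i1 (u : V d (ENNReal.ofReal p) 1) (i j : Fin d) :=
    integrable_mul_Lp (memLp_flux hd hp hdp hν u i j) (hg j i w)
  have i2 (a b c : V d (ENNReal.ofReal p) 1) (i j k : Fin d) :=
    integrable_mul_Lp (memLp_val_mul_val hd hp hdp j k a b) (hg j i c)
  have i3 (i j : Fin d) : Integrable (fun x => 2 * ν * V.strainLp i j w x ^ 2) (torusMeasure d) :=
    (memLp_two_Lp hp (V.strainLp i j w)).integrable_sq.const_mul _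
  have hval : ∀ᵐ x ∂torusMeasure d, ∀ i, V.val i w x = V.val i u x - V.val i u' x := by
    refine ae_all_iff.mpr fun i => ?_
    have : V.val i w = V.val i u - V.val i u' := map_sub _ _ _
    rw [this]
    exact Lp.coeFn_sub _ _
  have hstr : ∀ᵐ x ∂torusMeasure d, ∀ i j,
      V.strainLp i j w x = V.strainLp i j u x - V.strainLp i j u' x := by
    refine ae_all_iff.mpr fun i => ae_all_iff.mpr fun j => ?_
    have : V.strainLp i j w = V.strainLp i j u - V.strainLp i j u' := map_sub _ _ _
    rw [this]
    exact Lp.coeFn_sub _ _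
  have hgr : ∀ᵐ x ∂torusMeasure d, ∀ i j,
      V.strainLp i j w x = (V.grad i j w x + V.grad j i w x) / 2 :=
    ae_all_iff.mpr fun i => ae_all_iff.mpr fun j => strainLp_coeFn i j w
  have i4 (i j : Fin d) : Integrable (fun x => flux ν u i j x * V.grad j i w x -
      flux ν u' i j x * V.grad j i w x) (torusMeasure d) := (i1 u i j).sub (i1 u' i j)
  have i5 (i j : Fin d) : Integrable (fun x => V.val j u x * V.val i w x * V.grad j i w x +
      V.val j w x * V.val i u' x * V.grad j i w x) (torusMeasure d) :=
    (i2 u w w i j i).add (i2 w u' w i j i)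
  have i6 (i j : Fin d) : Integrable (fun x => (V.val j u x * V.val i w x * V.grad j i w x +
      V.val j w x * V.val i u' x * V.grad j i w x) - 2 * ν * V.strainLp i j w x ^ 2)
      (torusMeasure d) := (i5 i j).sub (i3 i j)
  have key : ∫ x, ∑ i, ∑ j, (flux ν u i j x * V.grad j i w x - flux ν u' i j x * V.grad j i w x)
      ∂torusMeasure d ≤ ∫ x, ∑ i, ∑ j, ((V.val j u x * V.val i w x * V.grad j i w x +
        V.val j w x * V.val i u' x * V.grad j i w x) - 2 * ν * V.strainLp i j w x ^ 2)
        ∂torusMeasure d := by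
    refine integral_mono_ae ?_ ?_ ?_
    · exact integrable_finsetSum _ fun i _ => integrable_finsetSum _ fun j _ => i4 i j
    · exact integrable_finsetSum _ fun i _ => integrable_finsetSum _ fun j _ => i6 i j
    · filter_upwards [hval, hstr, hgr] with x h1 h2 h3
      have h4 := flux_difference_le hν hp (fun i => V.val i u x) (fun i => V.val i u' x)
        (fun i j => V.grad j i w x) (fun i j => V.strainLp i j u x)
        (fun i j => V.strainLp i j u' x) (fun i j => by rw [strainLp_symm])
        (fun i j => by rw [strainLp_symm]) (fun i j => by
          rw [← h2, h3, add_comm])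
      simp only [← h1, ← h2] at h4
      exact h4
  rw [integral_sum_sum i4, integral_sum_sum i6] at key
  have e1 : production ν u w - production ν u' w = ∑ i, ∑ j, ∫ x, (flux ν u i j x * V.grad j i w x -
      flux ν u' i j x * V.grad j i w x) ∂torusMeasure d := by
    simp only [production, ← Finset.sum_sub_distrib]
    refine Finset.sum_congr rfl fun i _ => Finset.sum_congr rfl fun j _ => ?_
    rw [integral_sub (i1 u i j) (i1 u' i j)]
  have e2 : ∑ i, ∑ j, ∫ x, ((V.val j u x * V.val i w x * V.grad j i w x +
        V.val j w x * V.val i u' x * V.grad j i w x) - 2 * ν * V.strainLp i j w x ^ 2)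
        ∂torusMeasure d =
      ∑ i, ∑ j, (∫ x, V.val j u x * V.val i w x * V.grad j i w x ∂torusMeasure d) +
      ∑ i, ∑ j, (∫ x, V.val j w x * V.val i u' x * V.grad j i w x ∂torusMeasure d) -
      2 * ν * ∑ i, ∑ j, ∫ x, V.strainLp i j w x ^ 2 ∂torusMeasure d := by
    simp only [Finset.mul_sum, ← Finset.sum_sub_distrib, ← Finset.sum_add_distrib]
    refine Finset.sum_congr rfl fun i _ => Finset.sum_congr rfl fun j _ => ?_
    rw [integral_sub (i5 i j) (i3 i j),
      integral_add (i2 u w w i j i) (i2 w u' w i j i), integral_const_mul]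
  have e3 : ∑ i, ∑ j, (∫ x, V.val j u x * V.val i w x * V.grad j i w x ∂torusMeasure d) = 0 := by
    refine Finset.sum_eq_zero fun i _ => ?_
    have := integral_transport hd hp hdp u w w i i
    rw [Finset.sum_add_distrib] at this
    linarith
  have e4 : ∑ i, ∑ j, (∫ x, V.val j w x * V.val i u' x * V.grad j i w x ∂torusMeasure d) =
      -∑ i, ∑ j, ∫ x, V.val j w x * V.val i w x * V.grad j i u' x ∂torusMeasure d := by
    rw [← Finset.sum_neg_distrib]
    refine Finset.sum_congr rfl fun i _ => ?_
    have := integral_transport hd hp hdp w w u' i i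
    rw [Finset.sum_add_distrib] at this
    linarith
  rw [e1]
  refine key.trans ?_
  rw [e2, e3, e4, integral_sq_strain hp]
  linarith

theorem abs_integral_le_young (hd : 0 < d) (hp : 2 ≤ p) (hdp : 1 + (d : ℝ) / 2 ≤ p)
    (w u : V d (ENNReal.ofReal p) 1) (i j : Fin d) {l : ℝ} (hl : 0 < l) :
    |∫ x, V.val j w x * V.val i w x * V.grad j i u x ∂torusMeasure d| ≤
      2 * l ^ dualExp p * (gnConst (squareExp p) * √(energy w) ^ (squareExp p - 2) *
        dissipation w) + l⁻¹ ^ p * (besselNorm d p ^ p * ‖u‖ ^ p) := by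
  have hv (i : Fin d) := integrable_val_rpow hd hp hdp i w
  have hg := integrable_Lp_rpow (V.grad j i u)
  have hi : Integrable (fun x => l ^ dualExp p * (|V.val j w x| ^ squareExp p +
      |V.val i w x| ^ squareExp p) + l⁻¹ ^ p * |V.grad j i u x| ^ p) (torusMeasure d) :=
    (((hv j).add (hv i)).const_mul _).add (hg.const_mul _)
  refine abs_integral_le_integral_abs.trans ((integral_mono
    (integrable_mul_Lp (memLp_val_mul_val hd hp hdp j i w w) (Lp.memLp (V.grad j i u))).abs hi
    fun x => ?_).trans ?_)
  · change |V.val j w x * V.val i w x * V.grad j i u x| ≤ _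
    have h1 := abs_mul_le_rpow (p := p) (l * (V.val j w x * V.val i w x)) (l⁻¹ * V.grad j i u x)
    rw [show l * (V.val j w x * V.val i w x) * (l⁻¹ * V.grad j i u x) =
      V.val j w x * V.val i w x * V.grad j i u x by field_simp, abs_mul l, abs_mul l⁻¹,
      abs_of_pos hl, abs_of_pos (inv_pos.mpr hl), Real.mul_rpow hl.le (abs_nonneg _),
      Real.mul_rpow (inv_pos.mpr hl).le (abs_nonneg _)] at h1
    refine h1.trans ?_
    gcongr
    exact abs_mul_rpow_le _ _
  · have ha : Integrable (fun x => l ^ dualExp p * (|V.val j w x| ^ squareExp p +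
        |V.val i w x| ^ squareExp p)) (torusMeasure d) := ((hv j).add (hv i)).const_mul _
    rw [integral_add ha (hg.const_mul _), integral_const_mul, integral_const_mul, integral_add (hv j) (hv i), integral_Lp_rpow]
    have h2 (i : Fin d) := integral_val_rpow_le hd hp hdp i w
    have h3 := norm_rpow_le hp (norm_grad_le hp j i u)
    have h4 : 0 ≤ l ^ dualExp p := by positivity
    have h5 : 0 ≤ l⁻¹ ^ p := by positivity
    nlinarith [mul_le_mul_of_nonneg_left (h2 i) h4, mul_le_mul_of_nonneg_left (h2 j) h4,
      mul_le_mul_of_nonneg_left h3 h5]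

/-- The energy production of the difference of two fields is controlled by its energy. -/
theorem exists_production_sub_le (hd : 0 < d) (hp : 2 ≤ p) (hdp : 1 + (d : ℝ) / 2 ≤ p) {ν : ℝ}
    (hν : 0 < ν) : ∃ K : ℝ, 0 ≤ K ∧ ∀ u u' : V d (ENNReal.ofReal p) 1,
      production ν u (u - u') - production ν u' (u - u') ≤ K * ‖u'‖ ^ p * energy (u - u') := by
  set G := gnConst (squareExp p) + 1 with hG
  have hG0 : 0 < G := by linarith [gnConst_nonneg p]
  have hd0 : (0 : ℝ) < d := by exact_mod_cast hd
  set c : ℝ := 2 * d ^ 2 * G / ν with hc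
  have hc0 : 0 < c := by positivity
  set β := besselNorm d p ^ p with hβ
  have hβ0 : 0 ≤ β := Real.rpow_nonneg (besselNorm_nonneg d p) _
  have hp1 : 0 < p - 1 := by linarith
  have hq0 : 0 < dualExp p := by linarith [one_lt_dualExp p]
  have hs0 : 0 < squareExp p - 2 := by linarith [two_lt_squareExp p]
  refine ⟨d ^ 2 * c ^ (p - 1) * β, by positivity, fun u u' => ?_⟩
  have h1 := production_sub_le hd hp hdp hν.le u u'
  set w := u - u'
  set n := ‖u'‖ ^ p with hn
  have hn0 : 0 ≤ n := Real.rpow_nonneg (norm_nonneg _) _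
  have key (ε : ℝ) (hε : 0 < ε) : production ν u w - production ν u' w ≤
      d ^ 2 * c ^ (p - 1) * β * n * (energy w + ε) := by
    set e := energy w + ε with he
    have he0 : 0 < e := by linarith [energy_nonneg w]
    set E := √e ^ (squareExp p - 2) with hE
    have hE0 : 0 < E := by positivity
    have hEp : E ^ (p - 1) = e := by
      rw [hE, ← Real.rpow_mul (Real.sqrt_nonneg _), squareExp_sub_two, Real.rpow_two,
        Real.sq_sqrt he0.le]
    set l := (c * E)⁻¹ ^ (dualExp p)⁻¹ with hl
    have hl0 : 0 < l := by positivity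
    have hl1 : l ^ dualExp p = (c * E)⁻¹ := Real.rpow_inv_rpow (by positivity) hq0.ne'
    have hl2 : l⁻¹ ^ p = c ^ (p - 1) * e := by
      rw [← hEp, ← Real.mul_rpow hc0.le hE0.le, hl, Real.inv_rpow (x := c * E) (by positivity),
        inv_inv, ← Real.rpow_mul (by positivity)]
      congr 1
      unfold dualExp
      field_simp
    have h2 (i j : Fin d) : -(∫ x, V.val j w x * V.val i w x * V.grad j i u' x ∂torusMeasure d) ≤
        ν * dissipation w / d ^ 2 + c ^ (p - 1) * e * (β * n) := by
      refine (neg_le_abs _).trans ((abs_integral_le_young hd hp hdp w u' i j hl0).trans ?_)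
      rw [hl1, hl2]
      gcongr
      have h3 : gnConst (squareExp p) * √(energy w) ^ (squareExp p - 2) ≤ G * E := by
        have : √(energy w) ^ (squareExp p - 2) ≤ E :=
          Real.rpow_le_rpow (Real.sqrt_nonneg _) (Real.sqrt_le_sqrt (by linarith)) hs0.le
        have h4 := gnConst_nonneg p
        gcongr
        linarith
      have h5 := dissipation_nonneg w
      calc 2 * (c * E)⁻¹ * (gnConst (squareExp p) * √(energy w) ^ (squareExp p - 2) *
            dissipation w) ≤ 2 * (c * E)⁻¹ * (G * E * dissipation w) := by gcongr
        _ = _ := by rw [hc]; field_simp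
    have h6 : -(∑ i, ∑ j, ∫ x, V.val j w x * V.val i w x * V.grad j i u' x ∂torusMeasure d) ≤
        d ^ 2 * (ν * dissipation w / d ^ 2 + c ^ (p - 1) * e * (β * n)) := by
      simp only [← Finset.sum_neg_distrib]
      refine (Finset.sum_le_sum fun i _ => Finset.sum_le_sum fun j _ => h2 i j).trans_eq ?_
      simp only [Finset.sum_const, Finset.card_univ, Fintype.card_fin, nsmul_eq_mul]
      ring
    have h7 : d ^ 2 * (ν * dissipation w / d ^ 2 + c ^ (p - 1) * e * (β * n)) =
        ν * dissipation w + d ^ 2 * c ^ (p - 1) * β * n * e := by field_simp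
    linarith
  have hlim : Filter.Tendsto (fun ε : ℝ => d ^ 2 * c ^ (p - 1) * β * n * (energy w + ε))
      (nhdsWithin 0 (Set.Ioi 0)) (nhds (d ^ 2 * c ^ (p - 1) * β * n * (energy w + 0))) :=
    (tendsto_const_nhds.mul (tendsto_const_nhds.add Filter.tendsto_id)).mono_left nhdsWithin_le_nhds
  rw [add_zero] at hlim
  exact ge_of_tendsto hlim (by filter_upwards [self_mem_nhdsWithin] with ε hε using key ε hε)

end Difference

/-! ## Measurability in time of nonlinear functionals -/

section Measurability

/-- Truncation of a real number to `[-k, k]`. -/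
def clip (k : ℕ) (y : ℝ) : ℝ := max (-k) (min y k)

theorem continuous_clip (k : ℕ) : Continuous (clip k) := by
  unfold clip
  fun_prop

theorem abs_clip_le (k : ℕ) (y : ℝ) : |clip k y| ≤ k := by
  have : (0 : ℝ) ≤ k := Nat.cast_nonneg k
  rw [abs_le]
  exact ⟨le_max_left _ _, max_le (by linarith) (min_le_right _ _)⟩

theorem abs_clip_le_abs (k : ℕ) (y : ℝ) : |clip k y| ≤ |y| := by
  have hk : (0 : ℝ) ≤ k := Nat.cast_nonneg k
  rw [abs_le]
  refine ⟨le_max_of_le_right (le_min (neg_abs_le y) ?_),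
    max_le ?_ ((min_le_left _ _).trans (le_abs_self y))⟩
  · linarith [abs_nonneg y]
  · linarith [abs_nonneg y]

theorem clip_of_abs_le {k : ℕ} {y : ℝ} (h : |y| ≤ k) : clip k y = y := by
  rw [abs_le] at h
  rw [clip, min_eq_left h.2, max_eq_right h.1]

variable {d : ℕ} {q : ℝ≥0∞} [Fact (1 ≤ q)] {ι : Type*} [Fintype ι] {E : Type*} [MetricSpace E]

theorem exists_subseq_ae_tendsto {L : ι → E → Lp ℝ q (torusMeasure d)} (hL : ∀ i, Continuous (L i))
    {y : E} {v : ℕ → E} (hv : Filter.Tendsto v Filter.atTop (nhds y)) :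
    ∃ ms : ℕ → ℕ, ∀ᵐ x ∂torusMeasure d, ∀ i,
      Filter.Tendsto (fun n => L i (v (ms n)) x) Filter.atTop (nhds (L i y x)) := by
  have h1 (i : ι) : Filter.Tendsto (fun n => ‖L i (v n) - L i y‖) Filter.atTop (nhds 0) :=
    tendsto_iff_norm_sub_tendsto_zero.mp (((hL i).tendsto y).comp hv)
  have hi (i : ι) (n : ℕ) : Integrable (fun x => |L i (v n) x - L i y x|) (torusMeasure d) :=
    ((integrable_Lp _).sub (integrable_Lp _)).abs
  have h2 (n : ℕ) : ∫ x, ∑ i, |L i (v n) x - L i y x| ∂torusMeasure d ≤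
      ∑ i, ‖L i (v n) - L i y‖ := by
    rw [integral_finsetSum _ fun i _ => hi i n]
    refine Finset.sum_le_sum fun i _ => le_trans (le_of_eq ?_) (integral_norm_Lp_le _)
    refine integral_congr_ae ?_
    filter_upwards [Lp.coeFn_sub (L i (v n)) (L i y)] with x hx
    rw [hx]
    rfl
  have h3 : Filter.Tendsto (fun n => eLpNorm ((fun x => ∑ i, |L i (v n) x - L i y x|) - 0) 1
      (torusMeasure d)) Filter.atTop (nhds 0) := by
    have h4 : Filter.Tendsto (fun n => ENNReal.ofReal (∑ i, ‖L i (v n) - L i y‖)) Filter.atTop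
        (nhds 0) := by
      have := ENNReal.tendsto_ofReal (tendsto_finsetSum Finset.univ fun i _ => h1 i)
      simpa using this
    refine tendsto_of_tendsto_of_tendsto_of_le_of_le tendsto_const_nhds h4 (fun _ => zero_le)
      fun n => ?_
    have hI : Integrable (fun x => ∑ i, |L i (v n) x - L i y x|) (torusMeasure d) :=
      integrable_finsetSum _ fun i _ => hi i n
    change eLpNorm _ _ _ ≤ _
    rw [sub_zero, eLpNorm_one_eq_lintegral_enorm, ← ofReal_integral_norm_eq_lintegral_enorm hI]
    refine ENNReal.ofReal_le_ofReal ((le_of_eq ?_).trans (h2 n))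
    refine integral_congr_ae (.of_forall fun x => ?_)
    exact Real.norm_of_nonneg (Finset.sum_nonneg fun _ _ => abs_nonneg _)
  have h5 := tendstoInMeasure_of_tendsto_eLpNorm one_ne_zero (fun n =>
    (integrable_finsetSum Finset.univ fun i _ => hi i n).aestronglyMeasurable)
    (aestronglyMeasurable_const (b := (0 : ℝ))) h3
  obtain ⟨ms, -, hms⟩ := h5.exists_seq_tendsto_ae
  refine ⟨ms, hms.mono fun x hx i => ?_⟩
  rw [tendsto_iff_norm_sub_tendsto_zero]
  refine squeeze_zero (fun _ => norm_nonneg _) (fun n => ?_) hx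
  exact Finset.single_le_sum (f := fun i => |L i (v (ms n)) x - L i y x|)
    (fun _ _ => abs_nonneg _) (Finset.mem_univ i)

theorem continuous_integral_clip {L : ι → E → Lp ℝ q (torusMeasure d)} (hL : ∀ i, Continuous (L i))
    {G : (ι → ℝ) → ℝ} (hG : Continuous G) {ψ : UnitAddTorus (Fin d) → ℝ} (hψ : Continuous ψ)
    (k : ℕ) :
    Continuous fun y => ∫ x, clip k (G fun i => L i y x) * ψ x ∂torusMeasure d := by
  have hm (y : E) : Measurable fun x => fun i => L i y x :=
    measurable_pi_iff.mpr fun i => (Lp.stronglyMeasurable _).measurable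
  have hψi : Integrable ψ (torusMeasure d) :=
    hψ.integrable_of_hasCompactSupport (HasCompactSupport.of_compactSpace _)
  rw [continuous_iff_continuousAt]
  intro y
  refine Filter.tendsto_of_subseq_tendsto fun v hv => ?_
  obtain ⟨ms, hms⟩ := exists_subseq_ae_tendsto hL hv
  refine ⟨ms, tendsto_integral_of_dominated_convergence (fun x => k * |ψ x|) (fun n => ?_)
    (hψi.abs.const_mul _) (fun n => .of_forall fun x => ?_) ?_⟩
  · exact ((((continuous_clip k).comp hG).measurable.comp (hm _)).mul
      hψ.measurable).aestronglyMeasurable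
  · rw [Real.norm_eq_abs, abs_mul]
    exact mul_le_mul_of_nonneg_right (abs_clip_le _ _) (abs_nonneg _)
  · filter_upwards [hms] with x hx
    have h1 : Filter.Tendsto (fun n => fun i => L i (v (ms n)) x) Filter.atTop
        (nhds fun i => L i y x) := tendsto_pi_nhds.mpr hx
    have h2 := (((continuous_clip k).comp hG).tendsto _).comp h1
    exact h2.mul_const _

/-- Integral functionals of `L_q`-valued measurable paths are measurable. -/
theorem aestronglyMeasurable_integral_comp {L : ι → E → Lp ℝ q (torusMeasure d)}
    (hL : ∀ i, Continuous (L i)) {G : (ι → ℝ) → ℝ} (hG : Continuous G)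
    {ψ : UnitAddTorus (Fin d) → ℝ} (hψ : Continuous ψ)
    (hi : ∀ y, Integrable (fun x => (G fun i => L i y x) * ψ x) (torusMeasure d))
    {m : Measure ℝ} {u : ℝ → E} (hu : AEStronglyMeasurable u m) :
    AEStronglyMeasurable (fun s => ∫ x, (G fun i => L i (u s) x) * ψ x ∂torusMeasure d) m := by
  have hm (y : E) : Measurable fun x => fun i => L i y x :=
    measurable_pi_iff.mpr fun i => (Lp.stronglyMeasurable _).measurable
  refine aestronglyMeasurable_of_tendsto_ae Filter.atTop (f := fun k s =>
    ∫ x, clip k (G fun i => L i (u s) x) * ψ x ∂torusMeasure d)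
    (fun k => (continuous_integral_clip hL hG hψ k).comp_aestronglyMeasurable hu)
    (.of_forall fun s => ?_)
  refine tendsto_integral_of_dominated_convergence (fun x => |(G fun i => L i (u s) x) * ψ x|)
    (fun k => ?_) (hi _).abs (fun k => .of_forall fun x => ?_) (.of_forall fun x => ?_)
  · exact ((((continuous_clip k).comp hG).measurable.comp (hm _)).mul
      hψ.measurable).aestronglyMeasurable
  · rw [Real.norm_eq_abs, abs_mul, abs_mul]
    exact mul_le_mul_of_nonneg_right (abs_clip_le_abs _ _) (abs_nonneg _)
  · obtain ⟨n, hn⟩ := exists_nat_ge |G fun i => L i (u s) x|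
    refine tendsto_const_nhds.congr' ?_
    filter_upwards [Filter.eventually_ge_atTop n] with k hk
    rw [clip_of_abs_le (hn.trans (by exact_mod_cast hk))]

end Measurability

/-! ## Regular paths -/

section Paths

variable {d : ℕ} {p : ℝ} [Fact (1 < p)]

theorem aestronglyMeasurable_drift (hd : 0 < d) (hp : 2 ≤ p) (hdp : 1 + (d : ℝ) / 2 ≤ p) {ν : ℝ}
    (hν : 0 ≤ ν) (φ : TestField d) {m : Measure ℝ} {u : ℝ → V d (ENNReal.ofReal p) 1}
    (hu : AEStronglyMeasurable u m) :
    AEStronglyMeasurable (fun s => drift ν p (V.coeff 1 (u s)) φ) m := by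
  simp only [drift_eq hd hp hdp hν]
  refine Finset.aestronglyMeasurable_fun_sum _ fun i _ =>
    Finset.aestronglyMeasurable_fun_sum _ fun j _ => ?_
  let L : Fin d ⊕ (Fin d × Fin d) → V d (ENNReal.ofReal p) 1 →
      Lp ℝ (ENNReal.ofReal p) (torusMeasure d) :=
    Sum.elim (fun i => V.val i) (fun k => V.strainLp k.1 k.2)
  have hL : ∀ k, Continuous (L k) := by
    rintro (k | k)
    · exact (V.val k).continuous
    · exact (V.strainLp k.1 k.2).continuous
  let G : (Fin d ⊕ (Fin d × Fin d) → ℝ) → ℝ := fun a =>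
    a (Sum.inl i) * a (Sum.inl j) - stressTensor ν p (fun k l => a (Sum.inr (k, l))) i j
  have hG : Continuous G := by
    have h1 := (continuous_stressTensor (d := d) ν p i j).comp
      (show Continuous fun a : Fin d ⊕ (Fin d × Fin d) → ℝ => fun k l => a (Sum.inr (k, l)) by
        fun_prop)
    have h2 : Continuous fun a : Fin d ⊕ (Fin d × Fin d) → ℝ => a (Sum.inl i) * a (Sum.inl j) := by
      fun_prop
    exact h2.sub h1
  exact aestronglyMeasurable_integral_comp hL hG (φ.continuous_partialDeriv j i)
    (fun y => integrable_mul_Lp (memLp_flux hd hp hdp hν y i j)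
      (memLp_of_continuous (φ.continuous_partialDeriv j i) _)) hu

theorem integral_L2_sq (f : Lp ℝ 2 (torusMeasure d)) :
    ∫ x, f x ^ 2 ∂torusMeasure d = ‖f‖ ^ 2 := by
  rw [← real_inner_self_eq_norm_sq, L2.inner_def]
  refine integral_congr_ae (.of_forall fun x => ?_)
  simp [sq]

theorem energy_le_of_coeff_eq (hp : 2 ≤ p) {u : V d (ENNReal.ofReal p) 1} {w : V d 2 0}
    (h : V.coeff 1 u = V.coeff 0 w) : energy u ≤ d * ‖w‖ ^ 2 := by
  rw [coeff_zero] at h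
  have h1 (i : Fin d) : ∫ x, V.val i u x ^ 2 ∂torusMeasure d ≤ ‖w‖ ^ 2 := by
    have h2 := hasSum_val hp i u
    have h3 := hasSum_sq_coeff (Lp.memLp (coordLp 2 i (w : Lp (Vec d) 2 (torusMeasure d))))
    simp only [← rcoeff_eq, ← fieldCoeff_eq, ← h] at h3
    rw [h2.unique h3, integral_L2_sq]
    gcongr
    exact norm_coordLp_le i _
  calc energy u ≤ ∑ _i : Fin d, ‖w‖ ^ 2 := Finset.sum_le_sum fun i _ => h1 i
    _ = _ := by simp only [Finset.sum_const, Finset.card_univ, Fintype.card_fin, nsmul_eq_mul]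

/-- The path `x` is represented on `[0, T]` by the path `u` in `L_p([0, T] → V_{p,1})`, with energy
bounded by `M`. -/
structure IsRegularPath (T M : ℝ) (x : ℝ → FormalField d) (u : ℝ → V d (ENNReal.ofReal p) 1) :
    Prop where
  memLp : MemLp u (ENNReal.ofReal p) (volume.restrict (Set.Ioc 0 T))
  coeff_eq : ∀ᵐ t ∂volume.restrict (Set.Ioc 0 T), V.coeff 1 (u t) = x t
  energy_le : ∀ᵐ t ∂volume.restrict (Set.Ioc 0 T), energy (u t) ≤ M

theorem exists_isRegularPath (hp : 2 ≤ p) {x : ℝ → FormalField d}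
    (h : MemLpLoc (ENNReal.ofReal p) (ENNReal.ofReal p) 1 x) (h' : MemLpLoc ∞ 2 0 x) {T : ℝ}
    (hT : 0 < T) : ∃ (M : ℝ) (u : ℝ → V d (ENNReal.ofReal p) 1), IsRegularPath T M x u := by
  obtain ⟨u, hu, hux⟩ := h
  obtain ⟨w, hw, hwx⟩ := h'
  have hsub : Set.Ioc 0 T ⊆ Set.Icc 0 T := Set.Ioc_subset_Icc_self
  have hsub' : Set.Ioc 0 T ⊆ Set.Ici 0 := fun t ht => ht.1.le
  have hux' := ae_restrict_of_ae_restrict_of_subset hsub' hux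
  have hwx' := ae_restrict_of_ae_restrict_of_subset hsub' hwx
  have hw' := (hw T hT).mono_measure (Measure.restrict_mono_set volume hsub)
  refine ⟨d * (eLpNorm w ∞ (volume.restrict (Set.Ioc 0 T))).toReal ^ 2, u,
    (hu T hT).mono_measure (Measure.restrict_mono_set volume hsub), hux', ?_⟩
  have hb : ∀ᵐ t ∂volume.restrict (Set.Ioc 0 T),
      ‖w t‖ ≤ (eLpNorm w ∞ (volume.restrict (Set.Ioc 0 T))).toReal := by
    filter_upwards [ae_le_eLpNormEssSup (f := w) (μ := volume.restrict (Set.Ioc 0 T))] with t ht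
    rw [← eLpNorm_exponent_top] at ht
    have := ENNReal.toReal_mono hw'.2.ne ht
    rwa [toReal_enorm] at this
  filter_upwards [hux', hwx', hb] with t h1 h2 h3
  refine (energy_le_of_coeff_eq hp (h1.trans h2.symm)).trans ?_
  gcongr

theorem IsRegularPath.integrable_norm_rpow {T M : ℝ} {x : ℝ → FormalField d}
    {u : ℝ → V d (ENNReal.ofReal p) 1} (h : IsRegularPath T M x u) :
    Integrable (fun s => ‖u s‖ ^ p) (volume.restrict (Set.Ioc 0 T)) := by
  have hp : 0 < p := one_pos.trans Fact.out
  have := h.memLp.integrable_norm_rpow (by simpa using hp) ENNReal.ofReal_ne_top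
  rwa [ENNReal.toReal_ofReal hp.le] at this

theorem IsRegularPath.exists_flux_bound (hd : 0 < d) (hp : 2 ≤ p) (hdp : 1 + (d : ℝ) / 2 ≤ p)
    {ν : ℝ} (hν : 0 ≤ ν) {T M : ℝ} {x : ℝ → FormalField d} {u : ℝ → V d (ENNReal.ofReal p) 1}
    (h : IsRegularPath T M x u) : ∃ B : ℝ → ℝ, Integrable B (volume.restrict (Set.Ioc 0 T)) ∧
      ∀ᵐ s ∂volume.restrict (Set.Ioc 0 T), ∀ φ, |drift ν p (V.coeff 1 (u s)) φ| ≤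
        B s + ∑ i, ∑ j, ∫ x, |TestField.partialDeriv φ j i x| ^ p ∂torusMeasure d := by
  obtain ⟨C, hC, hb⟩ := integral_flux_rpow_le hd hp hdp hν
  have hs0 : 0 ≤ squareExp p - 2 := by linarith [two_lt_squareExp p]
  refine ⟨fun s => d * (d * (C * ((1 + ‖u s‖ ^ p) * (1 + √M ^ (squareExp p - 2))))), ?_, ?_⟩
  · exact ((((integrable_const _).add h.integrable_norm_rpow).mul_const _).const_mul C).const_mul
      (d : ℝ) |>.const_mul (d : ℝ)
  · filter_upwards [h.energy_le] with s hs φ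
    refine (abs_drift_le hd hp hdp hν (u s) φ).trans ?_
    simp only [Finset.sum_add_distrib]
    gcongr
    have h1 (i j : Fin d) : ∫ x, |flux ν (u s) i j x| ^ dualExp p ∂torusMeasure d ≤
        C * ((1 + ‖u s‖ ^ p) * (1 + √M ^ (squareExp p - 2))) := by
      refine (hb (u s) i j).trans ?_
      gcongr
    calc _ ≤ ∑ _i : Fin d, ∑ _j : Fin d, C * ((1 + ‖u s‖ ^ p) * (1 + √M ^ (squareExp p - 2))) :=
          Finset.sum_le_sum fun i _ => Finset.sum_le_sum fun j _ => h1 i j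
      _ = _ := by simp only [Finset.sum_const, Finset.card_univ, Fintype.card_fin, nsmul_eq_mul]

theorem IsRegularPath.integrable_drift (hd : 0 < d) (hp : 2 ≤ p) (hdp : 1 + (d : ℝ) / 2 ≤ p)
    {ν : ℝ} (hν : 0 ≤ ν) {T M : ℝ} {x : ℝ → FormalField d} {u : ℝ → V d (ENNReal.ofReal p) 1}
    (h : IsRegularPath T M x u) (φ : TestField d) :
    Integrable (fun s => drift ν p (V.coeff 1 (u s)) φ) (volume.restrict (Set.Ioc 0 T)) := by
  obtain ⟨B, hB, hb⟩ := h.exists_flux_bound hd hp hdp hν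
  refine (hB.add (integrable_const (∑ i, ∑ j, ∫ x, |φ.partialDeriv j i x| ^ p
    ∂torusMeasure d))).mono' (aestronglyMeasurable_drift hd hp hdp hν φ h.memLp.1) ?_
  filter_upwards [hb] with s hs
  exact hs φ

end Paths

/-! ## Integral inequalities in time -/

section Time

theorem eq_zero_step {T a b : ℝ} {E k : ℝ → ℝ} (hE : ContinuousOn E (Set.Icc 0 T))
    (hE0 : ∀ t ∈ Set.Icc 0 T, 0 ≤ E t) (hk : IntervalIntegrable k volume 0 T)
    (hk0 : ∀ t, 0 ≤ k t) (h : ∀ t ∈ Set.Icc 0 T, E t ≤ ∫ s in (0 : ℝ)..t, k s * E s)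
    (ha : 0 ≤ a) (hab : a ≤ b) (hb : b ≤ T) (hab' : ∫ s in a..b, k s ≤ 1 / 2)
    (hEa : ∀ t ∈ Set.Icc 0 a, E t = 0) : ∀ t ∈ Set.Icc 0 b, E t = 0 := by
  have hsub : Set.Icc 0 b ⊆ Set.Icc 0 T := Set.Icc_subset_Icc_right hb
  obtain ⟨t₀, ht₀, hmax⟩ := isCompact_Icc.exists_isMaxOn
    (Set.nonempty_Icc.mpr (ha.trans hab)) (hE.mono hsub)
  have hmax' : ∀ t ∈ Set.Icc 0 b, E t ≤ E t₀ := fun t ht => hmax ht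
  suffices hm : E t₀ ≤ 0 from fun t ht =>
    le_antisymm ((hmax' t ht).trans hm) (hE0 t (hsub ht))
  rcases le_total t₀ a with h1 | h1
  · exact (hEa t₀ ⟨ht₀.1, h1⟩).le
  · have hT : 0 ≤ T := (ht₀.1.trans ht₀.2).trans hb
    have hkE : IntervalIntegrable (fun s => k s * E s) volume 0 T := by
      refine hk.mul_continuousOn ?_
      rwa [Set.uIcc_of_le hT]
    have m0 : (0 : ℝ) ∈ Set.uIcc 0 T := Set.left_mem_uIcc
    have ma : a ∈ Set.uIcc 0 T := by
      rw [Set.uIcc_of_le hT]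
      exact ⟨ha, hab.trans hb⟩
    have mt : t₀ ∈ Set.uIcc 0 T := by
      rw [Set.uIcc_of_le hT]
      exact hsub ht₀
    have mb : b ∈ Set.uIcc 0 T := by
      rw [Set.uIcc_of_le hT]
      exact ⟨ha.trans hab, hb⟩
    have i1 := hkE.mono_set (Set.uIcc_subset_uIcc m0 ma)
    have i2 := hkE.mono_set (Set.uIcc_subset_uIcc ma mt)
    have i3 := hk.mono_set (Set.uIcc_subset_uIcc ma mt)
    have i4 := hk.mono_set (Set.uIcc_subset_uIcc mt mb)
    have z1 : ∫ s in (0 : ℝ)..a, k s * E s = 0 := by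
      refine intervalIntegral.integral_zero_ae (.of_forall fun s hs => ?_)
      rw [Set.uIoc_of_le ha] at hs
      rw [hEa s ⟨hs.1.le, hs.2⟩, mul_zero]
    have z2 : ∫ s in a..t₀, k s * E s ≤ ∫ s in a..t₀, k s * E t₀ := by
      refine intervalIntegral.integral_mono_on h1 i2 (i3.mul_const _) fun s hs => ?_
      exact mul_le_mul_of_nonneg_left (hmax' s ⟨ha.trans hs.1, hs.2.trans ht₀.2⟩) (hk0 s)
    have z3 : 0 ≤ ∫ s in t₀..b, k s :=
      intervalIntegral.integral_nonneg ht₀.2 fun s _ => hk0 s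
    have z4 := intervalIntegral.integral_add_adjacent_intervals i3 i4
    have z5 := intervalIntegral.integral_add_adjacent_intervals i1 i2
    rw [intervalIntegral.integral_mul_const] at z2
    have z6 := h t₀ (hsub ht₀)
    have z7 := hE0 t₀ (hsub ht₀)
    have z8 : (∫ s in a..t₀, k s) * E t₀ ≤ 1 / 2 * E t₀ := by gcongr; linarith
    linarith

/-- A form of Grönwall's inequality. -/
theorem eq_zero_of_le_integral {T : ℝ} (hT : 0 ≤ T) {E k : ℝ → ℝ}
    (hE : ContinuousOn E (Set.Icc 0 T)) (hE0 : ∀ t ∈ Set.Icc 0 T, 0 ≤ E t)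
    (hk : IntervalIntegrable k volume 0 T) (hk0 : ∀ t, 0 ≤ k t)
    (h : ∀ t ∈ Set.Icc 0 T, E t ≤ ∫ s in (0 : ℝ)..t, k s * E s) :
    ∀ t ∈ Set.Icc 0 T, E t = 0 := by
  have hint (a : ℝ) (ha : a ∈ Set.Icc 0 T) (b : ℝ) (hb : b ∈ Set.Icc 0 T) :
      IntervalIntegrable k volume a b := by
    rw [← Set.uIcc_of_le hT] at ha hb
    exact hk.mono_set (Set.uIcc_subset_uIcc ha hb)
  have h0 : (0 : ℝ) ∈ Set.Icc 0 T := ⟨le_rfl, hT⟩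
  have hc : ContinuousOn (fun t => ∫ s in (0 : ℝ)..t, k s) (Set.Icc 0 T) := by
    have := intervalIntegral.continuousOn_primitive_interval'
      (hint 0 h0 T ⟨hT, le_rfl⟩) Set.left_mem_uIcc
    rwa [Set.uIcc_of_le hT] at this
  have huc := isCompact_Icc.uniformContinuousOn_of_continuous hc
  rw [Metric.uniformContinuousOn_iff] at huc
  obtain ⟨δ, hδ, hδ'⟩ := huc (1 / 2) (by norm_num)
  have key (n : ℕ) : ∀ t ∈ Set.Icc 0 (min (n * (δ / 2)) T), E t = 0 := by
    induction n with
    | zero =>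
      intro t ht
      have ht' : t = 0 := by
        have h1 := ht.2.trans (min_le_left _ _)
        simp only [Nat.cast_zero, zero_mul] at h1
        exact le_antisymm h1 ht.1
      have h1 := h 0 h0
      rw [intervalIntegral.integral_same] at h1
      rw [ht']
      exact le_antisymm h1 (hE0 0 h0)
    | succ n ih =>
      have hn : (0 : ℝ) ≤ n * (δ / 2) := by positivity
      have hn1 : ((n + 1 : ℕ) : ℝ) * (δ / 2) = n * (δ / 2) + δ / 2 := by push_cast; ring
      have ha : 0 ≤ min (n * (δ / 2)) T := le_min hn hT
      have hab : min (n * (δ / 2)) T ≤ min (((n + 1 : ℕ) : ℝ) * (δ / 2)) T :=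
        min_le_min_right _ (by linarith)
      have hb := min_le_right (((n + 1 : ℕ) : ℝ) * (δ / 2)) T
      refine eq_zero_step hE hE0 hk hk0 h ha hab hb ?_ ih
      set a := min (n * (δ / 2)) T with hadef
      set b := min (((n + 1 : ℕ) : ℝ) * (δ / 2)) T with hbdef
      have ma : a ∈ Set.Icc 0 T := ⟨ha, hab.trans hb⟩
      have mb : b ∈ Set.Icc 0 T := ⟨ha.trans hab, hb⟩
      have hd : dist b a < δ := by
        rw [Real.dist_eq, abs_of_nonneg (by linarith)]
        have : b ≤ a + δ / 2 := by
          rw [hadef, hbdef, hn1]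
          rcases le_total (n * (δ / 2)) T with h' | h'
          · rw [min_eq_left h']
            exact min_le_left _ _
          · rw [min_eq_right h']
            exact (min_le_right _ _).trans (by linarith)
        linarith
      have h2 := hδ' b mb a ma hd
      rw [Real.dist_eq] at h2
      have h3 := intervalIntegral.integral_add_adjacent_intervals (hint 0 h0 a ma) (hint a ma b mb)
      have h4 := (abs_lt.mp h2).2
      linarith
  intro t ht
  obtain ⟨n, hn⟩ := exists_nat_ge (T / (δ / 2))
  refine key n t ⟨ht.1, le_min ?_ ht.2⟩
  rw [div_le_iff₀ (by positivity)] at hn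
  exact ht.2.trans hn

theorem sq_integral {T t : ℝ} (ht : t ∈ Set.Icc 0 T) {g : ℝ → ℝ}
    (hg : IntervalIntegrable g volume 0 T) :
    (∫ s in (0 : ℝ)..t, g s) ^ 2 = ∫ s in (0 : ℝ)..t, 2 * ((∫ r in (0 : ℝ)..s, g r) * g s) := by
  have hT : 0 ≤ T := ht.1.trans ht.2
  have hg' : IntervalIntegrable g volume 0 t := by
    refine hg.mono_set (Set.uIcc_subset_uIcc Set.left_mem_uIcc ?_)
    rwa [Set.uIcc_of_le hT]
  have hac := hg'.absolutelyContinuousOnInterval_intervalIntegral Set.left_mem_uIcc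
  have h1 := hac.integral_deriv_mul_eq_sub hac
  simp only [intervalIntegral.integral_same, mul_zero, sub_zero] at h1
  rw [sq, ← h1]
  refine intervalIntegral.integral_congr_ae ?_
  filter_upwards [hg'.ae_hasDerivAt_integral] with s hs hst
  have h2 := (hs (Set.uIoc_subset_uIcc hst) 0 Set.left_mem_uIcc).deriv
  rw [h2]
  ring

end Time

/-! ## Solenoidal Fourier modes -/

section Modes

variable {d : ℕ}

/-- The Leray projection at the frequency `z`. -/
def leray (z : Fin d → ℤ) : (Fin d → ℂ) →ₗ[ℝ] (Fin d → ℂ) where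
  toFun c j := if z = 0 then 0 else c j - (z j : ℂ) * (∑ i, (z i : ℂ) * c i) / (freqSq z : ℂ)
  map_add' c c' := by
    funext j
    simp only [Pi.add_apply, mul_add, Finset.sum_add_distrib]
    split_ifs <;> ring
  map_smul' a c := by
    funext j
    simp only [Pi.smul_apply, Complex.real_smul, RingHom.id_apply, mul_left_comm _ (a : ℂ),
      ← Finset.mul_sum]
    split_ifs <;> ring

theorem leray_zero (c : Fin d → ℂ) : leray 0 c = 0 := by
  funext j
  simp [leray]

theorem leray_apply {z : Fin d → ℤ} (hz : z ≠ 0) (c : Fin d → ℂ) (j : Fin d) :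
    leray z c j = c j - (z j : ℂ) * (∑ i, (z i : ℂ) * c i) / (freqSq z : ℂ) := if_neg hz

theorem freqSq_cast_ne_zero {z : Fin d → ℤ} (hz : z ≠ 0) : (freqSq z : ℂ) ≠ 0 := by
  have := one_le_freqSq hz
  exact_mod_cast (by linarith : freqSq z ≠ 0)

theorem sum_mul_leray (z : Fin d → ℤ) (c : Fin d → ℂ) : ∑ j, (z j : ℂ) * leray z c j = 0 := by
  by_cases hz : z = 0
  · simp [hz]
  · have h1 : (freqSq z : ℂ) = ∑ j, (z j : ℂ) * z j := by
      simp [freqSq, sq]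
    have h2 (j : Fin d) : (z j : ℂ) * leray z c j = (z j : ℂ) * c j -
        (z j : ℂ) * z j * ((∑ i, (z i : ℂ) * c i) / (freqSq z : ℂ)) := by
      rw [leray_apply hz]
      ring
    simp only [h2, Finset.sum_sub_distrib, ← Finset.sum_mul, ← h1]
    rw [mul_div_cancel₀ _ (freqSq_cast_ne_zero hz), sub_self]

theorem leray_of_solenoidal {u : FormalField d} (hu : IsSolenoidal u) (z : Fin d → ℤ) :
    leray z (u z) = u z := by
  by_cases hz : z = 0
  · rw [hz, leray_zero, hu.mean_zero]
  · funext j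
    rw [leray_apply hz, hu.div_free]
    simp

theorem sum_leray_mul_conj {u : FormalField d} (hu : IsSolenoidal u) (z : Fin d → ℤ)
    (c : Fin d → ℂ) : ∑ j, leray z c j * (starRingEnd ℂ) (u z j) =
      ∑ j, c j * (starRingEnd ℂ) (u z j) := by
  by_cases hz : z = 0
  · simp [hz, hu.mean_zero]
  · have h0 : ∑ i, (z i : ℂ) * (starRingEnd ℂ) (u z i) = 0 := by
      have := congrArg (starRingEnd ℂ) (hu.div_free z)
      simpa only [map_sum, map_mul, map_intCast, map_zero] using this
    have h2 (j : Fin d) : leray z c j * (starRingEnd ℂ) (u z j) = c j * (starRingEnd ℂ) (u z j) -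
        (z j : ℂ) * (starRingEnd ℂ) (u z j) * ((∑ i, (z i : ℂ) * c i) / (freqSq z : ℂ)) := by
      rw [leray_apply hz]
      ring
    simp only [h2, Finset.sum_sub_distrib, ← Finset.sum_mul, h0]
    ring

/-- The real solenoidal field with frequencies `±z` and amplitude `c`. -/
def TestField.mode (z : Fin d → ℤ) (c : Fin d → ℂ) : TestField d where
  coeff := Finsupp.single z ((1 / 2 : ℝ) • leray z c) +
    Finsupp.single (-z) ((1 / 2 : ℝ) • star (leray z c))
  mean_zero := by
    by_cases hz : z = 0
    · simp [hz, leray_zero]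
    · simp [hz]
  real w i := by
    simp only [Finsupp.add_apply, Finsupp.single_apply, Pi.add_apply, neg_inj,
      show z = -w ↔ -z = w from neg_eq_iff_eq_neg.symm]
    split_ifs <;> simp [add_comm, map_ofNat]
  div_free w := by
    have h0 := sum_mul_leray z c
    have h1 : ∑ j, (z j : ℂ) * (starRingEnd ℂ) (leray z c j) = 0 := by
      have := congrArg (starRingEnd ℂ) h0
      simpa only [map_sum, map_mul, map_intCast, map_zero] using this
    simp only [Finsupp.add_apply, Finsupp.single_apply, Pi.add_apply, mul_add,
      Finset.sum_add_distrib]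
    have h2 : ∑ i, (w i : ℂ) * (if z = w then (1 / 2 : ℝ) • leray z c else 0) i = 0 := by
      split_ifs with h
      · rw [← h]
        simp only [Pi.smul_apply, Complex.real_smul, mul_left_comm _ (((1 / 2 : ℝ)) : ℂ),
          ← Finset.mul_sum, h0, mul_zero]
      · simp
    have h3 : ∑ i, (w i : ℂ) * (if -z = w then (1 / 2 : ℝ) • star (leray z c) else 0) i = 0 := by
      split_ifs with h
      · rw [← h]
        simp only [Pi.smul_apply, Pi.star_apply, Pi.neg_apply, Int.cast_neg, Complex.real_smul,
          mul_left_comm _ (((1 / 2 : ℝ)) : ℂ), ← Finset.mul_sum, neg_mul, Finset.sum_neg_distrib]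
        simp only [RCLike.star_def, h1, neg_zero, mul_zero]
      · simp
    rw [h2, h3, add_zero]

theorem pairing_sub (φ : TestField d) (u u' : FormalField d) :
    pairing φ (u - u') = pairing φ u - pairing φ u' := by
  simp only [pairing, Pi.sub_apply, map_sub, mul_sub, Finset.sum_sub_distrib, Complex.sub_re]

theorem pairing_mode {u : FormalField d} (hu : IsSolenoidal u) (z : Fin d → ℤ) (c : Fin d → ℂ) :
    pairing (TestField.mode z c) u = (∑ i, c i * (starRingEnd ℂ) (u z i)).re := by
  have h1 : pairing (TestField.mode z c) u =
      ((TestField.mode z c).coeff.sum fun w v => ∑ i, v i * (starRingEnd ℂ) (u w i)).re := rfl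
  have h2 : ∀ w, ∑ i, (0 : Fin d → ℂ) i * (starRingEnd ℂ) (u w i) = 0 := fun w => by simp
  have h3 : ∀ (w : Fin d → ℤ) (v v' : Fin d → ℂ), ∑ i, (v + v') i * (starRingEnd ℂ) (u w i) =
      ∑ i, v i * (starRingEnd ℂ) (u w i) + ∑ i, v' i * (starRingEnd ℂ) (u w i) := fun w v v' => by
    simp only [Pi.add_apply, add_mul, Finset.sum_add_distrib]
  rw [h1, TestField.mode, Finsupp.sum_add_index' h2 h3, Finsupp.sum_single_index (h2 _),
    Finsupp.sum_single_index (h2 _)]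
  have h4 : ∑ i, ((1 / 2 : ℝ) • leray z c) i * (starRingEnd ℂ) (u z i) =
      ((1 / 2 : ℝ) : ℂ) * ∑ i, leray z c i * (starRingEnd ℂ) (u z i) := by
    simp only [Pi.smul_apply, Complex.real_smul, mul_assoc, ← Finset.mul_sum]
  have h5 : ∑ i, ((1 / 2 : ℝ) • star (leray z c)) i * (starRingEnd ℂ) (u (-z) i) =
      ((1 / 2 : ℝ) : ℂ) * (starRingEnd ℂ) (∑ i, leray z c i * (starRingEnd ℂ) (u z i)) := by
    simp only [Pi.smul_apply, Pi.star_apply, Complex.real_smul, mul_assoc, ← Finset.mul_sum,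
      map_sum, map_mul, hu.real, RCLike.star_def]
  rw [h4, h5, Complex.add_re, Complex.re_ofReal_mul, Complex.re_ofReal_mul, Complex.conj_re,
    sum_leray_mul_conj hu]
  ring

/-- The real coordinate directions of `ℂ^d`. -/
def direction (k : Fin d × Bool) : Fin d → ℂ := Pi.single k.1 (bif k.2 then Complex.I else 1)

/-- The real coordinates of a vector in `ℂ^d`. -/
def coordinate (k : Fin d × Bool) (v : Fin d → ℂ) : ℝ :=
  (∑ i, direction k i * (starRingEnd ℂ) (v i)).re

theorem coordinate_eq (i : Fin d) (b : Bool) (v : Fin d → ℂ) :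
    coordinate (i, b) v = bif b then (v i).im else (v i).re := by
  rw [coordinate, Finset.sum_eq_single i]
  · cases b <;> simp [direction]
  · intro j _ hj
    simp [direction, hj]
  · simp

theorem sum_coordinate_smul (v : Fin d → ℂ) : ∑ k, coordinate k v • direction k = v := by
  rw [Fintype.sum_prod_type]
  funext j
  simp only [Fintype.sum_bool, coordinate_eq, cond_true, cond_false, direction]
  rw [Finset.sum_apply, Finset.sum_eq_single j]
  · simp only [Pi.add_apply, Pi.smul_apply, Pi.single_eq_same, Complex.real_smul, mul_one]
    rw [add_comm, Complex.re_add_im]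
  · intro i _ hi
    simp [hi.symm]
  · simp

theorem sum_sq_coordinate (v : Fin d → ℂ) : ∑ k, coordinate k v ^ 2 = ∑ i, ‖v i‖ ^ 2 := by
  rw [Fintype.sum_prod_type]
  refine Finset.sum_congr rfl fun i _ => ?_
  simp only [Fintype.sum_bool, coordinate_eq, cond_true, cond_false]
  rw [Complex.sq_norm, Complex.normSq_apply]
  ring

theorem trunc_eq_sum {u : FormalField d} (hu : IsSolenoidal u) (N : ℕ) :
    (hu.trunc N).coeff = ∑ z ∈ cube d N, ∑ k, coordinate k (u z) •
      (TestField.mode z (direction k)).coeff := by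
  have h1 (z : Fin d → ℤ) : ∑ k, coordinate k (u z) • (TestField.mode z (direction k)).coeff =
      Finsupp.single z ((1 / 2 : ℝ) • u z) + Finsupp.single (-z) ((1 / 2 : ℝ) • star (u z)) := by
    have h2 : ∑ k, coordinate k (u z) • leray z (direction k) = u z := by
      rw [← leray_of_solenoidal hu z]
      conv_rhs => rw [← sum_coordinate_smul (u z)]
      simp only [map_sum, map_smul, leray_of_solenoidal hu z]
    have h3 : ∑ k, coordinate k (u z) • star (leray z (direction k)) = star (u z) := by
      conv_rhs => rw [← h2]
      simp only [star_sum, star_smul, star_trivial]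
    simp only [TestField.mode, smul_add, Finsupp.smul_single, Finset.sum_add_distrib,
      smul_comm _ (1 / 2 : ℝ)]
    rw [← Finsupp.single_finsetSum, ← Finsupp.single_finsetSum, ← Finset.smul_sum,
      ← Finset.smul_sum, h2, h3]
  ext w i
  simp only [h1]
  rw [IsSolenoidal.trunc_coeff]
  simp only [Finset.sum_add_distrib, Finsupp.add_apply, Finsupp.finsetSum_apply,
    Finsupp.single_apply, Pi.add_apply]
  rw [Finset.sum_ite_eq']
  have h4 : ∑ z ∈ cube d N, (if -z = w then (1 / 2 : ℝ) • star (u z) else 0) =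
      if w ∈ cube d N then (1 / 2 : ℝ) • star (u (-w)) else 0 := by
    simp only [neg_eq_iff_eq_neg]
    rw [Finset.sum_ite_eq']
    have : -w ∈ cube d N ↔ w ∈ cube d N := by simp [mem_cube]
    simp only [this]
  rw [h4, cubeSymbol]
  simp only [mem_cube]
  split_ifs
  · simp only [Pi.smul_apply, Pi.star_apply, RCLike.star_def, hu.real, neg_neg, one_mul,
      Complex.real_smul]
    push_cast
    ring
  · simp

/-- The value of the partial derivative at a point as a linear function of the coefficients. -/
def derivLin (j i : Fin d) (x : UnitAddTorus (Fin d)) :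
    ((Fin d → ℤ) →₀ (Fin d → ℂ)) →ₗ[ℝ] ℝ :=
  Finsupp.lsum ℝ fun z =>
    { toFun := fun v => (2 * Real.pi * Complex.I * (z j : ℂ) * v i *
        UnitAddTorus.mFourier z x).re
      map_add' := fun v v' => by
        rw [← Complex.add_re, Pi.add_apply]
        congr 1
        ring
      map_smul' := fun a v => by
        rw [RingHom.id_apply, smul_eq_mul, ← Complex.re_ofReal_mul, Pi.smul_apply,
          Complex.real_smul]
        congr 1
        ring }

theorem derivLin_coeff (φ : TestField d) (j i : Fin d) (x : UnitAddTorus (Fin d)) :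
    derivLin j i x φ.coeff = φ.partialDeriv j i x := by
  rw [TestField.partialDeriv, Complex.re_sum]
  rfl

variable {p : ℝ} [Fact (1 < p)]

theorem drift_trunc (hd : 0 < d) (hp : 2 ≤ p) (hdp : 1 + (d : ℝ) / 2 ≤ p) {ν : ℝ}
    (hν : 0 ≤ ν) (u : V d (ENNReal.ofReal p) 1) {c : FormalField d} (hc : IsSolenoidal c) (N : ℕ) :
    drift ν p (V.coeff 1 u) (hc.trunc N) = ∑ z ∈ cube d N, ∑ k, coordinate k (c z) *
      drift ν p (V.coeff 1 u) (TestField.mode z (direction k)) := by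
  have h1 (j i : Fin d) (x : UnitAddTorus (Fin d)) : (hc.trunc N).partialDeriv j i x =
      ∑ z ∈ cube d N, ∑ k, coordinate k (c z) *
        (TestField.mode z (direction k)).partialDeriv j i x := by
    rw [← derivLin_coeff, trunc_eq_sum]
    simp only [map_sum, map_smul, derivLin_coeff, smul_eq_mul]
  have hi (i j : Fin d) (φ : TestField d) := integrable_mul_Lp (memLp_flux hd hp hdp hν u i j)
    (memLp_of_continuous (φ.continuous_partialDeriv j i) (ENNReal.ofReal p))
  have h2 (i j : Fin d) : ∫ x, flux ν u i j x * (hc.trunc N).partialDeriv j i x ∂torusMeasure d =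
      ∑ z ∈ cube d N, ∑ k, coordinate k (c z) * ∫ x, flux ν u i j x *
        (TestField.mode z (direction k)).partialDeriv j i x ∂torusMeasure d := by
    have h3 (x : UnitAddTorus (Fin d)) : flux ν u i j x * (hc.trunc N).partialDeriv j i x =
        ∑ z ∈ cube d N, ∑ k, coordinate k (c z) * (flux ν u i j x *
          (TestField.mode z (direction k)).partialDeriv j i x) := by
      simp only [h1, Finset.mul_sum, mul_left_comm (flux ν u i j x)]
    simp only [h3]
    rw [integral_finsetSum _ fun z _ => integrable_finsetSum _ fun k _ => (hi i j _).const_mul _]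
    refine Finset.sum_congr rfl fun z _ => ?_
    rw [integral_finsetSum _ fun k _ => (hi i j _).const_mul _]
    exact Finset.sum_congr rfl fun k _ => integral_const_mul _ _
  simp only [drift_eq hd hp hdp hν, h2, Finset.mul_sum]
  calc _ = ∑ i, ∑ z ∈ cube d N, ∑ j, ∑ k, coordinate k (c z) * ∫ x, flux ν u i j x *
        (TestField.mode z (direction k)).partialDeriv j i x ∂torusMeasure d :=
        Finset.sum_congr rfl fun i _ => Finset.sum_comm
    _ = ∑ z ∈ cube d N, ∑ i, ∑ j, ∑ k, coordinate k (c z) * ∫ x, flux ν u i j x *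
        (TestField.mode z (direction k)).partialDeriv j i x ∂torusMeasure d := Finset.sum_comm
    _ = _ := by
        refine Finset.sum_congr rfl fun z _ => ?_
        exact (Finset.sum_congr rfl fun i _ => Finset.sum_comm).trans Finset.sum_comm

end Modes

/-! ## Pathwise uniqueness -/

section Uniqueness

variable {d : ℕ} {p : ℝ} [Fact (1 < p)]

/-- The energy of the difference of two solutions with the same noise. -/
theorem tendsto_sum_sq (hd : 0 < d) (hp : 2 ≤ p) (hdp : 1 + (d : ℝ) / 2 ≤ p) {ν : ℝ}
    (hν : 0 ≤ ν) {T M M' : ℝ} (hT : 0 ≤ T) {x x' : ℝ → FormalField d}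
    {u u' : ℝ → V d (ENNReal.ofReal p) 1} (hx : IsRegularPath T M x u)
    (hx' : IsRegularPath T M' x' u') (hs : ∀ t ∈ Set.Icc 0 T, IsSolenoidal (x t - x' t))
    (heq : ∀ φ, ∀ t ∈ Set.Icc 0 T, pairing φ (x t - x' t) =
      ∫ s in (0 : ℝ)..t, (drift ν p (V.coeff 1 (u s)) φ - drift ν p (V.coeff 1 (u' s)) φ)) :
    IntervalIntegrable (fun s => 2 * (production ν (u s) (u s - u' s) -
        production ν (u' s) (u s - u' s))) volume 0 T ∧
      ∀ t ∈ Set.Icc 0 T, Filter.Tendsto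
        (fun N => ∑ z ∈ cube d N, ∑ i, ‖(x t - x' t) z i‖ ^ 2) Filter.atTop
        (nhds (∫ s in (0 : ℝ)..t, 2 * (production ν (u s) (u s - u' s) -
          production ν (u' s) (u s - u' s)))) := by
  set G : TestField d → ℝ → ℝ := fun φ s =>
    drift ν p (V.coeff 1 (u s)) φ - drift ν p (V.coeff 1 (u' s)) φ with hG
  set h : ℝ → ℝ := fun s => 2 * (production ν (u s) (u s - u' s) -
    production ν (u' s) (u s - u' s)) with hh
  have hGi (φ : TestField d) : IntervalIntegrable (G φ) volume 0 T := by
    rw [intervalIntegrable_iff_integrableOn_Ioc_of_le hT]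
    exact (hx.integrable_drift hd hp hdp hν φ).sub (hx'.integrable_drift hd hp hdp hν φ)
  let f (z : Fin d → ℤ) (k : Fin d × Bool) (s : ℝ) : ℝ :=
    2 * ((∫ r in (0 : ℝ)..s, G (TestField.mode z (direction k)) r) *
      G (TestField.mode z (direction k)) s)
  have hf (z : Fin d → ℤ) (k : Fin d × Bool) : IntervalIntegrable (f z k) volume 0 T := by
    refine ((hGi _).continuousOn_mul ?_).const_mul 2
    exact intervalIntegral.continuousOn_primitive_interval' (hGi _) Set.left_mem_uIcc
  have hco (z : Fin d → ℤ) (k : Fin d × Bool) (t : ℝ) (ht : t ∈ Set.Icc 0 T) :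
      coordinate k ((x t - x' t) z) =
        ∫ r in (0 : ℝ)..t, G (TestField.mode z (direction k)) r :=
    (pairing_mode (hs t ht) z _).symm.trans (heq _ t ht)
  have hmono (t : ℝ) (ht : t ∈ Set.Icc 0 T) : Set.uIcc 0 t ⊆ Set.uIcc 0 T := by
    rw [← Set.uIcc_of_le hT] at ht
    exact Set.uIcc_subset_uIcc Set.left_mem_uIcc ht
  have hsum (N : ℕ) (t : ℝ) (ht : t ∈ Set.Icc 0 T) :
      ∑ z ∈ cube d N, ∑ i, ‖(x t - x' t) z i‖ ^ 2 =
        ∫ s in (0 : ℝ)..t, ∑ z ∈ cube d N, ∑ k, f z k s := by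
    have hf' (z : Fin d → ℤ) (k : Fin d × Bool) : IntervalIntegrable (f z k) volume 0 t :=
      (hf z k).mono_set (hmono t ht)
    have hf2 (z : Fin d → ℤ) : IntervalIntegrable (fun s => ∑ k, f z k s) volume 0 t :=
      ⟨integrable_finsetSum _ fun k _ => (hf' z k).1, integrable_finsetSum _ fun k _ => (hf' z k).2⟩
    rw [intervalIntegral.integral_finsetSum fun z _ => hf2 z]
    refine Finset.sum_congr rfl fun z _ => ?_
    rw [intervalIntegral.integral_finsetSum fun k _ => hf' z k, ← sum_sq_coordinate]
    refine Finset.sum_congr rfl fun k _ => ?_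
    rw [hco z k t ht]
    exact sq_integral ht (hGi _)
  let H (N : ℕ) (s : ℝ) : ℝ :=
    2 * G ((isSolenoidal_coeff 1 (u s - u' s)).trunc N) s
  have hH : ∀ᵐ s ∂volume.restrict (Set.Ioc 0 T), ∀ N,
      ∑ z ∈ cube d N, ∑ k, f z k s = H N s := by
    filter_upwards [hx.coeff_eq, hx'.coeff_eq, ae_restrict_mem measurableSet_Ioc]
      with s h1 h2 h3 N
    have h4 : V.coeff 1 (u s - u' s) = x s - x' s := by rw [coeff_sub, h1, h2]
    simp only [H, G, drift_trunc hd hp hdp hν, h4, Finset.mul_sum, ← Finset.sum_sub_distrib]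
    refine Finset.sum_congr rfl fun z _ => Finset.sum_congr rfl fun k _ => ?_
    rw [hco z k s (Set.Ioc_subset_Icc_self h3)]
    simp only [f, G]
    ring
  have hlim : ∀ᵐ s ∂volume.restrict (Set.Ioc 0 T), Filter.Tendsto
      (fun N => ∑ z ∈ cube d N, ∑ k, f z k s) Filter.atTop (nhds (h s)) := by
    filter_upwards [hH] with s h1
    simp only [h1]
    exact ((tendsto_drift_trunc hd hp hdp hν _ _).sub
      (tendsto_drift_trunc hd hp hdp hν _ _)).const_mul 2
  obtain ⟨B, hB, hBb⟩ := hx.exists_flux_bound hd hp hdp hν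
  obtain ⟨B', hB', hBb'⟩ := hx'.exists_flux_bound hd hp hdp hν
  have hp0 : 0 < p := one_pos.trans Fact.out
  have hw : Integrable (fun s => ‖u s - u' s‖ ^ p) (volume.restrict (Set.Ioc 0 T)) := by
    have := (hx.memLp.sub hx'.memLp).integrable_norm_rpow (by simpa using hp0)
      ENNReal.ofReal_ne_top
    rwa [ENNReal.toReal_ofReal hp0.le] at this
  let D (s : ℝ) : ℝ := d * (d * ((cubeNorm d p * besselNorm d p) ^ p * ‖u s - u' s‖ ^ p))
  have hDi : Integrable D (volume.restrict (Set.Ioc 0 T)) :=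
    ((hw.const_mul _).const_mul (d : ℝ)).const_mul (d : ℝ)
  let C (s : ℝ) : ℝ := 2 * ((B s + D s) + (B' s + D s))
  have hC : Integrable C (volume.restrict (Set.Ioc 0 T)) :=
    ((hB.add hDi).add (hB'.add hDi)).const_mul 2
  have hbound : ∀ᵐ s ∂volume.restrict (Set.Ioc 0 T), ∀ N,
      ‖∑ z ∈ cube d N, ∑ k, f z k s‖ ≤ C s := by
    filter_upwards [hH, hBb, hBb'] with s h1 h2 h3 N
    have h4 : ∑ i, ∑ j, ∫ y, |((isSolenoidal_coeff 1 (u s - u' s)).trunc N).partialDeriv j i y| ^ p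
        ∂torusMeasure d ≤ D s := by
      calc _ ≤ ∑ _i : Fin d, ∑ _j : Fin d,
            (cubeNorm d p * besselNorm d p) ^ p * ‖u s - u' s‖ ^ p :=
            Finset.sum_le_sum fun i _ => Finset.sum_le_sum fun j _ =>
              integral_trunc_partialDeriv_le hp _ N j i
        _ = _ := by simp only [Finset.sum_const, Finset.card_univ, Fintype.card_fin,
            nsmul_eq_mul, D]
    rw [h1, Real.norm_eq_abs, abs_mul, abs_two]
    refine mul_le_mul_of_nonneg_left ((abs_sub _ _).trans ?_) two_pos.le
    exact add_le_add ((h2 _).trans (add_le_add le_rfl h4)) ((h3 _).trans (add_le_add le_rfl h4))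
  have hmeas (N : ℕ) : AEStronglyMeasurable (fun s => ∑ z ∈ cube d N, ∑ k, f z k s)
      (volume.restrict (Set.Ioc 0 T)) := by
    refine Finset.aestronglyMeasurable_fun_sum _ fun z _ =>
      Finset.aestronglyMeasurable_fun_sum _ fun k _ => ?_
    exact ((intervalIntegrable_iff_integrableOn_Ioc_of_le hT).mp (hf z k)).1
  have hhi : Integrable h (volume.restrict (Set.Ioc 0 T)) := by
    refine hC.mono' (aestronglyMeasurable_of_tendsto_ae Filter.atTop hmeas hlim) ?_
    filter_upwards [hlim, hbound] with s h1 h2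
    exact le_of_tendsto h1.norm (.of_forall h2)
  refine ⟨(intervalIntegrable_iff_integrableOn_Ioc_of_le hT).mpr hhi, fun t ht => ?_⟩
  have hsub : Set.Ioc 0 t ⊆ Set.Ioc 0 T := Set.Ioc_subset_Ioc_right ht.2
  have hle := Measure.restrict_mono_set volume hsub
  simp only [hsum _ t ht, intervalIntegral.integral_of_le ht.1]
  exact tendsto_integral_of_dominated_convergence C (fun N => (hmeas N).mono_measure hle)
    (hC.mono_measure hle) (fun N => ae_mono hle (hbound.mono fun s h1 => h1 N)) (ae_mono hle hlim)

theorem IsRegularPath.eq_of_eq_noise (hd : 0 < d) (hp : 2 ≤ p) (hdp : 1 + (d : ℝ) / 2 ≤ p) {ν : ℝ}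
    (hν : 0 < ν) {T M M' : ℝ} (hT : 0 ≤ T) {x x' : ℝ → FormalField d}
    {u u' : ℝ → V d (ENNReal.ofReal p) 1} (hx : IsRegularPath T M x u)
    (hx' : IsRegularPath T M' x' u') (hs : ∀ t ∈ Set.Icc 0 T, IsSolenoidal (x t - x' t))
    (heq : ∀ φ, ∀ t ∈ Set.Icc 0 T, pairing φ (x t - x' t) =
      ∫ s in (0 : ℝ)..t, (drift ν p (V.coeff 1 (u s)) φ - drift ν p (V.coeff 1 (u' s)) φ)) :
    ∀ t ∈ Set.Icc 0 T, x t = x' t := by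
  obtain ⟨hi, hlim⟩ := tendsto_sum_sq hd hp hdp hν.le hT hx hx' hs heq
  obtain ⟨K, hK, hKb⟩ := exists_production_sub_le hd hp hdp hν
  set E : ℝ → ℝ := fun t => ∫ s in (0 : ℝ)..t, 2 * (production ν (u s) (u s - u' s) -
    production ν (u' s) (u s - u' s)) with hE
  have hmono (t : ℝ) : Monotone fun N => ∑ z ∈ cube d N, ∑ i, ‖(x t - x' t) z i‖ ^ 2 := by
    intro N N' hN
    refine Finset.sum_le_sum_of_subset_of_nonneg (fun z hz => ?_) fun z _ _ => by positivity
    rw [mem_cube] at hz ⊢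
    exact fun i => (hz i).trans (by exact_mod_cast hN)
  have hle (t : ℝ) (ht : t ∈ Set.Icc 0 T) (N : ℕ) :
      ∑ z ∈ cube d N, ∑ i, ‖(x t - x' t) z i‖ ^ 2 ≤ E t :=
    (hmono t).ge_of_tendsto (hlim t ht) N
  have hE0 (t : ℝ) (ht : t ∈ Set.Icc 0 T) : 0 ≤ E t :=
    le_trans (by positivity) (hle t ht 0)
  have hEe : ∀ᵐ t ∂volume.restrict (Set.Ioc 0 T), E t = energy (u t - u' t) := by
    filter_upwards [hx.coeff_eq, hx'.coeff_eq, ae_restrict_mem measurableSet_Ioc] with t h1 h2 h3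
    have h4 : V.coeff 1 (u t - u' t) = x t - x' t := by rw [coeff_sub, h1, h2]
    have h5 := (hasSum_energy hp (u t - u' t)).comp (tendsto_cube_atTop (d := d))
    simp only [Function.comp_def, h4] at h5
    exact tendsto_nhds_unique (hlim t (Set.Ioc_subset_Icc_self h3)) h5
  have hEc : ContinuousOn E (Set.Icc 0 T) := by
    have := intervalIntegral.continuousOn_primitive_interval' hi Set.left_mem_uIcc
    rwa [Set.uIcc_of_le hT] at this
  let k (s : ℝ) : ℝ := 2 * (K * ‖u' s‖ ^ p)
  have hki : IntervalIntegrable k volume 0 T :=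
    (intervalIntegrable_iff_integrableOn_Ioc_of_le hT).mpr
      ((hx'.integrable_norm_rpow.const_mul K).const_mul 2)
  have hEk (t : ℝ) (ht : t ∈ Set.Icc 0 T) : E t ≤ ∫ s in (0 : ℝ)..t, k s * E s := by
    have hsub : Set.uIcc 0 t ⊆ Set.uIcc 0 T := by
      rw [← Set.uIcc_of_le hT] at ht
      exact Set.uIcc_subset_uIcc Set.left_mem_uIcc ht
    have hkE : IntervalIntegrable (fun s => k s * E s) volume 0 T := by
      refine hki.mul_continuousOn ?_
      rwa [Set.uIcc_of_le hT]
    refine intervalIntegral.integral_mono_ae_restrict ht.1 (hi.mono_set hsub) (hkE.mono_set hsub) ?_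
    rw [← Measure.restrict_congr_set (Ioc_ae_eq_Icc (α := ℝ) (μ := volume))]
    filter_upwards [ae_restrict_of_ae_restrict_of_subset (Set.Ioc_subset_Ioc_right ht.2) hEe]
      with s h1
    rw [h1]
    have := hKb (u s) (u' s)
    simp only [k]
    linarith
  have hz := eq_zero_of_le_integral hT hEc hE0 hki (fun s => by positivity) hEk
  intro t ht
  funext z
  have h1 : z ∈ cube d (∑ i, (z i).natAbs) := by
    rw [mem_cube]
    intro i
    rw [Int.abs_eq_natAbs, Nat.cast_le]
    exact Finset.single_le_sum (f := fun i => (z i).natAbs) (fun _ _ => Nat.zero_le _)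
      (Finset.mem_univ i)
  have h2 := hle t ht (∑ i, (z i).natAbs)
  rw [hz t ht] at h2
  have h3 := (Finset.single_le_sum (f := fun z => ∑ i, ‖(x t - x' t) z i‖ ^ 2)
    (fun z _ => by positivity) h1).trans h2
  funext i
  have h4 := (Finset.single_le_sum (f := fun i => ‖(x t - x' t) z i‖ ^ 2)
    (fun i _ => by positivity) (Finset.mem_univ i)).trans h3
  have h5 : ‖(x t - x' t) z i‖ = 0 := by
    have := le_antisymm h4 (sq_nonneg _)
    exact pow_eq_zero_iff two_ne_zero |>.mp this
  exact sub_eq_zero.mp (norm_eq_zero.mp h5)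

theorem IsSolenoidal.eq_zero_of_dim_one {c : FormalField 1} (hc : IsSolenoidal c) : c = 0 := by
  funext z i
  by_cases hz : z = 0
  · rw [hz, hc.mean_zero]
    rfl
  · have h1 := hc.div_free z
    rw [Fin.sum_univ_one] at h1
    have h2 : z 0 ≠ 0 := fun h => hz (funext fun j => by rw [Subsingleton.elim j 0, h]; rfl)
    rw [Subsingleton.elim i 0]
    exact (mul_eq_zero.mp h1).resolve_left (by exact_mod_cast h2)

theorem MemC.isSolenoidal {q : ℝ≥0∞} [Fact (1 ≤ q)] {α : ℝ} {x : ℝ → FormalField d}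
    (h : MemC q α x) {t : ℝ} (ht : 0 ≤ t) : IsSolenoidal (x t) := by
  obtain ⟨v, -, hv⟩ := h
  rw [← hv t ht]
  exact isSolenoidal_coeff α (v t)

/-- Two paths driven by the same noise agree. -/
theorem eq_of_eq_noise (hd : 0 < d) (hdp : 1 + (d : ℝ) / 2 ≤ p) {ν : ℝ} (hν : 0 < ν)
    {x x' y : ℝ → FormalField d}
    (hx : MemLpLoc (ENNReal.ofReal p) (ENNReal.ofReal p) 1 x) (hxb : MemLpLoc ∞ 2 0 x)
    (hx' : MemLpLoc (ENNReal.ofReal p) (ENNReal.ofReal p) 1 x') (hxb' : MemLpLoc ∞ 2 0 x')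
    (hs : ∀ t, 0 ≤ t → IsSolenoidal (x t)) (hs' : ∀ t, 0 ≤ t → IsSolenoidal (x' t))
    (he : ∀ (φ : TestField d) (t : ℝ), 0 ≤ t → pairing φ (x t) = pairing φ (x 0) +
      (∫ s in (0 : ℝ)..t, drift ν p (x s) φ) + pairing φ (y t))
    (he' : ∀ (φ : TestField d) (t : ℝ), 0 ≤ t → pairing φ (x' t) = pairing φ (x' 0) +
      (∫ s in (0 : ℝ)..t, drift ν p (x' s) φ) + pairing φ (y t))
    (h0 : x 0 = x' 0) {t : ℝ} (ht : 0 ≤ t) : x t = x' t := by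
  rcases Nat.lt_or_ge 1 d with hd1 | hd1
  · have hp : 2 ≤ p := by
      have : (2 : ℝ) ≤ d := by exact_mod_cast hd1
      linarith
    rcases ht.eq_or_lt with rfl | htp
    · exact h0
    obtain ⟨M, u, hu⟩ := exists_isRegularPath hp hx hxb htp
    obtain ⟨M', u', hu'⟩ := exists_isRegularPath hp hx' hxb' htp
    refine hu.eq_of_eq_noise hd hp hdp hν ht hu' (fun s h1 => (hs s h1.1).sub (hs' s h1.1)) ?_ t
      ⟨ht, le_rfl⟩
    intro φ s h1
    have hsub : Set.Ioc 0 s ⊆ Set.Ioc 0 t := Set.Ioc_subset_Ioc_right h1.2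
    have hle := Measure.restrict_mono_set volume hsub
    have h2 : ∫ r in (0 : ℝ)..s, drift ν p (x r) φ =
        ∫ r in (0 : ℝ)..s, drift ν p (V.coeff 1 (u r)) φ := by
      rw [intervalIntegral.integral_of_le h1.1, intervalIntegral.integral_of_le h1.1]
      refine integral_congr_ae ?_
      filter_upwards [ae_mono hle hu.coeff_eq] with r hr
      rw [hr]
    have h3 : ∫ r in (0 : ℝ)..s, drift ν p (x' r) φ =
        ∫ r in (0 : ℝ)..s, drift ν p (V.coeff 1 (u' r)) φ := by
      rw [intervalIntegral.integral_of_le h1.1, intervalIntegral.integral_of_le h1.1]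
      refine integral_congr_ae ?_
      filter_upwards [ae_mono hle hu'.coeff_eq] with r hr
      rw [hr]
    rw [pairing_sub, he φ s h1.1, he' φ s h1.1, h0, h2, h3, intervalIntegral.integral_sub]
    · ring
    · exact (intervalIntegrable_iff_integrableOn_Ioc_of_le h1.1).mpr
        ((hu.integrable_drift hd hp hdp hν.le φ).mono_measure hle)
    · exact (intervalIntegrable_iff_integrableOn_Ioc_of_le h1.1).mpr
        ((hu'.integrable_drift hd hp hdp hν.le φ).mono_measure hle)
  · obtain rfl : d = 1 := le_antisymm hd1 hd
    rw [(hs t ht).eq_zero_of_dim_one, (hs' t ht).eq_zero_of_dim_one]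

end Uniqueness

end PowerLawFluid

end

theorem theorem2p2p1 {d : ℕ} (hd : 1 ≤ d) (ν p : ℝ) (hν : 0 < ν) [Fact (1 < p)]
    (hp : 1 + (d : ℝ) / 2 ≤ p)
    (Γ : PowerLawFluid.V d 2 0 →L[ℝ] PowerLawFluid.V d 2 0)
    (hΓ : PowerLawFluid.IsCovariance Γ)
    (μ₀ : Measure (PowerLawFluid.V d 2 0)) [IsProbabilityMeasure μ₀]
    {Ω : Type*} [MeasurableSpace Ω] (P : Measure Ω) [IsProbabilityMeasure P]
    (X X' : ℝ → Ω → PowerLawFluid.FormalField d) (Y : ℝ → Ω → PowerLawFluid.V d 2 0)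
    (hX : PowerLawFluid.IsWeakSolution ν p Γ μ₀ P X Y)
    (hX' : PowerLawFluid.IsWeakSolution ν p Γ μ₀ P X' Y)
    (hXbound : PowerLawFluid.AprioriBound p P X)
    (hX'bound : PowerLawFluid.AprioriBound p P X')
    (h0 : ∀ᵐ ω ∂P, X 0 ω = X' 0 ω) :
    ∀ᵐ ω ∂P, ∀ t : ℝ, 0 ≤ t → X t ω = X' t ω := by
  obtain ⟨β, -, hc⟩ := hX.memC
  obtain ⟨β', -, hc'⟩ := hX'.memC
  filter_upwards [hX.memLp, hX'.memLp, hX.memLinfty, hX'.memLinfty, hc, hc', hX.equation,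
    hX'.equation, h0] with ω h1 h1' h2 h2' h3 h3' h4 h4' h5 t ht
  exact PowerLawFluid.eq_of_eq_noise (x := fun t => X t ω) (x' := fun t => X' t ω)
    (y := fun t => PowerLawFluid.V.coeff 0 (Y t ω)) hd hp hν h1 h2 h1' h2'
    (fun _ => h3.isSolenoidal) (fun _ => h3'.isSolenoidal) h4 h4' h5 ht
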